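/- **Theorem (Computational complexity of FMT\*).** Let $d\ge 2$, let $\mathcal X=[0,1]^d$, and let $\mathcal X_{\text{obs}}\subseteq\mathcal X$ be an obstacle region such that $\mathcal X\setminus\mathcal X_{\text{obs}}$ is open and $\partial\mathcal X\subseteq\mathcal X_{\text{obs}}$. Put $\mathcal X_{\text{free}}=\mathrm{cl}(\mathcal X\setminus\mathcal X_{\text{obs}})$, let $x_{\text{init}}\in\mathcal X_{\text{free}}$, and let $\mathcal X_{\text{goal}}\subseteq\mathcal X_{\text{free}}$ be open. Assume that the obstacles have finite surface area, in the sense that for some constant $S$ and all $s>0$ the set of points of $\mathcal X_{\text{free}}$ at distance less than $s$ from $\mathcal X_{\text{obs}}$ has Lebesgue measure at most $S\,s$. Fix $\gamma>0$ and put $r_n=\gamma\,(\log(n)/n)^{1/d}$. Let $V$ consist of $x_{\text{init}}$ and $n$ independent samples from the uniform distribution on $\mathcal X_{\text{free}}$. FMT\* on $V$ with radius $r_n$ grows a tree rooted at $x_{\text{init}}$, with cost-to-arrive $c(x_{\text{init}})=0$. Initially $V_{\text{open}}=\{x_{\text{init}}\}$, $V_{\text{unvisited}}=V\setminus\{x_{\text{init}}\}$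 and $z=x_{\text{init}}$. While $z\notin\mathcal X_{\text{goal}}$: for each $x\in V_{\text{unvisited}}$ with $\|x-z\|<r_n$ (this list being fixed before the pass over it), it chooses $y_{\min}$ minimizing $c(y)+\|x-y\|$ over all $y\in V_{\text{open}}$ with $\|x-y\|<r_n$ and calls $\texttt{CollisionFree}(y_{\min},x)$, which tells whether the segment from $y_{\min}$ to $x$ avoids $\mathcal X_{\text{obs}}$; if it does, the edge $(y_{\min},x)$ is added to the tree, $c(x)=c(y_{\min})+\|x-y_{\min}\|$, and $x$ is removed from $V_{\text{unvisited}}$. After all these $x$ have been treated, the newly connected ones are added to $V_{\text{open}}$ and $z$ is removed from it; if $V_{\text{open}}$ is then empty, failure is returned; otherwise $z$ becomes a node of $V_{\text{open}}$ of least cost $c(z)$. When $z\in\mathcal X_{\text{goal}}$, the path from $x_{\text{init}}$ to $z$ in the tree is returned. Then, as $n\to\infty$, with constants that may depend on $d$, on the planning problem and on $\gamma$: 1. There is an implementation of FMT\* (one program for all $d$, all planning problems and all $\gamma$, on a random access machine with exact real arithmetic including square roots, in which calls to $\texttt{CollisionFree}$ and tests for membership in $\mathcal X_{\text{goal}}$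 cost one step; the input is $n$, $d$, $V$ and $r_n$) that takes $O(n\log n)$ expected time and $O(n\log n)$ expected space. On every sample set in $\mathcal X_{\text{free}}$ it halts, and its result and its calls to $\texttt{CollisionFree}$ are those of a run of FMT\*. 2. FMT\* makes $O(n)$ expected calls to $\texttt{CollisionFree}$, whatever the order in which the nodes $x$ are treated and however ties between minimizers are broken. 3. In comparison, PRM\* on the same $V$ and with the same radius, which calls $\texttt{CollisionFree}$ for every ordered pair of distinct nodes at distance less than $r_n$, makes $O(n\log n)$ expected calls. -/

import Mathlib

open MeasureTheory Filter Set
open scoped ENNReal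

noncomputable section

/-! ## Path planning problems -/

/-- The unit cube `[0, 1]^d`. -/
def unitCube (d : ℕ) : Set (EuclideanSpace ℝ (Fin d)) :=
  {x | ∀ i, 0 ≤ x i ∧ x i ≤ 1}

/-- A path planning problem in the configuration space `[0, 1]^d`. The obstacle-free space is the
closure of `[0, 1]^d` minus the obstacle region. -/
structure PlanningProblem (d : ℕ) where
  /-- obstacle region -/
  obs : Set (EuclideanSpace ℝ (Fin d))
  /-- initial condition -/
  init : EuclideanSpace ℝ (Fin d)
  /-- goal region -/
  goal : Set (EuclideanSpace ℝ (Fin d))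
  obs_subset : obs ⊆ unitCube d
  isOpen_diff : IsOpen (unitCube d \ obs)
  frontier_subset : frontier (unitCube d) ⊆ obs
  init_mem : init ∈ closure (unitCube d \ obs)
  isOpen_goal : IsOpen goal
  goal_subset : goal ⊆ closure (unitCube d \ obs)

namespace PlanningProblem

variable {d : ℕ} (Q : PlanningProblem d)

/-- The obstacle-free space. -/
def free : Set (EuclideanSpace ℝ (Fin d)) := closure (unitCube d \ Q.obs)

/-- The straight line joining `u` and `v` does not intersect an obstacle. -/
def CollisionFree (u v : EuclideanSpace ℝ (Fin d)) : Prop := Disjoint (segment ℝ u v) Q.obs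

/-- The obstacles have finite surface area: the part of the free space within distance `s` of the
obstacles is a thin shell, whose volume is at most a constant times `s`. -/
def FiniteObstacleSurface : Prop :=
  ∃ S : ℝ, ∀ s : ℝ, 0 < s →
    volume (Q.free ∩ Metric.thickening s Q.obs) ≤ ENNReal.ofReal (S * s)

/-- The law of `n` independent samples from the uniform distribution on the free space. -/
def sampleLaw (n : ℕ) : Measure (Fin n → EuclideanSpace ℝ (Fin d)) :=
  Measure.pi fun _ => ProbabilityTheory.cond volume Q.free

/-- The sample set `V` for the samples `ω`: the nodes are numbered `0, …, n`, node `0` is the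
initial condition and node `k + 1` is the `k`-th sample. (Numbers above `n` are not nodes.) -/
def node {n : ℕ} (ω : Fin n → EuclideanSpace ℝ (Fin d)) : ℕ → EuclideanSpace ℝ (Fin d)
  | 0 => Q.init
  | k + 1 => if h : k < n then ω ⟨k, h⟩ else Q.init

end PlanningProblem

/-- The connection radius `γ (log n / n)^(1/d)`. -/
def connectionRadius (γ : ℝ) (d n : ℕ) : ℝ :=
  γ * (Real.log n / n) ^ (1 / (d : ℝ))

/-- The expected value of `f`, as an upper integral, so that an upper bound for it is meaningful
without knowing beforehand that `f` is measurable. -/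
def expectation {Ω : Type*} [MeasurableSpace Ω] (μ : Measure Ω) (f : Ω → ℝ≥0∞) : ℝ≥0∞ :=
  ⨅ (g : Ω → ℝ≥0∞) (_ : Measurable g) (_ : f ≤ᵐ[μ] g), ∫⁻ ω, g ω ∂μ

theorem expectation_eq_lintegral {Ω : Type*} [MeasurableSpace Ω] (μ : Measure Ω) (f : Ω → ℝ≥0∞)
    (hf : Measurable f) : expectation μ f = ∫⁻ ω, f ω ∂μ := by
  apply le_antisymm
  · exact iInf_le_of_le f (iInf_le_of_le hf (iInf_le _ (Eventually.of_forall fun _ => le_rfl)))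
  · exact le_iInf fun g => le_iInf fun _ => le_iInf fun h => lintegral_mono_ae h

/-! ## The Fast Marching Tree algorithm

Nodes are numbered `0, …, n`; `p k` is the position of node `k`, node `0` is the root. Whatever the
pseudocode leaves open (the order in which a set is traversed, the choice among several
minimizers) is left open here as well: a run is any run that the pseudocode permits. -/

namespace FMT

open Classical in
/-- `Near(V \ {v}, v, r)`. -/
def near {d : ℕ} (n : ℕ) (p : ℕ → EuclideanSpace ℝ (Fin d)) (r : ℝ) (v : ℕ) : Finset ℕ :=
  (Finset.range (n + 1)).filter fun u => u ≠ v ∧ dist (p u) (p v) < r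

/-- The variables of the algorithm. The field `calls` is the list of all calls to
`CollisionFree` made so far, in order and with repetitions. -/
structure State where
  unvisited : Finset ℕ
  opened : Finset ℕ
  openNew : Finset ℕ
  closed : Finset ℕ
  edges : Finset (ℕ × ℕ)
  cost : ℕ → ℝ
  z : ℕ
  calls : List (ℕ × ℕ)

/-- The initialization. -/
def start (n : ℕ) : State where
  unvisited := (Finset.range (n + 1)).erase 0
  opened := {0}
  openNew := ∅
  closed := ∅
  edges := ∅
  cost := fun _ => 0
  z := 0
  calls := []

variable {d : ℕ} (Q : PlanningProblem d) (n : ℕ) (p : ℕ → EuclideanSpace ℝ (Fin d)) (r : ℝ)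

/-- `y` minimizes `c(y) + Cost(y, x)` over `Y_near = N_x ∩ V_open`. -/
def IsBestParent (s : State) (x y : ℕ) : Prop :=
  y ∈ near n p r x ∩ s.opened ∧
    ∀ y' ∈ near n p r x ∩ s.opened,
      s.cost y + dist (p y) (p x) ≤ s.cost y' + dist (p y') (p x)

/-- The body of the for loop: the consideration of one node `x`. -/
inductive Consider (x : ℕ) : State → State → Prop
  | connect (s : State) (y : ℕ) (hy : IsBestParent n p r s x y)
      (hfree : Q.CollisionFree (p y) (p x)) :
      Consider x s
        { s with
          edges := insert (y, x) s.edges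
          openNew := insert x s.openNew
          unvisited := s.unvisited.erase x
          cost := Function.update s.cost x (s.cost y + dist (p y) (p x))
          calls := s.calls ++ [(y, x)] }
  | reject (s : State) (y : ℕ) (hy : IsBestParent n p r s x y)
      (hcoll : ¬ Q.CollisionFree (p y) (p x)) :
      Consider x s { s with calls := s.calls ++ [(y, x)] }

/-- The for loop, over a list of nodes. -/
inductive ForLoop : List ℕ → State → State → Prop
  | nil (s : State) : ForLoop [] s s
  | cons (x : ℕ) (l : List ℕ) (s t u : State) (hx : Consider Q n p r x s t)
      (hl : ForLoop l t u) : ForLoop (x :: l) s u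

/-- The body of the while loop, up to the test whether `V_open` is empty: the nodes of
`X_near = N_z ∩ V_unvisited` are considered, each once, and `z` is closed. -/
inductive Iteration : State → State → Prop
  | mk (s t : State) (l : List ℕ) (hl : l.Nodup)
      (hmem : ∀ x, x ∈ l ↔ x ∈ near n p r s.z ∩ s.unvisited)
      (hloop : ForLoop Q n p r l { s with openNew := ∅ } t) :
      Iteration s
        { t with
          opened := (t.opened ∪ t.openNew).erase s.z
          closed := insert s.z t.closed }

/-- `path` is the list of nodes on a path from the root to `z` along edges of the tree. -/
def IsTreePath (edges : Finset (ℕ × ℕ)) (z : ℕ) (path : List ℕ) : Prop :=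
  path.head? = some 0 ∧ path.getLast? = some z ∧ path.IsChain fun a b => (a, b) ∈ edges

/-- The while loop, with the result that is returned (`none` for failure) and the list of all calls
to `CollisionFree`. -/
inductive WhileLoop : State → Option (List ℕ) → List (ℕ × ℕ) → Prop
  | success (s : State) (path : List ℕ) (hgoal : p s.z ∈ Q.goal)
      (hpath : IsTreePath s.edges s.z path) : WhileLoop s (some path) s.calls
  | failure (s t : State) (hgoal : p s.z ∉ Q.goal) (hit : Iteration Q n p r s t)
      (hempty : t.opened = ∅) : WhileLoop s none t.calls
  | step (s t : State) (z : ℕ) (result : Option (List ℕ)) (calls : List (ℕ × ℕ))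
      (hgoal : p s.z ∉ Q.goal) (hit : Iteration Q n p r s t)
      (hz : z ∈ t.opened) (hmin : ∀ y ∈ t.opened, t.cost z ≤ t.cost y)
      (hrest : WhileLoop { t with z := z } result calls) : WhileLoop s result calls

/-- A complete run of FMT* on the samples `ω` with radius `r`. -/
def IsRun (ω : Fin n → EuclideanSpace ℝ (Fin d)) (result : Option (List ℕ))
    (calls : List (ℕ × ℕ)) : Prop :=
  WhileLoop Q n (Q.node ω) r (start n) result calls

/-- The number of calls to `CollisionFree` made by FMT* on the samples `ω` with radius `r` (the
largest one, over all runs that the pseudocode permits). -/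
def collisionCalls (ω : Fin n → EuclideanSpace ℝ (Fin d)) : ℝ≥0∞ :=
  ⨆ (result : Option (List ℕ)) (calls : List (ℕ × ℕ)) (_ : IsRun Q n r ω result calls),
    (calls.length : ℝ≥0∞)

end FMT

open Classical in
/-- The calls to `CollisionFree` made by PRM* on nodes `0, …, n` with connection radius `r`: for
every node `v`, one call for every other node `u` at distance less than `r`. -/
def prmStarCalls {d : ℕ} (n : ℕ) (p : ℕ → EuclideanSpace ℝ (Fin d)) (r : ℝ) : List (ℕ × ℕ) :=
  (List.range (n + 1)).flatMap fun v =>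
    ((List.range (n + 1)).filter fun u => u ≠ v ∧ dist (p u) (p v) < r).map fun u => (v, u)

/-! ## Random access machines with real arithmetic

The memory consists of integer arrays and real arrays. A program names finitely many of them. An
operation on integers (addition, truncated subtraction, halving), an operation on reals
(field operations, square root), a comparison, a memory access, a call to `CollisionFree` and
a test for membership in the goal region take one step each. There is no rounding of reals. -/

namespace RAM

/-- Integer expressions; `get a i` is the entry of integer array `a` with index `i`. -/
inductive IntExp
  | lit (k : ℕ)
  | get (a : ℕ) (i : IntExp)
  | add (e f : IntExp)
  | sub (e f : IntExp)
  | half (e : IntExp)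

/-- Real expressions; `get a i` is the entry of real array `a` with index `i`. -/
inductive RealExp
  | ofInt (e : IntExp)
  | get (a : ℕ) (i : IntExp)
  | add (e f : RealExp)
  | sub (e f : RealExp)
  | mul (e f : RealExp)
  | div (e f : RealExp)
  | sqrt (e : RealExp)

/-- Tests. -/
inductive Test
  | intEq (e f : IntExp)
  | intLt (e f : IntExp)
  | realLt (e f : RealExp)
  | neg (b : Test)
  | conj (b c : Test)

/-- Programs. -/
inductive Program
  | skip
  | setInt (a : ℕ) (i e : IntExp)
  | setReal (a : ℕ) (i : IntExp) (e : RealExp)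
  /-- `a[i] := 1` if the line joining nodes `u` and `v` is collision-free, `a[i] := 0` if not -/
  | collisionFree (a : ℕ) (i u v : IntExp)
  /-- `a[i] := 1` if node `u` lies in the goal region, `a[i] := 0` if not -/
  | inGoal (a : ℕ) (i u : IntExp)
  | seq (P R : Program)
  | branch (b : Test) (P R : Program)
  | loop (b : Test) (P : Program)

/-- Machine configurations: the memory, the number of steps so far, the memory size so far (one
plus the largest index that occurs, in any of the finitely many arrays) and the calls to
`CollisionFree` so far. -/
structure Config where
  ints : ℕ → ℕ → ℕ
  reals : ℕ → ℕ → ℝ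
  time : ℕ
  space : ℕ
  calls : List (ℕ × ℕ)

namespace IntExp

/-- The value of an integer expression. -/
def eval (s : Config) : IntExp → ℕ
  | lit k => k
  | get a i => s.ints a (eval s i)
  | add e f => eval s e + eval s f
  | sub e f => eval s e - eval s f
  | half e => eval s e / 2

/-- The number of operations in an integer expression. -/
def size : IntExp → ℕ
  | lit _ => 1
  | get _ i => size i + 1
  | add e f => size e + size f + 1
  | sub e f => size e + size f + 1
  | half e => size e + 1

end IntExp

namespace RealExp

/-- The value of a real expression. -/
def eval (s : Config) : RealExp → ℝ
  | ofInt e => (e.eval s : ℝ)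
  | get a i => s.reals a (i.eval s)
  | add e f => eval s e + eval s f
  | sub e f => eval s e - eval s f
  | mul e f => eval s e * eval s f
  | div e f => eval s e / eval s f
  | sqrt e => Real.sqrt (eval s e)

/-- The number of operations in a real expression. -/
def size : RealExp → ℕ
  | ofInt e => e.size + 1
  | get _ i => i.size + 1
  | add e f => size e + size f + 1
  | sub e f => size e + size f + 1
  | mul e f => size e + size f + 1
  | div e f => size e + size f + 1
  | sqrt e => size e + 1

end RealExp

namespace Test

/-- The truth of a test. -/
def Holds (s : Config) : Test → Prop
  | intEq e f => e.eval s = f.eval s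
  | intLt e f => e.eval s < f.eval s
  | realLt e f => e.eval s < f.eval s
  | neg b => ¬ Holds s b
  | conj b c => Holds s b ∧ Holds s c

/-- The number of operations in a test. -/
def size : Test → ℕ
  | intEq e f => e.size + f.size + 1
  | intLt e f => e.size + f.size + 1
  | realLt e f => e.size + f.size + 1
  | neg b => size b + 1
  | conj b c => size b + size c + 1

end Test

namespace Config

/-- Let `k` steps pass. -/
def tick (s : Config) (k : ℕ) : Config := { s with time := s.time + k }

/-- Write to an integer array. -/
def writeInt (s : Config) (a i v : ℕ) : Config :=
  { s with
    ints := Function.update s.ints a (Function.update (s.ints a) i v)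
    space := max s.space (i + 1) }

/-- Write to a real array. -/
def writeReal (s : Config) (a i : ℕ) (v : ℝ) : Config :=
  { s with
    reals := Function.update s.reals a (Function.update (s.reals a) i v)
    space := max s.space (i + 1) }

/-- Record a call to `CollisionFree`. -/
def logCall (s : Config) (u v : ℕ) : Config := { s with calls := s.calls ++ [(u, v)] }

end Config

open Classical in
/-- The number `1` for a true proposition and `0` for a false one. -/
def truthValue (q : Prop) : ℕ := if q then 1 else 0

/-- `Exec col inG P s t`: program `P`, started in configuration `s`, halts in configuration `t`.
Here `col` answers the calls to `CollisionFree` and `inG` the tests for the goal region. -/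
inductive Exec (col : ℕ → ℕ → Prop) (inG : ℕ → Prop) : Program → Config → Config → Prop
  | skip (s : Config) : Exec col inG .skip s (s.tick 1)
  | setInt (s : Config) (a : ℕ) (i e : IntExp) :
      Exec col inG (.setInt a i e) s
        ((s.tick (i.size + e.size + 1)).writeInt a (i.eval s) (e.eval s))
  | setReal (s : Config) (a : ℕ) (i : IntExp) (e : RealExp) :
      Exec col inG (.setReal a i e) s
        ((s.tick (i.size + e.size + 1)).writeReal a (i.eval s) (e.eval s))
  | collisionFree (s : Config) (a : ℕ) (i u v : IntExp) :
      Exec col inG (.collisionFree a i u v) s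
        (((s.tick (i.size + u.size + v.size + 1)).logCall (u.eval s) (v.eval s)).writeInt a
          (i.eval s) (truthValue (col (u.eval s) (v.eval s))))
  | inGoal (s : Config) (a : ℕ) (i u : IntExp) :
      Exec col inG (.inGoal a i u) s
        ((s.tick (i.size + u.size + 1)).writeInt a (i.eval s) (truthValue (inG (u.eval s))))
  | seq (P R : Program) (s t u : Config) (hP : Exec col inG P s t) (hR : Exec col inG R t u) :
      Exec col inG (.seq P R) s u
  | branchTrue (b : Test) (P R : Program) (s t : Config) (hb : b.Holds s)
      (hP : Exec col inG P (s.tick (b.size + 1)) t) : Exec col inG (.branch b P R) s t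
  | branchFalse (b : Test) (P R : Program) (s t : Config) (hb : ¬ b.Holds s)
      (hR : Exec col inG R (s.tick (b.size + 1)) t) : Exec col inG (.branch b P R) s t
  | loopTrue (b : Test) (P : Program) (s t u : Config) (hb : b.Holds s)
      (hP : Exec col inG P (s.tick (b.size + 1)) t) (hrest : Exec col inG (.loop b P) t u) :
      Exec col inG (.loop b P) s u
  | loopFalse (b : Test) (P : Program) (s : Config) (hb : ¬ b.Holds s) :
      Exec col inG (.loop b P) s (s.tick (b.size + 1))

/-- A program halts in at most one configuration. -/
theorem Exec.unique {col : ℕ → ℕ → Prop} {inG : ℕ → Prop} {P : Program} {s t t' : Config}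
    (h : Exec col inG P s t) (h' : Exec col inG P s t') : t = t' := by
  induction h generalizing t' with
  | skip s => cases h'; rfl
  | setInt s a i e => cases h'; rfl
  | setReal s a i e => cases h'; rfl
  | collisionFree s a i u v => cases h'; rfl
  | inGoal s a i u => cases h'; rfl
  | seq P R s t u hP hR ihP ihR =>
    cases h' with
    | seq _ _ _ t₁ _ hP' hR' =>
      obtain rfl := ihP hP'
      exact ihR hR'
  | branchTrue b P R s t hb hP ih =>
    cases h' with
    | branchTrue _ _ _ _ _ _ hP' => exact ih hP'
    | branchFalse _ _ _ _ _ hb' _ => exact absurd hb hb'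
  | branchFalse b P R s t hb hR ih =>
    cases h' with
    | branchTrue _ _ _ _ _ hb' _ => exact absurd hb' hb
    | branchFalse _ _ _ _ _ _ hR' => exact ih hR'
  | loopTrue b P s t u hb hP hrest ihP ihrest =>
    cases h' with
    | loopTrue _ _ _ t₁ _ _ hP' hrest' =>
      obtain rfl := ihP hP'
      exact ihrest hrest'
    | loopFalse _ _ _ hb' => exact absurd hb hb'
  | loopFalse b P s hb =>
    cases h' with
    | loopTrue _ _ _ _ _ hb' _ _ => exact absurd hb' hb
    | loopFalse _ _ _ _ => rfl

/-- The input: integer array `0` holds `n` and `d`, real array `0` holds the coordinates of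
the nodes `0, …, n` one node after the other, real array `1` holds the radius, and every other
entry is `0`. -/
def input {d : ℕ} (n : ℕ) (p : ℕ → EuclideanSpace ℝ (Fin d)) (r : ℝ) : Config where
  ints := fun a i => if a = 0 ∧ i = 0 then n else if a = 0 ∧ i = 1 then d else 0
  reals := fun a i =>
    if a = 0 then
      if h : i % d < d ∧ i / d ≤ n then p (i / d) ⟨i % d, h.1⟩ else 0
    else if a = 1 ∧ i = 0 then r else 0
  time := 0
  space := max 2 ((n + 1) * d)
  calls := []

/-- The output, in integer array `1`: entry `0` is the number of nodes on the path, or `0` for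
failure, and the nodes of the path follow. -/
def Config.output (t : Config) : Option (List ℕ) :=
  if t.ints 1 0 = 0 then none
  else some ((List.range (t.ints 1 0)).map fun i => t.ints 1 (i + 1))

section

variable {d : ℕ} (P : Program) (Q : PlanningProblem d) (n : ℕ) (r : ℝ)
  (ω : Fin n → EuclideanSpace ℝ (Fin d))

/-- Program `P`, run on the samples `ω` with radius `r` for the planning problem `Q`, halts in
configuration `t`. -/
def HaltsIn (t : Config) : Prop :=
  Exec (fun u v => Q.CollisionFree (Q.node ω u) (Q.node ω v)) (fun u => Q.node ω u ∈ Q.goal) P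
    (input n (Q.node ω) r) t

/-- Program `P` performs a run of FMT* on the samples `ω` with radius `r`: it halts, and its output
and its calls to `CollisionFree` are those of such a run. -/
def PerformsFMT : Prop :=
  ∃ t, HaltsIn P Q n r ω t ∧ FMT.IsRun Q n r ω t.output t.calls

/-- The number of steps (infinite if the program does not halt). -/
def runTime : ℝ≥0∞ := ⨅ (t : Config) (_ : HaltsIn P Q n r ω t), (t.time : ℝ≥0∞)

/-- The memory size (infinite if the program does not halt). -/
def runSpace : ℝ≥0∞ := ⨅ (t : Config) (_ : HaltsIn P Q n r ω t), (t.space : ℝ≥0∞)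

end

end RAM

end

/-! Calls. Every call to `CollisionFree` belongs to the consideration of one node `x` for one `z`,
and `z` is closed right afterwards. So `x` is considered at most once for each of its near nodes. If
`x` has distance at least `r` from the obstacles, a connection shorter than `r` cannot meet them,
and the first consideration already connects `x`. Hence `x` costs one call, or at most its degree
when it lies in the shell of width `r` around the obstacles (`FMT.WhileLoop.sum_le`). This holds
whatever choices the run makes. The shell has probability `O(r)`, and given the position of a sample
its expected degree is `O(log n)`. The expected number of calls is thus `n (1 + O(r log n))`, which
is `O(n)` because `r log n` stays bounded. For PRM* the expected degrees are simply added up.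

Time. The implementation stores the list of near nodes of every node. They are found with a grid
whose cells are at least `r` wide, so that `3 ^ d` cells around a node suffice (`exists_offset`),
but not much wider, so that everything found there lies within `4 * d * r` and numbers `O(log n)` on
average (`candCard_le`). The open nodes sit in a tournament tree, which is updated in time `O(log
n)` and has the cheapest node at its root. Closing `z` or considering `x` then takes time
proportional to degree plus `log n`, and the second is charged to the call that it makes. A node of
the shell costs up to degree times (degree plus `log n`), so a second moment is needed:
`Sampling.lintegral_crowd_sq_le` gives `O(r (log n) ^ 2)` per node, and boundedness of `r log n`
leaves `O(log n)`.

Space. The near lists have expected total length `O(n log n)`, and the array of cells has `O(1 + r ^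
(-d))` entries, which is `O(n)`.

Correctness is a simulation: `Rep` relates memory to a state of the pseudocode,
`iterationProgram_spec` preserves it, and `fmtProgram_spec` collects result, time and space. All
random costs are bounded by explicit measurable functions of the samples, which is enough for an
upper integral. -/

/-! ## A program logic for the random access machine -/

namespace RAM

/-- The value of the integer variable kept in entry `0` of array `a`. -/
def IntExp.var (a : ℕ) : IntExp := .get a (.lit 0)

/-- The value of the real variable kept in entry `0` of array `a`. -/
def RealExp.var (a : ℕ) : RealExp := .get a (.lit 0)

/-- Assignment to an integer variable. -/
def Program.assign (a : ℕ) (e : IntExp) : Program := .setInt a (.lit 0) e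

/-- Assignment to a real variable. -/
def Program.assignReal (a : ℕ) (e : RealExp) : Program := .setReal a (.lit 0) e

/-- `for a = e, …, f - 1 do P`. -/
def Program.forLoop (a : ℕ) (e f : IntExp) (P : Program) : Program :=
  .seq (.assign a e) (.loop (.intLt (.var a) f) (.seq P (.assign a (.add (.var a) (.lit 1)))))

namespace Program

/-- The integer arrays to which a program may write. -/
def intWrites : Program → List ℕ
  | skip => []
  | setInt a _ _ => [a]
  | setReal _ _ _ => []
  | collisionFree a _ _ _ => [a]
  | inGoal a _ _ => [a]
  | seq P R => P.intWrites ++ R.intWrites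
  | branch _ P R => P.intWrites ++ R.intWrites
  | loop _ P => P.intWrites

/-- The real arrays to which a program may write. -/
def realWrites : Program → List ℕ
  | setReal a _ _ => [a]
  | seq P R => P.realWrites ++ R.realWrites
  | branch _ P R => P.realWrites ++ R.realWrites
  | loop _ P => P.realWrites
  | _ => []

/-- The program contains no call to `CollisionFree`. -/
def callFree : Program → Bool
  | collisionFree _ _ _ _ => false
  | seq P R => P.callFree && R.callFree
  | branch _ P R => P.callFree && R.callFree
  | loop _ P => P.callFree
  | _ => true

end Program

/-- What `P` cannot change is the same in `s` and `t`. -/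
structure Frame (P : Program) (s t : Config) : Prop where
  ints : ∀ a, a ∉ P.intWrites → t.ints a = s.ints a
  reals : ∀ a, a ∉ P.realWrites → t.reals a = s.reals a
  calls : P.callFree = true → t.calls = s.calls

theorem Frame.refl (P : Program) (s : Config) : Frame P s s := ⟨by simp, by simp, by simp⟩

theorem Frame.trans {P : Program} {s t u : Config} (h : Frame P s t) (h' : Frame P t u) :
    Frame P s u :=
  ⟨fun a ha => (h'.ints a ha).trans (h.ints a ha), fun a ha => (h'.reals a ha).trans (h.reals a ha),
    fun hc => (h'.calls hc).trans (h.calls hc)⟩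

theorem Frame.mono {P R : Program} {s t : Config} (h : Frame P s t)
    (hi : ∀ a, a ∈ P.intWrites → a ∈ R.intWrites)
    (hr : ∀ a, a ∈ P.realWrites → a ∈ R.realWrites)
    (hc : R.callFree = true → P.callFree = true) : Frame R s t :=
  ⟨fun a ha => h.ints a fun h' => ha (hi a h'), fun a ha => h.reals a fun h' => ha (hr a h'),
    fun h' => h.calls (hc h')⟩

namespace Config

variable (s : Config) (k a b i u v : ℕ) (x : ℝ)

@[simp] theorem tick_ints : (s.tick k).ints = s.ints := rfl
@[simp] theorem tick_reals : (s.tick k).reals = s.reals := rfl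
@[simp] theorem tick_calls : (s.tick k).calls = s.calls := rfl
@[simp] theorem tick_space : (s.tick k).space = s.space := rfl
@[simp] theorem tick_time : (s.tick k).time = s.time + k := rfl
@[simp] theorem writeInt_ints :
    (s.writeInt a i v).ints b = if b = a then Function.update (s.ints a) i v else s.ints b := by
  simp [writeInt, Function.update_apply]
@[simp] theorem writeInt_reals : (s.writeInt a i v).reals = s.reals := rfl
@[simp] theorem writeInt_calls : (s.writeInt a i v).calls = s.calls := rfl
@[simp] theorem writeInt_space : (s.writeInt a i v).space = max s.space (i + 1) := rfl
@[simp] theorem writeInt_time : (s.writeInt a i v).time = s.time := rfl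
@[simp] theorem writeReal_ints : (s.writeReal a i x).ints = s.ints := rfl
@[simp] theorem writeReal_reals :
    (s.writeReal a i x).reals b = if b = a then Function.update (s.reals a) i x else s.reals b := by
  simp [writeReal, Function.update_apply]
@[simp] theorem writeReal_calls : (s.writeReal a i x).calls = s.calls := rfl
@[simp] theorem writeReal_space : (s.writeReal a i x).space = max s.space (i + 1) := rfl
@[simp] theorem writeReal_time : (s.writeReal a i x).time = s.time := rfl
@[simp] theorem logCall_ints : (s.logCall u v).ints = s.ints := rfl
@[simp] theorem logCall_reals : (s.logCall u v).reals = s.reals := rfl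
@[simp] theorem logCall_calls : (s.logCall u v).calls = s.calls ++ [(u, v)] := rfl
@[simp] theorem logCall_space : (s.logCall u v).space = s.space := rfl
@[simp] theorem logCall_time : (s.logCall u v).time = s.time := rfl

end Config

/-! ### Evaluation and sizes of expressions -/

section eval

variable (s t : Config)

@[simp] theorem IntExp.eval_lit (k : ℕ) : (IntExp.lit k).eval s = k := rfl
@[simp] theorem IntExp.eval_get (a : ℕ) (i : IntExp) :
    (IntExp.get a i).eval s = s.ints a (i.eval s) := rfl
@[simp] theorem IntExp.eval_var (a : ℕ) : (IntExp.var a).eval s = s.ints a 0 := rfl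
@[simp] theorem IntExp.eval_add (e f : IntExp) : (IntExp.add e f).eval s = e.eval s + f.eval s := rfl
@[simp] theorem IntExp.eval_sub (e f : IntExp) : (IntExp.sub e f).eval s = e.eval s - f.eval s := rfl
@[simp] theorem IntExp.eval_half (e : IntExp) : (IntExp.half e).eval s = e.eval s / 2 := rfl
@[simp] theorem IntExp.size_lit (k : ℕ) : (IntExp.lit k).size = 1 := rfl
@[simp] theorem IntExp.size_get (a : ℕ) (i : IntExp) : (IntExp.get a i).size = i.size + 1 := rfl
@[simp] theorem IntExp.size_var (a : ℕ) : (IntExp.var a).size = 2 := rfl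
@[simp] theorem IntExp.size_add (e f : IntExp) : (IntExp.add e f).size = e.size + f.size + 1 := rfl
@[simp] theorem IntExp.size_sub (e f : IntExp) : (IntExp.sub e f).size = e.size + f.size + 1 := rfl
@[simp] theorem IntExp.size_half (e : IntExp) : (IntExp.half e).size = e.size + 1 := rfl
@[simp] theorem RealExp.eval_ofInt (e : IntExp) : (RealExp.ofInt e).eval s = (e.eval s : ℝ) := rfl
@[simp] theorem RealExp.eval_get (a : ℕ) (i : IntExp) :
    (RealExp.get a i).eval s = s.reals a (i.eval s) := rfl
@[simp] theorem RealExp.eval_var (a : ℕ) : (RealExp.var a).eval s = s.reals a 0 := rfl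
@[simp] theorem RealExp.eval_add (e f : RealExp) :
    (RealExp.add e f).eval s = e.eval s + f.eval s := rfl
@[simp] theorem RealExp.eval_sub (e f : RealExp) :
    (RealExp.sub e f).eval s = e.eval s - f.eval s := rfl
@[simp] theorem RealExp.eval_mul (e f : RealExp) :
    (RealExp.mul e f).eval s = e.eval s * f.eval s := rfl
@[simp] theorem RealExp.eval_sqrt (e : RealExp) : (RealExp.sqrt e).eval s = √(e.eval s) := rfl
@[simp] theorem RealExp.size_ofInt (e : IntExp) : (RealExp.ofInt e).size = e.size + 1 := rfl
@[simp] theorem RealExp.size_get (a : ℕ) (i : IntExp) : (RealExp.get a i).size = i.size + 1 := rfl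
@[simp] theorem RealExp.size_var (a : ℕ) : (RealExp.var a).size = 2 := rfl
@[simp] theorem RealExp.size_add (e f : RealExp) :
    (RealExp.add e f).size = e.size + f.size + 1 := rfl
@[simp] theorem RealExp.size_sub (e f : RealExp) :
    (RealExp.sub e f).size = e.size + f.size + 1 := rfl
@[simp] theorem RealExp.size_mul (e f : RealExp) :
    (RealExp.mul e f).size = e.size + f.size + 1 := rfl
@[simp] theorem RealExp.size_sqrt (e : RealExp) : (RealExp.sqrt e).size = e.size + 1 := rfl
@[simp] theorem Test.holds_intEq (e f : IntExp) :
    (Test.intEq e f).Holds s ↔ e.eval s = f.eval s := Iff.rfl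
@[simp] theorem Test.holds_intLt (e f : IntExp) :
    (Test.intLt e f).Holds s ↔ e.eval s < f.eval s := Iff.rfl
@[simp] theorem Test.holds_realLt (e f : RealExp) :
    (Test.realLt e f).Holds s ↔ e.eval s < f.eval s := Iff.rfl
@[simp] theorem Test.holds_neg (b : Test) : (Test.neg b).Holds s ↔ ¬ b.Holds s := Iff.rfl
@[simp] theorem Test.holds_conj (b c : Test) :
    (Test.conj b c).Holds s ↔ b.Holds s ∧ c.Holds s := Iff.rfl
@[simp] theorem Test.size_intEq (e f : IntExp) : (Test.intEq e f).size = e.size + f.size + 1 := rfl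
@[simp] theorem Test.size_intLt (e f : IntExp) : (Test.intLt e f).size = e.size + f.size + 1 := rfl
@[simp] theorem Test.size_realLt (e f : RealExp) :
    (Test.realLt e f).size = e.size + f.size + 1 := rfl
@[simp] theorem Test.size_neg (b : Test) : (Test.neg b).size = b.size + 1 := rfl
@[simp] theorem Test.size_conj (b c : Test) : (Test.conj b c).size = b.size + c.size + 1 := rfl

variable {s t}

theorem IntExp.eval_congr (h : s.ints = t.ints) (e : IntExp) : e.eval s = e.eval t := by
  induction e <;> simp_all

theorem RealExp.eval_congr (h : s.ints = t.ints) (h' : s.reals = t.reals) (e : RealExp) :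
    e.eval s = e.eval t := by
  induction e <;> simp_all [RealExp.eval, IntExp.eval_congr h]

theorem Test.holds_congr (h : s.ints = t.ints) (h' : s.reals = t.reals) (b : Test) :
    b.Holds s ↔ b.Holds t := by
  induction b <;> simp_all [IntExp.eval_congr h, RealExp.eval_congr h h']

@[simp] theorem IntExp.eval_tick (k : ℕ) (e : IntExp) : e.eval (s.tick k) = e.eval s :=
  IntExp.eval_congr (s := s.tick k) (t := s) rfl e

@[simp] theorem Test.holds_tick (k : ℕ) (b : Test) : b.Holds (s.tick k) ↔ b.Holds s :=
  Test.holds_congr (s := s.tick k) (t := s) rfl rfl b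

end eval

/-! ### Weakest preconditions and loop rules -/

section exec

variable {col : ℕ → ℕ → Prop} {inG : ℕ → Prop} {P R : Program} {s t : Config}

/-- Specifications below mention only what changes. Everything else is recovered from this lemma,
with membership in the lists of written arrays settled by `decide`. -/
theorem Exec.frame (h : Exec col inG P s t) : Frame P s t := by
  induction h with
  | skip | setInt | setReal | collisionFree | inGoal =>
    constructor <;> simp +contextual [Program.intWrites, Program.realWrites, Program.callFree]
  | seq P R s t u hP hR ihP ihR =>
    refine Frame.trans (ihP.mono ?_ ?_ ?_) (ihR.mono ?_ ?_ ?_) <;>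
      simp +contextual [Program.intWrites, Program.realWrites, Program.callFree]
  | branchTrue b P R s t hb hP ih =>
    refine Frame.mono (P := P) ⟨ih.ints, ih.reals, ih.calls⟩ ?_ ?_ ?_ <;>
      simp +contextual [Program.intWrites, Program.realWrites, Program.callFree]
  | branchFalse b P R s t hb hR ih =>
    refine Frame.mono (P := R) ⟨ih.ints, ih.reals, ih.calls⟩ ?_ ?_ ?_ <;>
      simp +contextual [Program.intWrites, Program.realWrites, Program.callFree]
  | loopTrue b P s t u hb hP hrest ihP ihrest =>
    exact Frame.trans ⟨ihP.ints, ihP.reals, ihP.calls⟩ ihrest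
  | loopFalse b P s hb => exact ⟨by simp, by simp, by simp⟩

theorem Exec.time_le (h : Exec col inG P s t) : s.time ≤ t.time := by
  induction h <;> (try simp only [Config.tick_time, Config.writeInt_time, Config.writeReal_time,
    Config.logCall_time] at *) <;> omega

variable (col inG) in
/-- `P`, started in `s`, halts in a configuration with property `post`. -/
def WP (P : Program) (s : Config) (post : Config → Prop) : Prop :=
  ∃ t, Exec col inG P s t ∧ post t

namespace WP

variable {post post' : Config → Prop}

/-- The frame is handed over together with the postcondition, so that unchanged variables need not
occur in the latter. -/
theorem conseq (h : WP col inG P s post') (h' : ∀ t, Frame P s t → post' t → post t) :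
    WP col inG P s post :=
  let ⟨t, ht, hp⟩ := h
  ⟨t, ht, h' t ht.frame hp⟩

theorem seq (h : WP col inG P s fun t => WP col inG R t post) :
    WP col inG (.seq P R) s post :=
  let ⟨_, ht, u, hu, hp⟩ := h
  ⟨u, .seq _ _ _ _ _ ht hu, hp⟩

@[simp] theorem skip_iff : WP col inG .skip s post ↔ post (s.tick 1) :=
  ⟨fun ⟨_, ht, hp⟩ => by cases ht; exact hp, fun h => ⟨_, .skip _, h⟩⟩

@[simp] theorem seq_iff :
    WP col inG (.seq P R) s post ↔ WP col inG P s fun t => WP col inG R t post :=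
  ⟨fun ⟨_, ht, hp⟩ => by cases ht with | seq _ _ _ t _ h h' => exact ⟨t, h, _, h', hp⟩, seq⟩

@[simp] theorem setInt_iff {a : ℕ} {i e : IntExp} : WP col inG (.setInt a i e) s post ↔
    post ((s.tick (i.size + e.size + 1)).writeInt a (i.eval s) (e.eval s)) :=
  ⟨fun ⟨_, ht, hp⟩ => by cases ht; exact hp, fun h => ⟨_, .setInt _ _ _ _, h⟩⟩

@[simp] theorem assign_iff {a : ℕ} {e : IntExp} : WP col inG (.assign a e) s post ↔
    post ((s.tick (e.size + 2)).writeInt a 0 (e.eval s)) := by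
  rw [Program.assign, setInt_iff, IntExp.size_lit, add_comm 1, IntExp.eval_lit]

@[simp] theorem setReal_iff {a : ℕ} {i : IntExp} {e : RealExp} :
    WP col inG (.setReal a i e) s post ↔
      post ((s.tick (i.size + e.size + 1)).writeReal a (i.eval s) (e.eval s)) :=
  ⟨fun ⟨_, ht, hp⟩ => by cases ht; exact hp, fun h => ⟨_, .setReal _ _ _ _, h⟩⟩

@[simp] theorem assignReal_iff {a : ℕ} {e : RealExp} : WP col inG (.assignReal a e) s post ↔
    post ((s.tick (e.size + 2)).writeReal a 0 (e.eval s)) := by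
  rw [Program.assignReal, setReal_iff, IntExp.size_lit, add_comm 1, IntExp.eval_lit]

@[simp] theorem collisionFree_iff {a : ℕ} {i u v : IntExp} :
    WP col inG (.collisionFree a i u v) s post ↔
      post (((s.tick (i.size + u.size + v.size + 1)).logCall (u.eval s) (v.eval s)).writeInt a
          (i.eval s) (truthValue (col (u.eval s) (v.eval s)))) :=
  ⟨fun ⟨_, ht, hp⟩ => by cases ht; exact hp, fun h => ⟨_, .collisionFree _ _ _ _ _, h⟩⟩

@[simp] theorem inGoal_iff {a : ℕ} {i u : IntExp} :
    WP col inG (.inGoal a i u) s post ↔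
      post ((s.tick (i.size + u.size + 1)).writeInt a (i.eval s) (truthValue (inG (u.eval s)))) :=
  ⟨fun ⟨_, ht, hp⟩ => by cases ht; exact hp, fun h => ⟨_, .inGoal _ _ _ _, h⟩⟩

@[simp] theorem branch_iff {b : Test} : WP col inG (.branch b P R) s post ↔
    (b.Holds s → WP col inG P (s.tick (b.size + 1)) post) ∧
      (¬ b.Holds s → WP col inG R (s.tick (b.size + 1)) post) := by
  constructor
  · rintro ⟨t, ht, hp⟩
    cases ht with
    | branchTrue _ _ _ _ _ hb h => exact ⟨fun _ => ⟨t, h, hp⟩, fun h' => absurd hb h'⟩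
    | branchFalse _ _ _ _ _ hb h => exact ⟨fun h' => absurd h' hb, fun _ => ⟨t, h, hp⟩⟩
  · rintro ⟨h, h'⟩
    by_cases hb : b.Holds s
    · obtain ⟨t, ht, hp⟩ := h hb
      exact ⟨t, .branchTrue _ _ _ _ _ hb ht, hp⟩
    · obtain ⟨t, ht, hp⟩ := h' hb
      exact ⟨t, .branchFalse _ _ _ _ _ hb ht, hp⟩

/-- Rule for while loops, with an invariant `I` and an amount `pot` of time that is still
available. -/
theorem loop {b : Test} {S : ℕ} (I : (ℕ → ℕ → ℕ) → (ℕ → ℕ → ℝ) → List (ℕ × ℕ) → Prop)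
    (pot : (ℕ → ℕ → ℕ) → (ℕ → ℕ → ℝ) → List (ℕ × ℕ) → ℕ) (hS : s.space ≤ S)
    (h0 : I s.ints s.reals s.calls)
    (hstep : ∀ u, Frame (.loop b P) s u → u.space ≤ S → I u.ints u.reals u.calls → b.Holds u →
      WP col inG P u fun t => t.time + pot t.ints t.reals t.calls + (b.size + 1) ≤
        u.time + pot u.ints u.reals u.calls ∧ t.space ≤ S ∧ I t.ints t.reals t.calls) :
    WP col inG (.loop b P) s fun t => t.time + pot t.ints t.reals t.calls ≤
      s.time + pot s.ints s.reals s.calls + (b.size + 1) ∧ t.space ≤ S ∧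
        I t.ints t.reals t.calls ∧ ¬ b.Holds t := by
  suffices H : ∀ k, ∀ u : Config, pot u.ints u.reals u.calls ≤ k → Frame (.loop b P) s u →
      u.space ≤ S → I u.ints u.reals u.calls →
      WP col inG (.loop b P) u fun t => t.time + pot t.ints t.reals t.calls ≤
        u.time + pot u.ints u.reals u.calls + (b.size + 1) ∧ t.space ≤ S ∧
          I t.ints t.reals t.calls ∧ ¬ b.Holds t from
    H _ s le_rfl (Frame.refl _ _) hS h0
  intro k
  induction k with
  | zero =>
    intro u hk hf hu hI
    by_cases hb : b.Holds u
    -- With no potential left a true test is contradictory: the pass would have to pay `b.size + 1`,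
    -- while time never decreases.
    · obtain ⟨t, ht, ht1, -, -⟩ := hstep (u.tick (b.size + 1)) ⟨hf.ints, hf.reals, hf.calls⟩ hu hI
        ((Test.holds_tick _ _).2 hb)
      obtain ⟨t', ht', h1, -⟩ := hstep u hf hu hI hb
      have := ht.time_le
      simp only [Config.tick_time, Config.tick_ints, Config.tick_reals, Config.tick_calls] at *
      omega
    · exact ⟨_, .loopFalse _ _ _ hb, by simp; omega, hu, hI, by simpa using hb⟩
  | succ k ih =>
    intro u hk hf hu hI
    by_cases hb : b.Holds u
    · obtain ⟨t, ht, ht1, ht2, ht3⟩ := hstep (u.tick (b.size + 1)) ⟨hf.ints, hf.reals, hf.calls⟩ hu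
        hI ((Test.holds_tick _ _).2 hb)
      have := ht.time_le
      simp only [Config.tick_time, Config.tick_ints, Config.tick_reals, Config.tick_calls] at *
      have hf' := ht.frame
      obtain ⟨t', ht', h1, h2⟩ := ih t (by omega)
        (hf.trans ⟨hf'.ints, hf'.reals, hf'.calls⟩) ht2 ht3
      exact ⟨t', .loopTrue _ _ _ _ _ hb ht ht', by omega, h2⟩
    · exact ⟨_, .loopFalse _ _ _ hb, by simp; omega, hu, hI, by simpa using hb⟩

/-- Rule for for loops: `I k` holds before the pass for `k`, which takes time `c k`. -/
theorem forLoop {a : ℕ} {e f : IntExp} {S : ℕ} {lo hi : ℕ} (c : ℕ → ℕ)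
    (I : ℕ → (ℕ → ℕ → ℕ) → (ℕ → ℕ → ℝ) → List (ℕ × ℕ) → Prop)
    (hS : s.space ≤ S) (hS0 : 0 < S) (ha : a ∉ P.intWrites) (he : e.eval s = lo) (hlo : lo ≤ hi)
    (hf : ∀ u, Frame (.forLoop a e f P) s u → f.eval u = hi)
    (hIa : ∀ k A R C v, I k A R C → I k (Function.update A a (Function.update (A a) 0 v)) R C)
    (h0 : I lo s.ints s.reals s.calls)
    (hstep : ∀ k u, lo ≤ k → k < hi → Frame (.forLoop a e f P) s u → u.space ≤ S →
      u.ints a 0 = k → I k u.ints u.reals u.calls →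
      WP col inG P u fun t => t.time ≤ u.time + c k ∧ t.space ≤ S ∧
        I (k + 1) t.ints t.reals t.calls) :
    WP col inG (.forLoop a e f P) s fun t =>
      t.time ≤ s.time + ∑ k ∈ Finset.Ico lo hi, (c k + (f.size + 10)) + (e.size + f.size + 6) ∧
        t.space ≤ S ∧ I hi t.ints t.reals t.calls := by
  rw [Program.forLoop, seq_iff, assign_iff, he]
  have hfr : Frame (.forLoop a e f P) s ((s.tick (e.size + 2)).writeInt a 0 lo) := by
    refine ⟨fun b hb => ?_, by simp, by simp⟩
    have : b ≠ a := by rintro rfl; exact hb (by simp [Program.forLoop, Program.assign,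
      Program.intWrites])
    simp [this]
  -- The loop variable is the index of the invariant, and the potential is the time of the passes
  -- still to come. The hypothesis `hIa` says that the invariant itself does not look at the loop
  -- variable, which is incremented after `P`.
  refine (loop (S := S)
    (fun A R C => lo ≤ A a 0 ∧ A a 0 ≤ hi ∧ I (A a 0) A R C)
    (fun A _ _ => ∑ k ∈ Finset.Ico (A a 0) hi, (c k + (f.size + 10))) ?_ ?_ ?_).conseq ?_
  · simp [hS]; omega
  · refine ⟨by simp, by simpa using hlo, ?_⟩
    simpa [Config.writeInt] using hIa lo _ _ _ lo h0
  · rintro u hu hus ⟨h1, h2, h3⟩ hb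
    have hu' : Frame (.forLoop a e f P) s u := by
      refine hfr.trans (hu.mono ?_ ?_ ?_) <;> simp +contextual [Program.forLoop,
        Program.assign, Program.intWrites, Program.realWrites, Program.callFree]
    rw [seq_iff]
    simp only [Test.holds_intLt, IntExp.eval_var, hf u hu'] at hb
    refine (hstep _ u h1 hb hu' hus rfl h3).conseq ?_
    rintro t hft ⟨ht1, ht2, ht3⟩
    have hat : t.ints a = u.ints a := hft.ints a ha
    rw [assign_iff]
    have hta : t.ints a 0 = u.ints a 0 := by rw [hat]
    refine ⟨?_, ?_, ?_, ?_, ?_⟩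
    · simp [hta]
      rw [Finset.sum_eq_sum_Ico_succ_bot hb]
      omega
    · simp [ht2]; omega
    · simp [hta]; omega
    · simp [hta]; omega
    · have := hIa _ _ _ _ (t.ints a 0 + 1) ht3
      simpa [hta, Config.writeInt] using this
  · rintro t hft ⟨h1, h2, ⟨h3, h4, h5⟩, h6⟩
    have hu' : Frame (.forLoop a e f P) s t := by
      refine hfr.trans (hft.mono ?_ ?_ ?_) <;> simp +contextual [Program.forLoop,
        Program.assign, Program.intWrites, Program.realWrites, Program.callFree]
    simp only [Test.holds_intLt, IntExp.eval_var, hf t hu'] at h6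
    have : t.ints a 0 = hi := by omega
    rw [this] at h5
    simp [this] at h1
    exact ⟨by omega, h2, h5⟩

end WP
end exec
end RAM

namespace RAM

/-! ### Names of the arrays -/

notation "rGrid" => (2 : ℕ)
notation "rLev" => (3 : ℕ)
notation "rI" => (4 : ℕ)
notation "rJ" => (5 : ℕ)
notation "rW" => (6 : ℕ)
notation "rCnt" => (7 : ℕ)
notation "rOff" => (8 : ℕ)
notation "rBase" => (9 : ℕ)
notation "rKey" => (10 : ℕ)
notation "rHead" => (11 : ℕ)
notation "rNext" => (12 : ℕ)
notation "rV" => (13 : ℕ)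
notation "rK" => (14 : ℕ)
notation "rCur" => (15 : ℕ)
notation "rT" => (16 : ℕ)
notation "rMark" => (17 : ℕ)
notation "rStart" => (18 : ℕ)
notation "rNbr" => (19 : ℕ)
notation "rTot" => (20 : ℕ)
notation "rPos" => (21 : ℕ)
notation "rStat" => (22 : ℕ)
notation "rTree" => (23 : ℕ)
notation "rZ" => (24 : ℕ)
notation "rDone" => (25 : ℕ)
notation "rFlag" => (26 : ℕ)
notation "rNew" => (27 : ℕ)
notation "rNumNew" => (28 : ℕ)
notation "rBest" => (29 : ℕ)
notation "rPar" => (30 : ℕ)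
notation "rDep" => (31 : ℕ)
notation "rNode" => (32 : ℕ)
notation "rP" => (33 : ℕ)
notation "rA" => (34 : ℕ)
notation "rB" => (35 : ℕ)
notation "rArg" => (36 : ℕ)
notation "qCoord" => (0 : ℕ)
notation "qRad" => (1 : ℕ)
notation "qY" => (2 : ℕ)
notation "qSum" => (3 : ℕ)
notation "qDiff" => (4 : ℕ)
notation "qDist" => (5 : ℕ)
notation "qCost" => (6 : ℕ)
notation "qVal" => (7 : ℕ)
notation "qBest" => (8 : ℕ)

infixr:60 " ;; " => Program.seq

variable {col : ℕ → ℕ → Prop} {inG : ℕ → Prop}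

/-! ### The size of the grid -/

/-- A bound for the binary logarithms that occur on inputs with `n` samples. -/
def lg (n : ℕ) : ℕ := Nat.log 2 (n + 1) + 1

/-- Computes the number `L` of bits of a grid coordinate. -/
def gridProgram : Program :=
  .assign rGrid (.lit 1) ;; .assign rLev (.lit 0) ;;
  .loop (.conj (.intLt (.var rGrid) (.get 0 (.lit 0)))
      (.neg (.realLt (.ofInt (.lit 1)) (.mul (.ofInt (.add (.var rGrid) (.var rGrid))) (.var qRad)))))
    (.assign rGrid (.add (.var rGrid) (.var rGrid)) ;; .assign rLev (.add (.var rLev) (.lit 1)))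

/-- `2 ^ L` is a suitable number of grid cells per coordinate for `n` samples and radius `r`. -/
structure GridLevel (n : ℕ) (r : ℝ) (L : ℕ) : Prop where
  le_lg : L ≤ lg n
  coarse : L = 0 ∨ 2 ^ L * r ≤ 1
  fine : n ≤ 2 ^ L ∨ 1 < 2 * 2 ^ L * r

/-- Doubling stops when one more doubling would make the cells narrower than `r`, which gives
`coarse` and `fine`. Stopping at `n` cells as well makes the loop end however small `r` is and keeps
`L` of order `log n`. -/
theorem gridProgram_spec {s : Config} {S n : ℕ} {r : ℝ} (hn : s.ints 0 0 = n)
    (hr : s.reals qRad 0 = r) (hS : s.space ≤ S) (hS0 : 0 < S) :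
    WP col inG gridProgram s fun t => t.time ≤ s.time + 100 * (lg n + 1) ∧ t.space ≤ S ∧
      GridLevel n r (t.ints rLev 0) := by
  simp only [gridProgram, WP.seq_iff, WP.assign_iff]
  refine (WP.loop (S := S) (fun A _ _ => A rGrid 0 = 2 ^ A rLev 0 ∧ A rLev 0 ≤ lg n ∧
    (A rLev 0 = 0 ∨ 2 ^ A rLev 0 * r ≤ 1)) (fun A _ _ => (lg n - A rLev 0) * 50)
    ?_ ?_ ?_).conseq ?_
  · simp; omega
  · simp
  · rintro u hf hu ⟨h1, h2, h3⟩ hb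
    have hn' : u.ints 0 0 = n := by rw [hf.ints 0 (by decide)]; simpa using hn
    have hr' : u.reals 1 0 = r := by rw [hf.reals 1 (by decide)]; simpa using hr
    simp [hn', hr', h1] at hb
    -- While the test holds, `2 ^ L < n`, so `L` is at most the logarithm in `lg n`; the summand `1`
    -- of `lg n` leaves room for the doubling.
    have hlt : u.ints rLev 0 < lg n := by
      have : u.ints rLev 0 ≤ Nat.log 2 (n + 1) := Nat.le_log_of_pow_le (by norm_num) (by omega)
      unfold lg; omega
    simp [h1]
    refine ⟨?_, by omega, by ring, by omega, ?_⟩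
    · have : lg n - u.ints rLev 0 = lg n - (u.ints rLev 0 + 1) + 1 := by omega
      omega
    · have := hb.2
      rw [pow_succ]; linarith
  · rintro t hf ⟨h1, h2, ⟨h3, h4, h5⟩, h6⟩
    have hn' : t.ints 0 0 = n := by rw [hf.ints 0 (by decide)]; simpa using hn
    have hr' : t.reals 1 0 = r := by rw [hf.reals 1 (by decide)]; simpa using hr
    simp at h1
    refine ⟨by omega, h2, h4, h5, ?_⟩
    simp [hn', hr', h3] at h6
    by_cases hc : n ≤ 2 ^ t.ints rLev 0
    · exact Or.inl hc
    · right
      have := h6 (by omega)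
      linarith

/-! ### Offsets of the neighbouring cells -/

/-- The number with the digits `e 0, …, e (i - 1)` in base `M`. -/
def horner (M : ℕ) (e : ℕ → ℕ) : ℕ → ℕ
  | 0 => 0
  | i + 1 => horner M e i * M + e i

theorem horner_congr {M : ℕ} {e e' : ℕ → ℕ} {i : ℕ} (h : ∀ j < i, e j = e' j) :
    horner M e i = horner M e' i := by
  induction i with
  | zero => rfl
  | succ i ih => rw [horner, horner, ih fun j hj => h j (by omega), h i (by omega)]

/-- Digits are not required to be smaller than the base, so there are no carries to consider. -/
theorem horner_add (M : ℕ) (e e' : ℕ → ℕ) (i : ℕ) :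
    horner M e i + horner M e' i = horner M (fun j => e j + e' j) i := by
  induction i with
  | zero => rfl
  | succ i ih => rw [horner, horner, horner, ← ih]; ring

theorem horner_lt {M : ℕ} {e : ℕ → ℕ} {i : ℕ} (h : ∀ j < i, e j < M) : horner M e i < M ^ i := by
  induction i with
  | zero => simp [horner]
  | succ i ih =>
    have h1 := ih fun j hj => h j (by omega)
    have h2 := h i (by omega)
    calc horner M e i * M + e i < horner M e i * M + M := by omega
      _ = (horner M e i + 1) * M := by ring
      _ ≤ M ^ i * M := Nat.mul_le_mul_right _ h1
      _ = M ^ (i + 1) := by ring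

/-- Lets equality of cell numbers be read off coordinate by coordinate. -/
theorem horner_inj {M : ℕ} {e e' : ℕ → ℕ} {i : ℕ} (h : ∀ j < i, e j < M) (h' : ∀ j < i, e' j < M)
    (heq : horner M e i = horner M e' i) : ∀ j < i, e j = e' j := by
  induction i with
  | zero => simp
  | succ i ih =>
    rw [horner, horner] at heq
    have h1 := h i (by omega)
    have h2 := h' i (by omega)
    have hM : 0 < M := by omega
    have h3 : e i = e' i := by
      have := congrArg (· % M) heq
      simpa [Nat.add_mod, Nat.mod_eq_of_lt h1, Nat.mod_eq_of_lt h2] using this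
    have h4 : horner M e i = horner M e' i := by
      rw [h3] at heq
      exact Nat.eq_of_mul_eq_mul_right hM (by omega)
    intro j hj
    rcases Nat.lt_succ_iff_lt_or_eq.1 hj with hj | rfl
    · exact ih (fun j hj => h j (by omega)) (fun j hj => h' j (by omega)) h4 j hj
    · exact h3

/-- The first `3 ^ i` entries of `off` are the numbers with `i` digits from `{0, 1, 2}`; the one
with all digits `1` comes first. -/
structure OffsetTable (M i : ℕ) (off : ℕ → ℕ) : Prop where
  first : off 0 = horner M (fun _ => 1) i
  surj : ∀ e : ℕ → ℕ, (∀ j, e j ≤ 2) → ∃ k < 3 ^ i, off k = horner M e i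
  digits : ∀ k < 3 ^ i, ∃ e : ℕ → ℕ, (∀ j, e j ≤ 2) ∧ off k = horner M e i

/-- The new table consists of three blocks, for the last digits `1`, `0` and `2`. The block for `1`
comes first, so that entry `0` keeps all its digits equal to `1`. -/
theorem OffsetTable.succ {M i : ℕ} {o o' : ℕ → ℕ} (h : OffsetTable M i o)
    (h' : ∀ k < 3 ^ i, o' k = o k * M + 1 ∧ o' (3 ^ i + k) = o k * M ∧
      o' (3 ^ i + 3 ^ i + k) = o k * M + 2) : OffsetTable M (i + 1) o' := by
  have hpos : 0 < 3 ^ i := by positivity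
  have hpow : 3 ^ (i + 1) = 3 ^ i + 3 ^ i + 3 ^ i := by ring
  refine ⟨?_, fun e he => ?_, fun k hk => ?_⟩
  · rw [(h' 0 hpos).1, h.first, horner]
  · obtain ⟨k, hk, hk'⟩ := h.surj e he
    obtain ⟨h1, h2, h3⟩ := h' k hk
    rw [horner, ← hk', hpow]
    have := he i
    interval_cases e i
    · exact ⟨_, by omega, h2⟩
    · exact ⟨_, by omega, h1⟩
    · exact ⟨_, by omega, h3⟩
  · have key : ∀ k' < 3 ^ i, ∀ c ≤ 2, o' k = o k' * M + c →
        ∃ e : ℕ → ℕ, (∀ j, e j ≤ 2) ∧ o' k = horner M e (i + 1) := by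
      intro k' hk' c hc heq
      obtain ⟨e, he, he'⟩ := h.digits k' hk'
      refine ⟨Function.update e i c, fun j => ?_, ?_⟩
      · rw [Function.update_apply]; split_ifs <;> simp [he, hc]
      · rw [heq, horner, he', Function.update_self]
        congr 2
        exact horner_congr fun j hj => by rw [Function.update_of_ne (by omega)]
    rw [hpow] at hk
    by_cases h1 : k < 3 ^ i
    · exact key k h1 1 (by norm_num) (h' k h1).1
    by_cases h2 : k < 3 ^ i + 3 ^ i
    · refine key (k - 3 ^ i) (by omega) 0 (by norm_num) ?_
      rw [add_zero, ← (h' (k - 3 ^ i) (by omega)).2.1]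
      congr 1; omega
    · refine key (k - (3 ^ i + 3 ^ i)) (by omega) 2 (by norm_num) ?_
      rw [← (h' (k - (3 ^ i + 3 ^ i)) (by omega)).2.2]
      congr 1; omega

/-- Multiplies the variable `W` by `4 * 2 ^ L`. -/
def shiftProgram : Program :=
  .forLoop rT (.lit 0) (.add (.var rLev) (.lit 2)) (.assign rW (.add (.var rW) (.var rW)))

/-- The machine has no multiplication of integers, hence `L + 2` doublings. Their cost of order `log
n` is paid only a number of times that depends on `d`. -/
theorem shiftProgram_spec {s : Config} {S L : ℕ} (hL : s.ints rLev 0 = L) (hS : s.space ≤ S)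
    (hS0 : 0 < S) : WP col inG shiftProgram s fun t => t.time ≤ s.time + 30 * (L + 3) ∧
      t.space ≤ S ∧ t.ints rW 0 = s.ints rW 0 * (4 * 2 ^ L) := by
  refine (WP.forLoop (S := S) (lo := 0) (hi := L + 2) (fun _ => 7)
    (fun k A _ _ => A rW 0 = s.ints rW 0 * 2 ^ k) hS hS0 (by decide) rfl (by omega) ?_ ?_ ?_
    ?_).conseq ?_
  · intro u hu
    simp [hu.ints rLev (by decide), hL]
  · intro k A R C v h; simpa using h
  · simp
  · intro k u _ hk hu hus _ hI
    simp [hI, pow_succ]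
    exact ⟨by omega, by ring⟩
  · rintro t hf ⟨h1, h2, h3⟩
    simp at h1
    refine ⟨by omega, h2, ?_⟩
    rw [h3]; ring

/-- Computes the table of offsets. -/
def offsetProgram : Program :=
  .setInt rOff (.lit 0) (.lit 0) ;; .assign rCnt (.lit 1) ;;
  .forLoop rI (.lit 0) (.get 0 (.lit 1))
    (.forLoop rJ (.lit 0) (.var rCnt)
      (.assign rW (.get rOff (.var rJ)) ;; shiftProgram ;;
        .setInt rOff (.var rJ) (.add (.var rW) (.lit 1)) ;;
        .setInt rOff (.add (.var rCnt) (.var rJ)) (.var rW) ;;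
        .setInt rOff (.add (.add (.var rCnt) (.var rCnt)) (.var rJ)) (.add (.var rW) (.lit 2))) ;;
      .assign rCnt (.add (.add (.var rCnt) (.var rCnt)) (.var rCnt)))

/-- The table is extended in place: pass `j` overwrites entry `j` and otherwise writes beyond the
old table, so the old entries from `j` on are still available. -/
theorem offsetProgram_inner {s : Config} {S L i : ℕ} (hL : s.ints rLev 0 = L)
    (hcnt : s.ints rCnt 0 = 3 ^ i) (hS : s.space ≤ S) (hS0 : 3 ^ (i + 1) ≤ S) :
    WP col inG (.forLoop rJ (.lit 0) (.var rCnt)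
      (.assign rW (.get rOff (.var rJ)) ;; shiftProgram ;;
        .setInt rOff (.var rJ) (.add (.var rW) (.lit 1)) ;;
        .setInt rOff (.add (.var rCnt) (.var rJ)) (.var rW) ;;
        .setInt rOff (.add (.add (.var rCnt) (.var rCnt)) (.var rJ)) (.add (.var rW) (.lit 2)))) s
      fun t => t.time ≤ s.time + 3 ^ i * (30 * (L + 3) + 100) + 20 ∧ t.space ≤ S ∧
        ∀ k < 3 ^ i, t.ints rOff k = s.ints rOff k * (4 * 2 ^ L) + 1 ∧
          t.ints rOff (3 ^ i + k) = s.ints rOff k * (4 * 2 ^ L) ∧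
          t.ints rOff (3 ^ i + 3 ^ i + k) = s.ints rOff k * (4 * 2 ^ L) + 2 := by
  have hpos : 0 < 3 ^ i := by positivity
  have hpow : 3 ^ (i + 1) = 3 ^ i + 3 ^ i + 3 ^ i := by ring
  refine (WP.forLoop (S := S) (lo := 0) (hi := 3 ^ i) (fun _ => 30 * (L + 3) + 80)
    (fun j A _ _ => (∀ k, j ≤ k → k < 3 ^ i → A rOff k = s.ints rOff k) ∧
      ∀ k < j, A rOff k = s.ints rOff k * (4 * 2 ^ L) + 1 ∧
          A rOff (3 ^ i + k) = s.ints rOff k * (4 * 2 ^ L) ∧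
          A rOff (3 ^ i + 3 ^ i + k) = s.ints rOff k * (4 * 2 ^ L) + 2) hS (by omega) (by decide)
          rfl (by omega) ?_ ?_ ?_ ?_).conseq ?_
  · intro u hu
    simp [hu.ints rCnt (by decide), hcnt]
  · intro k A R C v h; simpa using h
  · simp
  · intro k u _ hk hu hus huk hI
    simp only [WP.seq_iff, WP.assign_iff]
    refine (shiftProgram_spec (S := S) (L := L) ?_ (by simp; omega) (by omega)).conseq ?_
    · simp [hu.ints rLev (by decide), hL]
    rintro t hft ⟨ht1, ht2, ht3⟩
    have e1 : t.ints rCnt 0 = 3 ^ i := by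
      rw [hft.ints _ (by decide)]; simp [hu.ints rCnt (by decide), hcnt]
    have e2 : t.ints rJ 0 = k := by
      rw [hft.ints _ (by decide)]; simp [huk]
    have e3 : t.ints rOff = u.ints rOff := by
      rw [hft.ints _ (by decide)]; simp
    have e4 := hI.1 k le_rfl hk
    simp [huk, e4] at ht1 ht3
    simp [e1, e2, e3, ht3]
    refine ⟨by omega, by omega, ?_, ?_⟩
    · intro k' h1 h2
      rw [Function.update_of_ne (by omega), Function.update_of_ne (by omega),
        Function.update_of_ne (by omega), hI.1 k' (by omega) h2]
    · intro k' h1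
      rcases Nat.lt_or_eq_of_le h1 with h1 | rfl
      · rw [Function.update_of_ne (by omega), Function.update_of_ne (by omega),
        Function.update_of_ne (by omega), Function.update_of_ne (by omega),
        Function.update_of_ne (by omega), Function.update_of_ne (by omega),
        Function.update_of_ne (by omega), Function.update_of_ne (by omega),
        Function.update_of_ne (by omega)]
        exact hI.2 k' h1
      · rw [Function.update_of_ne (by omega), Function.update_of_ne (by omega),
          Function.update_self, Function.update_of_ne (by omega), Function.update_self,
          Function.update_self]
        simp
  · rintro t hf ⟨h1, h2, h3⟩
    simp at h1
    refine ⟨?_, h2, h3.2⟩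
    nlinarith

theorem offsetProgram_spec {s : Config} {S L d : ℕ} (hL : s.ints rLev 0 = L)
    (hd : s.ints 0 1 = d) (hS : s.space ≤ S) (hS0 : 3 ^ d ≤ S) :
    WP col inG offsetProgram s
      fun t => t.time ≤ s.time + d * (3 ^ d * (30 * (L + 3) + 100) + 60) + 30 ∧ t.space ≤ S ∧
        t.ints rCnt 0 = 3 ^ d ∧ OffsetTable (4 * 2 ^ L) d (t.ints rOff) := by
  have hpos : 0 < 3 ^ d := by positivity
  simp only [offsetProgram, WP.seq_iff, WP.setInt_iff, WP.assign_iff]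
  refine (WP.forLoop (S := S) (lo := 0) (hi := d) (fun _ => 3 ^ d * (30 * (L + 3) + 100) + 40)
    (fun i A _ _ => A rCnt 0 = 3 ^ i ∧ OffsetTable (4 * 2 ^ L) i (A rOff)) (by simp; omega)
      (by omega) (by decide) rfl (by omega) ?_ ?_ ?_ ?_).conseq ?_
  · intro u hu
    simp [hu.ints 0 (by decide), hd]
  · intro k A R C v h; simpa using h
  · simp
    refine ⟨by simp [horner], fun e he => ⟨0, by simp, by simp [horner]⟩, fun k hk => ?_⟩
    obtain rfl : k = 0 := by simpa using hk
    exact ⟨fun _ => 0, by simp, by simp [horner]⟩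
  · intro i u _ hi hu hus hui ⟨hI, hI'⟩
    have hpow : 3 ^ (i + 1) ≤ 3 ^ d := Nat.pow_le_pow_right (by norm_num) hi
    have hpow' : 3 ^ i ≤ 3 ^ d := Nat.pow_le_pow_right (by norm_num) hi.le
    rw [WP.seq_iff]
    refine (offsetProgram_inner (S := S) (L := L) (i := i) ?_ hI hus (by omega)).conseq ?_
    · simp [hu.ints rLev (by decide), hL]
    rintro t hft ⟨ht1, ht2, ht3⟩
    have e1 : t.ints rCnt 0 = 3 ^ i := by
      rw [hft.ints _ (by decide)]; exact hI
    simp [e1]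
    have := Nat.mul_le_mul_right (30 * (L + 3) + 100) hpow'
    exact ⟨by omega, by omega, by ring, hI'.succ ht3⟩
  · rintro t hf ⟨h1, h2, h3⟩
    simp at h1
    refine ⟨?_, h2, h3⟩
    nlinarith

end RAM

namespace RAM

variable {col : ℕ → ℕ → Prop} {inG : ℕ → Prop}

/-! ### Grid cells of the nodes -/

/-- `q` is the number of a grid interval of width `2 ^ (-L)` that contains `x`. -/
structure IsDigit (L : ℕ) (x : ℝ) (q : ℕ) : Prop where
  lt : q < 2 ^ L
  le : (q : ℝ) ≤ x * 2 ^ L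
  ge : x * 2 ^ L ≤ q + 1

/-- Appends the `L` bits of the grid coordinate of `Y` to the number `W`. -/
def bitProgram : Program :=
  .forLoop rT (.lit 0) (.var rLev)
    (.assignReal qY (.add (.var qY) (.var qY)) ;; .assign rW (.add (.var rW) (.var rW)) ;;
      .branch (.realLt (.var qY) (.ofInt (.lit 1))) .skip
        (.assignReal qY (.sub (.var qY) (.ofInt (.lit 1))) ;; .assign rW (.add (.var rW) (.lit 1))))

theorem bitProgram_spec {s : Config} {S L : ℕ} {x : ℝ} (hL : s.ints rLev 0 = L)
    (hx : s.reals qY 0 = x) (hx0 : 0 ≤ x) (hx1 : x ≤ 1) (hS : s.space ≤ S)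
    (hS0 : 0 < S) : WP col inG bitProgram s fun t => t.time ≤ s.time + 60 * (L + 1) ∧
      t.space ≤ S ∧ ∃ q, IsDigit L x q ∧ t.ints rW 0 = s.ints rW 0 * 2 ^ L + q := by
  -- After `k` bits, `q` is the number read so far and `Y` the remaining fraction. Only `Y ≤ 1` is
  -- claimed, since the coordinate `x = 1` is allowed; it gets all bits equal to `1` and so belongs
  -- to the last cell.
  refine (WP.forLoop (S := S) (lo := 0) (hi := L) (fun _ => 40)
    (fun k A R _ => 0 ≤ R qY 0 ∧ R qY 0 ≤ 1 ∧ ∃ q : ℕ, q < 2 ^ k ∧ x * 2 ^ k = q + R qY 0 ∧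
      A rW 0 = s.ints rW 0 * 2 ^ k + q) hS hS0 (by decide) rfl (by omega) ?_ ?_ ?_ ?_).conseq ?_
  · intro u hu
    simp [hu.ints rLev (by decide), hL]
  · intro k A R C v h; simpa using h
  · simp [hx, hx0, hx1]
  · rintro k u _ hk hu hus _ ⟨h0, h1, q, hq, hxq, hw⟩
    simp only [WP.seq_iff, WP.assign_iff, WP.assignReal_iff, WP.branch_iff, WP.skip_iff]
    constructor
    · intro hb
      simp at hb
      simp [hw]
      refine ⟨by omega, h0, hb.le, 2 * q, by rw [pow_succ]; omega, ?_, by rw [pow_succ]; ring⟩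
      push_cast
      rw [pow_succ]; linarith
    · intro hb
      simp at hb
      simp [hw]
      refine ⟨by omega, hb, by linarith, 2 * q + 1, by rw [pow_succ]; omega, ?_,
        by rw [pow_succ]; ring⟩
      push_cast
      rw [pow_succ]; linarith
  · rintro t hf ⟨h1, h2, h3, h4, q, hq, hxq, hw⟩
    simp at h1
    exact ⟨by omega, h2, q, ⟨hq, by linarith, by linarith⟩, hw⟩

/-- The largest number `v + 1 ≤ k` with `cell v = c`, or `0` if there is none. -/
def lastBelow (cell : ℕ → ℕ) (c : ℕ) : ℕ → ℕ
  | 0 => 0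
  | k + 1 => if cell k = c then k + 1 else lastBelow cell c k

theorem lastBelow_congr {cell cell' : ℕ → ℕ} {c k : ℕ} (h : ∀ v < k, cell v = cell' v) :
    lastBelow cell c k = lastBelow cell' c k := by
  induction k with
  | zero => rfl
  | succ k ih => rw [lastBelow, lastBelow, h k (by omega), ih fun v hv => h v (by omega)]

theorem lastBelow_le (cell : ℕ → ℕ) (c k : ℕ) : lastBelow cell c k ≤ k := by
  induction k with
  | zero => exact le_rfl
  | succ k ih => rw [lastBelow]; split_ifs <;> omega

theorem cell_lastBelow {cell : ℕ → ℕ} {c k : ℕ} (h : 0 < lastBelow cell c k) :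
    cell (lastBelow cell c k - 1) = c := by
  induction k with
  | zero => simp [lastBelow] at h
  | succ k ih =>
    rw [lastBelow] at h ⊢
    split_ifs at h ⊢ with h'
    · simpa using h'
    · exact ih h

/-- Following a linked list skips no member of the cell. -/
theorem cell_ne_of_lastBelow_le {cell : ℕ → ℕ} {c k v : ℕ} (h : lastBelow cell c k ≤ v)
    (hv : v < k) : cell v ≠ c := by
  induction k with
  | zero => omega
  | succ k ih =>
    rw [lastBelow] at h
    split_ifs at h with h'
    · omega
    · rcases Nat.lt_or_eq_of_le (Nat.le_of_lt_succ hv) with hv | rfl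
      · exact ih h hv
      · exact h'

/-- `b` is the number of a grid cell that contains node `v`; `x` holds the coordinates. -/
def IsKey (x : ℕ → ℝ) (d L v b : ℕ) : Prop :=
  ∃ q : ℕ → ℕ, (∀ i < d, IsDigit L (x (v * d + i)) (q i)) ∧ b = horner (4 * 2 ^ L) q d

/-- The keys of the first `k` nodes, and linked lists of the nodes in each cell. -/
structure CellLists (x : ℕ → ℝ) (d L o k : ℕ) (base key head next : ℕ → ℕ) : Prop where
  base_eq : ∀ v < k, base v = v * d
  isKey : ∀ v < k, IsKey x d L v (key v)
  head_eq : ∀ c, head c = lastBelow (fun v => key v + o) c k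
  next_eq : ∀ v < k, next v = lastBelow (fun v => key v + o) (key v + o) v

/-- Node `k` is inserted at the head of its list. Entries are node numbers plus one, so that `0`,
the initial content of the memory, marks the end of a list and nothing has to be initialized. -/
theorem CellLists.succ {x : ℕ → ℝ} {d L o k b : ℕ} {base key head next : ℕ → ℕ}
    (h : CellLists x d L o k base key head next) (hb : IsKey x d L k b) :
    CellLists x d L o (k + 1) (Function.update base k (k * d)) (Function.update key k b)
      (Function.update head (b + o) (k + 1)) (Function.update next k (head (b + o))) := by
  have hcongr : ∀ c, ∀ j ≤ k, lastBelow (fun v => Function.update key k b v + o) c j =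
      lastBelow (fun v => key v + o) c j := fun c j hj =>
    lastBelow_congr fun v hv => by rw [Function.update_of_ne (by omega)]
  refine ⟨fun v hv => ?_, fun v hv => ?_, fun c => ?_, fun v hv => ?_⟩
  · rcases Nat.lt_or_eq_of_le (Nat.le_of_lt_succ hv) with hv | rfl
    · rw [Function.update_of_ne (by omega), h.base_eq v hv]
    · simp
  · rcases Nat.lt_or_eq_of_le (Nat.le_of_lt_succ hv) with hv | rfl
    · rw [Function.update_of_ne (by omega)]; exact h.isKey v hv
    · simpa using hb
  · rw [lastBelow, hcongr c k le_rfl, ← h.head_eq, Function.update_self, Function.update_apply]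
    simp [eq_comm]
  · rw [hcongr _ v (by omega)]
    rcases Nat.lt_or_eq_of_le (Nat.le_of_lt_succ hv) with hv | rfl
    · rw [Function.update_of_ne (by omega), Function.update_of_ne (by omega), h.next_eq v hv]
    · simp [h.head_eq]

/-- Computes the number of the cell of the node whose coordinates start at position `Pos`. -/
def hashProgram : Program :=
  .assign rW (.lit 0) ;;
  .forLoop rI (.lit 0) (.get 0 (.lit 1))
    (.assign rW (.add (.var rW) (.var rW)) ;; .assign rW (.add (.var rW) (.var rW)) ;;
      .assignReal qY (.get qCoord (.var rPos)) ;; .assign rPos (.add (.var rPos) (.lit 1)) ;;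
      bitProgram)

theorem hashProgram_spec {s : Config} {S L d v : ℕ} {x : ℕ → ℝ} (hL : s.ints rLev 0 = L)
    (hd : s.ints 0 1 = d) (hx : s.reals qCoord = x) (hpos : s.ints rPos 0 = v * d)
    (hx01 : ∀ i < d, 0 ≤ x (v * d + i) ∧ x (v * d + i) ≤ 1) (hS : s.space ≤ S) (hS0 : 0 < S) :
    WP col inG hashProgram s fun t => t.time ≤ s.time + (d * (60 * L + 150) + 30) ∧ t.space ≤ S ∧
      t.ints rPos 0 = (v + 1) * d ∧ IsKey x d L v (t.ints rW 0) := by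
  simp only [hashProgram, WP.seq_iff, WP.assign_iff]
  refine (WP.forLoop (S := S) (lo := 0) (hi := d) (fun _ => 60 * L + 110)
    (fun i A _ _ => A rPos 0 = v * d + i ∧ ∃ q : ℕ → ℕ,
      (∀ j < i, IsDigit L (x (v * d + j)) (q j)) ∧ A rW 0 = horner (4 * 2 ^ L) q i)
      (by simp; omega) hS0 (by decide) rfl (by omega) ?_ ?_ ?_ ?_).conseq ?_
  · intro u hu
    simp [hu.ints 0 (by decide), hd]
  · intro k A R C v h; simpa using h
  · simp [hpos, horner]
  · rintro i u _ hi hu hus _ ⟨hp, q, hq, hw⟩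
    simp only [WP.seq_iff, WP.assign_iff, WP.assignReal_iff]
    refine (bitProgram_spec (S := S) (L := L) (x := x (v * d + i)) ?_ ?_ (hx01 i hi).1 (hx01 i hi).2
      (by simp; omega) hS0).conseq ?_
    · simp [hu.ints rLev (by decide), hL]
    · simp [hu.reals qCoord (by decide), hx, hp]
    rintro t hft ⟨ht1, ht2, q', hq', hw'⟩
    have e1 : t.ints rPos 0 = v * d + (i + 1) := by
      rw [hft.ints _ (by decide)]; simp [hp, add_assoc]
    simp at ht1
    refine ⟨by omega, ht2, e1, Function.update q i q', fun j hj => ?_, ?_⟩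
    · rcases Nat.lt_or_eq_of_le (Nat.le_of_lt_succ hj) with hj | rfl
      · rw [Function.update_of_ne (by omega)]; exact hq j hj
      · simpa using hq'
    -- Two doublings of `W`, followed by the `L` doublings made while the bits are appended, amount
    -- to a multiplication by the base `4 * 2 ^ L`.
    · rw [hw', horner, Function.update_self,
        horner_congr (e' := q) fun j hj => by rw [Function.update_of_ne (by omega)]]
      simp [hw]; ring
  · rintro t hf ⟨h1, h2, h3, h4⟩
    simp at h1
    refine ⟨?_, h2, by rw [h3]; ring, h4⟩
    nlinarith

/-- Computes the cells of all nodes and the lists of the nodes in each cell. -/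
def cellProgram : Program :=
  .assign rPos (.lit 0) ;;
  .forLoop rV (.lit 0) (.add (.get 0 (.lit 0)) (.lit 1))
    (.setInt rBase (.var rV) (.var rPos) ;; hashProgram ;; .setInt rKey (.var rV) (.var rW) ;;
      .assign rCur (.add (.var rW) (.get rOff (.lit 0))) ;;
      .setInt rNext (.var rV) (.get rHead (.var rCur)) ;;
      .setInt rHead (.var rCur) (.add (.var rV) (.lit 1)))

/-- A grid coordinate plus an offset digit is at most `2 ^ L + 1`, which is below the base `4 * 2 ^
L`. This bounds the indices used in the array of list heads. -/
theorem IsKey.add_lt {x : ℕ → ℝ} {d L v b : ℕ} (h : IsKey x d L v b) {e : ℕ → ℕ}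
    (he : ∀ i, e i ≤ 2) : b + horner (4 * 2 ^ L) e d < (4 * 2 ^ L) ^ d := by
  obtain ⟨q, hq, rfl⟩ := h
  rw [horner_add]
  refine horner_lt fun i hi => ?_
  have := (hq i hi).lt
  have := he i
  omega

theorem cellProgram_spec {s : Config} {S L d n o : ℕ} {x : ℕ → ℝ} (hL : s.ints rLev 0 = L)
    (hn : s.ints 0 0 = n) (hd : s.ints 0 1 = d) (hx : s.reals qCoord = x)
    (hx01 : ∀ v ≤ n, ∀ i < d, 0 ≤ x (v * d + i) ∧ x (v * d + i) ≤ 1)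
    (ho : s.ints rOff 0 = o) (ho' : o = horner (4 * 2 ^ L) (fun _ => 1) d)
    (hhead : ∀ c, s.ints rHead c = 0)
    (hS : s.space ≤ S) (hS0 : n + 1 ≤ S) (hS1 : (4 * 2 ^ L) ^ d ≤ S) :
    WP col inG cellProgram s fun t =>
      t.time ≤ s.time + ((n + 1) * (d * (60 * L + 150) + 130) + 30) ∧ t.space ≤ S ∧
      CellLists x d L o (n + 1) (t.ints rBase) (t.ints rKey) (t.ints rHead) (t.ints rNext) := by
  simp only [cellProgram, WP.seq_iff, WP.assign_iff]
  refine (WP.forLoop (S := S) (lo := 0) (hi := n + 1) (fun _ => d * (60 * L + 150) + 100)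
    (fun v A _ _ => A rPos 0 = v * d ∧
      CellLists x d L o v (A rBase) (A rKey) (A rHead) (A rNext))
      (by simp; omega) (by omega) (by decide) rfl (by omega) ?_ ?_ ?_ ?_).conseq ?_
  · intro u hu
    simp [hu.ints 0 (by decide), hn]
  · intro k A R C v h; simpa using h
  · simp
    exact ⟨by simp, by simp, by simpa [lastBelow] using hhead, by simp⟩
  · rintro v u _ hv hu hus huv ⟨hp, hc⟩
    simp only [WP.seq_iff, WP.assign_iff, WP.setInt_iff]
    refine (hashProgram_spec (S := S) (L := L) (d := d) (v := v) (x := x) ?_ ?_ ?_ ?_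
      (hx01 v (by omega)) (by simp [huv]; omega) (by omega)).conseq ?_
    · simp [hu.ints rLev (by decide), hL]
    · simp [hu.ints 0 (by decide), hd]
    · simp [hu.reals qCoord (by decide), hx]
    · simp [hp]
    rintro t hft ⟨ht1, ht2, ht3, ht4⟩
    have e1 : t.ints rV 0 = v := by
      rw [hft.ints _ (by decide)]; simp [huv]
    have e2 : t.ints rOff 0 = o := by
      rw [hft.ints _ (by decide)]; simp [hu.ints rOff (by decide), ho]
    have e3 : t.ints rBase = Function.update (u.ints rBase) v (v * d) := by
      rw [hft.ints _ (by decide)]; simp [huv, hp]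
    have e4 : t.ints rKey = u.ints rKey := by rw [hft.ints _ (by decide)]; simp
    have e5 : t.ints rHead = u.ints rHead := by rw [hft.ints _ (by decide)]; simp
    have e6 : t.ints rNext = u.ints rNext := by rw [hft.ints _ (by decide)]; simp
    have hlt : t.ints rW 0 + o < (4 * 2 ^ L) ^ d := by
      rw [ho']; exact ht4.add_lt fun _ => by norm_num
    simp at ht1
    simp [e1, e2, e3, e4, e5, e6, ht3]
    exact ⟨by omega, by omega, hc.succ ht4⟩
  · rintro t hf ⟨h1, h2, h3, h4⟩
    simp at h1
    refine ⟨?_, h2, h4⟩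
    nlinarith

/-! ### The lists of near nodes -/

/-- The distance of nodes `u` and `v`, whose coordinates are held by `x` one node after the
other. -/
noncomputable def flatDist (x : ℕ → ℝ) (d u v : ℕ) : ℝ :=
  √(∑ i ∈ Finset.range d, (x (u * d + i) - x (v * d + i)) * (x (u * d + i) - x (v * d + i)))

theorem abs_sub_le_flatDist (x : ℕ → ℝ) {d i : ℕ} (hi : i < d) (u v : ℕ) :
    |x (u * d + i) - x (v * d + i)| ≤ flatDist x d u v := by
  refine Real.abs_le_sqrt ?_
  rw [sq]
  exact Finset.single_le_sum (f := fun i =>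
    (x (u * d + i) - x (v * d + i)) * (x (u * d + i) - x (v * d + i)))
    (fun i _ => mul_self_nonneg _) (Finset.mem_range.2 hi)

/-- Cells are at least `r` wide unless there is only one, so the grid coordinates of near nodes
differ by at most `1`. A node is entered under its key plus the all-ones offset; neighbours are then
reached by digits `0`, `1`, `2` without negative numbers. -/
theorem exists_offset {x : ℕ → ℝ} {d n L u v a b : ℕ} {r : ℝ} {off : ℕ → ℕ}
    (hL : GridLevel n r L) (ho : OffsetTable (4 * 2 ^ L) d off) (ha : IsKey x d L u a)
    (hb : IsKey x d L v b) (h : flatDist x d u v < r) : ∃ k < 3 ^ d, a + off 0 = b + off k := by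
  obtain ⟨q, hq, rfl⟩ := ha
  obtain ⟨q', hq', rfl⟩ := hb
  have key : ∀ i < d, q i ≤ q' i + 1 ∧ q' i ≤ q i + 1 := by
    intro i hi
    have h1 := hq i hi
    have h2 := hq' i hi
    rcases hL.coarse with rfl | hr
    · have := h1.lt
      have := h2.lt
      simp at *
      omega
    · have h3 := abs_lt.1 ((abs_sub_le_flatDist x hi u v).trans_lt h)
      have hpos : (0 : ℝ) < 2 ^ L := by positivity
      have h4 : (x (u * d + i) - x (v * d + i)) * 2 ^ L < r * 2 ^ L :=
        mul_lt_mul_of_pos_right h3.2 hpos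
      have h5 : -r * 2 ^ L < (x (u * d + i) - x (v * d + i)) * 2 ^ L :=
        mul_lt_mul_of_pos_right h3.1 hpos
      have := h1.le
      have := h1.ge
      have := h2.le
      have := h2.ge
      constructor
      -- Cells are closed, so their boundaries give only weak inequalities. The strict bound on the
      -- distance yields `q i < q' i + 2`, and integrality does the rest.
      · have : (q i : ℝ) < (q' i + 1 + 1 : ℕ) := by push_cast; linarith
        have := Nat.cast_lt.1 this
        omega
      · have : (q' i : ℝ) < (q i + 1 + 1 : ℕ) := by push_cast; linarith
        have := Nat.cast_lt.1 this
        omega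
  -- The required digit is the difference of the grid coordinates, shifted by one; beyond `d` any
  -- admissible value will do.
  obtain ⟨k, hk, hk'⟩ := ho.surj (fun i => if i < d then q i + 1 - q' i else 0) fun i => by
    split_ifs with hi
    · have := key i hi; omega
    · omega
  refine ⟨k, hk, ?_⟩
  rw [hk', ho.first, horner_add, horner_add]
  refine horner_congr fun i hi => ?_
  have := key i hi
  simp only [hi, if_true]
  omega

/-- The converse estimate, which limits the work. Since digits and offsets add without carries,
`horner_inj` applies to the sums, and a node found by the search is at most two cell widths away in
each coordinate. -/
theorem abs_sub_le_of_offset {x : ℕ → ℝ} {d L u v a b k : ℕ} {off : ℕ → ℕ}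
    (ho : OffsetTable (4 * 2 ^ L) d off) (ha : IsKey x d L u a)
    (hb : IsKey x d L v b) (hk : k < 3 ^ d) (h : a + off 0 = b + off k) :
    ∀ i < d, |x (u * d + i) - x (v * d + i)| * 2 ^ L ≤ 2 := by
  obtain ⟨q, hq, rfl⟩ := ha
  obtain ⟨q', hq', rfl⟩ := hb
  obtain ⟨e, he, he'⟩ := ho.digits k hk
  rw [ho.first, he', horner_add, horner_add] at h
  intro i hi
  have h1 := hq i hi
  have h2 := hq' i hi
  have hi' := horner_inj (fun j hj => by have := (hq j hj).lt; omega)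
    (fun j hj => by have := (hq' j hj).lt; have := he j; omega) h i hi
  have h3 : q i ≤ q' i + 1 ∧ q' i ≤ q i + 1 := by have := he i; omega
  have h4 : (q i : ℝ) ≤ q' i + 1 := by exact_mod_cast h3.1
  have h5 : (q' i : ℝ) ≤ q i + 1 := by exact_mod_cast h3.2
  have := h1.le
  have := h1.ge
  have := h2.le
  have := h2.ge
  rw [← abs_of_pos (show (0 : ℝ) < 2 ^ L by positivity), ← abs_mul, abs_le]
  constructor <;> linarith

end RAM

namespace RAM

variable {col : ℕ → ℕ → Prop} {inG : ℕ → Prop}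

/-- Node `u` is near node `v`. -/
def IsNear (x : ℕ → ℝ) (n d : ℕ) (r : ℝ) (v u : ℕ) : Prop :=
  u ≤ n ∧ u ≠ v ∧ flatDist x d u v < r

open Classical in
/-- The number of nodes near node `v`. -/
noncomputable def nearCard (x : ℕ → ℝ) (n d : ℕ) (r : ℝ) (v : ℕ) : ℕ :=
  ((Finset.range (n + 1)).filter (IsNear x n d r v)).card

/-- The entries `lo, …, hi - 1` of `nbr` list the numbers with property `p`, each once, and `ds`
contains their values under `δ`. -/
structure Row (δ : ℕ → ℝ) (lo hi : ℕ) (nbr : ℕ → ℕ) (ds : ℕ → ℝ) (p : ℕ → Prop) : Prop where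
  le : lo ≤ hi
  mem : ∀ u, (∃ j, lo ≤ j ∧ j < hi ∧ nbr j = u) ↔ p u
  inj : ∀ j j', lo ≤ j → j < hi → lo ≤ j' → j' < hi → nbr j = nbr j' → j = j'
  dist : ∀ j, lo ≤ j → j < hi → ds j = δ (nbr j)

namespace Row

variable {δ : ℕ → ℝ} {lo hi : ℕ} {nbr nbr' : ℕ → ℕ} {ds ds' : ℕ → ℝ} {p p' : ℕ → Prop}

theorem congr (h : Row δ lo hi nbr ds p) (hn : ∀ j < hi, nbr' j = nbr j)
    (hd : ∀ j < hi, ds' j = ds j) : Row δ lo hi nbr' ds' p := by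
  refine ⟨h.le, fun u => ?_, fun j j' h1 h2 h3 h4 h5 => ?_, fun j h1 h2 => ?_⟩
  · rw [← h.mem u]
    constructor <;> rintro ⟨j, h1, h2, h3⟩ <;> refine ⟨j, h1, h2, ?_⟩
    · rwa [← hn j h2]
    · rwa [hn j h2]
  · rw [hn j h2, hn j' h4] at h5
    exact h.inj j j' h1 h2 h3 h4 h5
  · rw [hd j h2, hn j h2, h.dist j h1 h2]

theorem of_iff (h : Row δ lo hi nbr ds p) (hp : ∀ u, p u ↔ p' u) : Row δ lo hi nbr ds p' :=
  ⟨h.le, fun u => (h.mem u).trans (hp u), h.inj, h.dist⟩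

theorem snoc (h : Row δ lo hi nbr ds p) {u : ℕ} (hu : ¬ p u) :
    Row δ lo (hi + 1) (Function.update nbr hi u) (Function.update ds hi (δ u))
      (fun w => p w ∨ w = u) := by
  have hle := h.le
  have hne : ∀ j, lo ≤ j → j < hi → nbr j ≠ u := fun j h1 h2 h3 => hu ((h.mem u).1 ⟨j, h1, h2, h3⟩)
  refine ⟨by omega, fun w => ?_, fun j j' h1 h2 h3 h4 h5 => ?_, fun j h1 h2 => ?_⟩
  · rw [← h.mem w]
    constructor
    · rintro ⟨j, h1, h2, h3⟩
      rcases Nat.lt_or_eq_of_le (Nat.le_of_lt_succ h2) with h2 | rfl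
      · rw [Function.update_of_ne (by omega)] at h3
        exact Or.inl ⟨j, h1, h2, h3⟩
      · rw [Function.update_self] at h3
        exact Or.inr h3.symm
    · rintro (⟨j, h1, h2, h3⟩ | rfl)
      · exact ⟨j, h1, by omega, by rwa [Function.update_of_ne (by omega)]⟩
      · exact ⟨hi, hle, by omega, by simp⟩
  · rcases Nat.lt_or_eq_of_le (Nat.le_of_lt_succ h2) with h2 | rfl <;>
      rcases Nat.lt_or_eq_of_le (Nat.le_of_lt_succ h4) with h4 | rfl
    · rw [Function.update_of_ne (by omega), Function.update_of_ne (by omega)] at h5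
      exact h.inj j j' h1 h2 h3 h4 h5
    · rw [Function.update_of_ne (by omega), Function.update_self] at h5
      exact absurd h5 (hne j h1 h2)
    · rw [Function.update_self, Function.update_of_ne (by omega)] at h5
      exact absurd h5.symm (hne j' h3 h4)
    · rfl
  · rcases Nat.lt_or_eq_of_le (Nat.le_of_lt_succ h2) with h2 | rfl
    · rw [Function.update_of_ne (by omega), Function.update_of_ne (by omega), h.dist j h1 h2]
    · simp

theorem card_le (h : Row δ lo hi nbr ds p) {s : Finset ℕ} (hs : ∀ u, p u → u ∈ s) :
    hi ≤ lo + s.card := by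
  have : (Finset.Ico lo hi).card ≤ s.card := by
    refine Finset.card_le_card_of_injOn nbr (fun j hj => ?_) fun j hj j' hj' heq => ?_
    · rw [Finset.mem_coe, Finset.mem_Ico] at hj
      exact hs _ ((h.mem _).1 ⟨j, hj.1, hj.2, rfl⟩)
    · rw [Finset.mem_coe, Finset.mem_Ico] at hj hj'
      exact h.inj j j' hj.1 hj.2 hj'.1 hj'.2 heq
  rw [Nat.card_Ico] at this
  omega

theorem le_card (h : Row δ lo hi nbr ds p) {s : Finset ℕ} (hs : ∀ u ∈ s, p u) :
    lo + s.card ≤ hi := by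
  have : s.card ≤ (Finset.Ico lo hi).card := by
    refine (Finset.card_le_card (t := (Finset.Ico lo hi).image nbr) fun u hu => ?_).trans
      Finset.card_image_le
    obtain ⟨j, h1, h2, h3⟩ := (h.mem u).2 (hs u hu)
    exact Finset.mem_image.2 ⟨j, Finset.mem_Ico.2 ⟨h1, h2⟩, h3⟩
  rw [Nat.card_Ico] at this
  have := h.le
  omega

end Row

/-- Computes the distance of nodes `Node` and `V`. -/
def distProgram : Program :=
  .assignReal qSum (.ofInt (.lit 0)) ;;
  .forLoop rI (.lit 0) (.get 0 (.lit 1))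
    (.assignReal qDiff (.sub (.get qCoord (.add (.get rBase (.var rNode)) (.var rI)))
        (.get qCoord (.add (.get rBase (.var rV)) (.var rI)))) ;;
      .assignReal qSum (.add (.var qSum) (.mul (.var qDiff) (.var qDiff)))) ;;
  .assignReal qSum (.sqrt (.var qSum))

theorem distProgram_spec {s : Config} {S d u v : ℕ} {x : ℕ → ℝ} (hd : s.ints 0 1 = d)
    (hx : s.reals qCoord = x) (hu : s.ints rBase (s.ints rNode 0) = u * d)
    (hv : s.ints rBase (s.ints rV 0) = v * d) (hS : s.space ≤ S) (hS0 : 0 < S) :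
    WP col inG distProgram s fun t => t.time ≤ s.time + (60 * d + 50) ∧ t.space ≤ S ∧
      t.reals qSum 0 = flatDist x d u v := by
  simp only [distProgram, WP.seq_iff, WP.assignReal_iff]
  refine (WP.forLoop (S := S) (lo := 0) (hi := d) (fun _ => 40)
    (fun i _ R _ => R qSum 0 = ∑ j ∈ Finset.range i,
      (x (u * d + j) - x (v * d + j)) * (x (u * d + j) - x (v * d + j)))
      (by simp; omega) hS0 (by decide) rfl (by omega) ?_ ?_ ?_ ?_).conseq ?_
  · intro t ht
    simp [ht.ints 0 (by decide), hd]
  · intro k A R C v h; simpa using h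
  · simp
  · rintro i t _ hi ht hts hti hI
    simp [ht.ints rBase (by decide), ht.ints rNode (by decide), ht.ints rV (by decide),
      ht.reals qCoord (by decide), hx, hu, hv, hti, hI, Finset.sum_range_succ]
    omega
  · rintro t hf ⟨h1, h2, h3⟩
    simp at h1
    simp [h3, flatDist]
    exact ⟨by omega, by omega⟩

/-- Adds node `Cur - 1` to the list of node `V`, if it is near and not yet marked, and moves on
in the list of a cell. -/
def scanProgram : Program :=
  .assign rNode (.sub (.var rCur) (.lit 1)) ;;
  .branch (.intEq (.get rMark (.var rNode)) (.add (.var rV) (.lit 1))) .skip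
    (.setInt rMark (.var rNode) (.add (.var rV) (.lit 1)) ;; distProgram ;;
      .branch (.realLt (.var qSum) (.var qRad))
        (.setInt rNbr (.var rTot) (.var rNode) ;; .setReal qDist (.var rTot) (.var qSum) ;;
          .assign rTot (.add (.var rTot) (.lit 1))) .skip) ;;
  .assign rCur (.get rNext (.var rNode))

/-- The list of node `v`, from position `lo` on, contains the near nodes that are marked. -/
structure RowState (x : ℕ → ℝ) (n d : ℕ) (r : ℝ) (v lo tot : ℕ) (mark nbr nbr₀ : ℕ → ℕ)
    (ds ds₀ : ℕ → ℝ) : Prop where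
  row : Row (fun u => flatDist x d u v) lo tot nbr ds
    (fun u => IsNear x n d r v u ∧ mark u = v + 1)
  mark_self : mark v = v + 1
  mark_le : ∀ u, mark u ≤ v + 1
  old : ∀ j < lo, nbr j = nbr₀ j ∧ ds j = ds₀ j

theorem RowState.mark_far {x : ℕ → ℝ} {n d v lo tot u : ℕ} {r : ℝ} {mark nbr nbr₀ : ℕ → ℕ}
    {ds ds₀ : ℕ → ℝ} (h : RowState x n d r v lo tot mark nbr nbr₀ ds ds₀)
    (hu : ¬ IsNear x n d r v u) :
    RowState x n d r v lo tot (Function.update mark u (v + 1)) nbr nbr₀ ds ds₀ := by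
  refine ⟨h.row.of_iff fun w => and_congr_right fun hw => ?_, ?_, fun w => ?_, h.old⟩
  · rw [Function.update_of_ne]
    rintro rfl
    exact hu hw
  · rw [Function.update_apply]; split_ifs <;> [rfl; exact h.mark_self]
  · rw [Function.update_apply]; split_ifs <;> [rfl; exact h.mark_le w]

theorem RowState.mark_near {x : ℕ → ℝ} {n d v lo tot u : ℕ} {r : ℝ} {mark nbr nbr₀ : ℕ → ℕ}
    {ds ds₀ : ℕ → ℝ} (h : RowState x n d r v lo tot mark nbr nbr₀ ds ds₀)
    (hu : IsNear x n d r v u) (hm : mark u ≠ v + 1) :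
    RowState x n d r v lo (tot + 1) (Function.update mark u (v + 1)) (Function.update nbr tot u) nbr₀
      (Function.update ds tot (flatDist x d u v)) ds₀ := by
  have hle := h.row.le
  refine ⟨(h.row.snoc (u := u) (by simp [hm])).of_iff fun w => ?_, ?_, fun w => ?_, fun j hj => ?_⟩
  · rw [Function.update_apply]
    by_cases hw : w = u
    · subst hw; simp [hu]
    · simp [hw]
  · rw [Function.update_apply]; split_ifs <;> [rfl; exact h.mark_self]
  · rw [Function.update_apply]; split_ifs <;> [rfl; exact h.mark_le w]
  · rw [Function.update_of_ne (by omega), Function.update_of_ne (by omega)]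
    exact h.old j hj

/-- Guarantees that the next entry of the list is still written inside the space reserved for it. -/
theorem RowState.tot_lt {x : ℕ → ℝ} {n d v lo tot u : ℕ} {r : ℝ} {mark nbr nbr₀ : ℕ → ℕ}
    {ds ds₀ : ℕ → ℝ} (h : RowState x n d r v lo tot mark nbr nbr₀ ds ds₀)
    (hu : IsNear x n d r v u) (hm : mark u ≠ v + 1) : tot < lo + nearCard x n d r v := by
  classical
  have := (h.mark_near hu hm).row.card_le (s := (Finset.range (n + 1)).filter (IsNear x n d r v))
    fun w hw => by
      simp only [Finset.mem_filter, Finset.mem_range]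
      exact ⟨Nat.lt_succ_of_le hw.1.1, hw.1⟩
  rw [nearCard]
  omega

theorem scanProgram_spec {s : Config} {S n d v lo u : ℕ} {x : ℕ → ℝ} {r : ℝ} {nbr₀ : ℕ → ℕ}
    {ds₀ : ℕ → ℝ} (hd : s.ints 0 1 = d) (hx : s.reals qCoord = x) (hr : s.reals qRad 0 = r)
    (hcur : s.ints rCur 0 = u + 1) (hu : u ≤ n) (hv : s.ints rV 0 = v)
    (hbu : s.ints rBase u = u * d) (hbv : s.ints rBase v = v * d)
    (hS : s.space ≤ S) (hS0 : n + 1 ≤ S) (hS1 : lo + nearCard x n d r v ≤ S)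
    (h : RowState x n d r v lo (s.ints rTot 0) (s.ints rMark) (s.ints rNbr) nbr₀ (s.reals qDist)
      ds₀) :
    WP col inG scanProgram s fun t => t.time ≤ s.time + (60 * d + 150) ∧ t.space ≤ S ∧
      t.ints rCur 0 = s.ints rNext u ∧
      t.ints rMark = Function.update (s.ints rMark) u (v + 1) ∧
      RowState x n d r v lo (t.ints rTot 0) (t.ints rMark) (t.ints rNbr) nbr₀ (t.reals qDist)
        ds₀ := by
  rw [scanProgram, WP.seq_iff, WP.assign_iff, WP.seq_iff, WP.branch_iff]
  constructor
  · intro hb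
    simp [hcur, hv] at hb
    simp [hcur, ← hb]
    exact ⟨by omega, by omega, h⟩
  · intro hb
    simp [hcur, hv] at hb
    simp only [WP.seq_iff, WP.setInt_iff]
    refine (distProgram_spec (S := S) (d := d) (x := x) (u := u) (v := v) ?_ ?_ ?_ ?_ ?_
      (by omega)).conseq ?_
    · simp [hd]
    · simp [hx]
    · simp [hcur, hbu]
    · simp [hv, hbv]
    · simp [hcur]; omega
    rintro t hft ⟨ht1, ht2, ht3⟩
    have e1 : t.ints rNode 0 = u := by rw [hft.ints _ (by decide)]; simp [hcur]
    have e2 : t.ints rMark = Function.update (s.ints rMark) u (v + 1) := by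
      rw [hft.ints _ (by decide)]; simp [hcur, hv]
    have e3 : t.ints rTot = s.ints rTot := by rw [hft.ints _ (by decide)]; simp
    have e4 : t.ints rNbr = s.ints rNbr := by rw [hft.ints _ (by decide)]; simp
    have e5 : t.ints rNext = s.ints rNext := by rw [hft.ints _ (by decide)]; simp
    have e6 : t.reals qDist = s.reals qDist := by rw [hft.reals _ (by decide)]; simp
    have e7 : t.reals qRad 0 = r := by rw [hft.reals _ (by decide)]; simp [hr]
    simp at ht1
    rw [WP.branch_iff]
    constructor
    · intro hb'
      simp [ht3, e7] at hb'
      have hne : u ≠ v := by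
        rintro rfl
        exact hb h.mark_self
      have hnear : IsNear x n d r v u := ⟨hu, hne, hb'⟩
      have := h.tot_lt hnear hb
      simp [e1, e2, e3, e4, e5, e6, ht3]
      exact ⟨by omega, by omega, h.mark_near hnear hb⟩
    · intro hb'
      simp [ht3, e7] at hb'
      have hnear : ¬ IsNear x n d r v u := fun h' => absurd h'.2.2 (not_lt.2 hb')
      simp [e1, e2, e3, e4, e5, e6]
      exact ⟨by omega, by omega, h.mark_far hnear⟩

-- The list of a cell runs through decreasing node numbers, so the potential counts the nodes of the
-- cell below the cursor. Every node of the cell at or above the cursor has been marked.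
open Classical in
theorem scanLoop_spec {s : Config} {S n d v lo c L o : ℕ} {x : ℕ → ℝ} {r : ℝ} {nbr₀ : ℕ → ℕ}
    {ds₀ : ℕ → ℝ} (hd : s.ints 0 1 = d) (hx : s.reals qCoord = x) (hr : s.reals qRad 0 = r)
    (hv : s.ints rV 0 = v) (hvn : v ≤ n)
    (hc : CellLists x d L o (n + 1) (s.ints rBase) (s.ints rKey) (s.ints rHead) (s.ints rNext))
    (hcur : s.ints rCur 0 = s.ints rHead c)
    (hS : s.space ≤ S) (hS0 : n + 1 ≤ S) (hS1 : lo + nearCard x n d r v ≤ S)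
    (h : RowState x n d r v lo (s.ints rTot 0) (s.ints rMark) (s.ints rNbr) nbr₀ (s.reals qDist)
      ds₀) :
    WP col inG (.loop (.intLt (.lit 0) (.var rCur)) scanProgram) s fun t =>
      t.time ≤ s.time + (((Finset.range (n + 1)).filter fun u => s.ints rKey u + o = c).card *
        (60 * d + 160) + 10) ∧ t.space ≤ S ∧
      (∀ u, s.ints rMark u = v + 1 → t.ints rMark u = v + 1) ∧
      (∀ u ≤ n, s.ints rKey u + o = c → t.ints rMark u = v + 1) ∧
      RowState x n d r v lo (t.ints rTot 0) (t.ints rMark) (t.ints rNbr) nbr₀ (t.reals qDist)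
        ds₀ := by
  set cell : ℕ → ℕ := fun u => s.ints rKey u + o with hcell
  have hhead := hc.head_eq c
  refine (WP.loop (S := S) (fun A R _ => A rCur 0 ≤ n + 1 ∧
    (0 < A rCur 0 → cell (A rCur 0 - 1) = c) ∧
    (∀ u ≤ n, A rCur 0 ≤ u → cell u = c → A rMark u = v + 1) ∧
    (∀ u, s.ints rMark u = v + 1 → A rMark u = v + 1) ∧
    RowState x n d r v lo (A rTot 0) (A rMark) (A rNbr) nbr₀ (R qDist) ds₀)
    (fun A _ _ => ((Finset.range (n + 1)).filter fun u => cell u = c ∧ u < A rCur 0).card *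
      (60 * d + 160)) hS ?_ ?_).conseq ?_
  · rw [hcur, hhead]
    refine ⟨lastBelow_le _ _ _, fun h => cell_lastBelow h, fun u hu h1 h2 => ?_, fun u h => h, h⟩
    exact absurd h2 (cell_ne_of_lastBelow_le h1 (by omega))
  · rintro t hf hts ⟨h1, h2, h3, h4, h5⟩ hb
    simp at hb
    have eB : t.ints rBase = s.ints rBase := hf.ints _ (by decide)
    have eN : t.ints rNext = s.ints rNext := hf.ints _ (by decide)
    obtain ⟨u, hu⟩ : ∃ u, t.ints rCur 0 = u + 1 := ⟨t.ints rCur 0 - 1, by omega⟩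
    rw [hu] at h1 h2 h3
    have hcu : cell u = c := h2 (by omega)
    refine (scanProgram_spec (S := S) (n := n) (d := d) (v := v) (lo := lo) (u := u) (x := x)
      (r := r) ?_ ?_ ?_ hu (by omega) ?_ ?_ ?_ hts hS0 hS1 h5).conseq ?_
    · rw [hf.ints _ (by decide), hd]
    · rw [hf.reals _ (by decide), hx]
    · rw [hf.reals _ (by decide), hr]
    · rw [hf.ints _ (by decide), hv]
    · rw [eB, hc.base_eq u (by omega)]
    · rw [eB, hc.base_eq v (by omega)]
    rintro t' hft ⟨ht1, ht2, ht3, ht4, ht5⟩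
    have hnext : t'.ints rCur 0 = lastBelow cell c u := by
      rw [ht3, eN, hc.next_eq u (by omega), ← hcu]
    have hle := lastBelow_le cell c u
    refine ⟨?_, ht2, by omega, ?_, ?_, ?_, ht5⟩
    · have : ((Finset.range (n + 1)).filter fun w => cell w = c ∧ w < t'.ints rCur 0).card + 1 ≤
          ((Finset.range (n + 1)).filter fun w => cell w = c ∧ w < t.ints rCur 0).card := by
        refine Finset.card_lt_card (Finset.ssubset_iff_of_subset ?_ |>.2 ⟨u, ?_, ?_⟩)
        · intro w
          simp only [Finset.mem_filter]
          rintro ⟨h, h', h''⟩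
          exact ⟨h, h', by omega⟩
        · simp only [Finset.mem_filter, Finset.mem_range]
          exact ⟨by omega, hcu, by omega⟩
        · simp only [Finset.mem_filter]
          rintro ⟨-, -, h⟩
          omega
      have := Nat.mul_le_mul_right (60 * d + 160) this
      rw [Nat.add_mul] at this
      simp
      omega
    · intro h; rw [hnext] at h ⊢
      exact cell_lastBelow h
    · intro w hw h1' h2'
      rw [hnext] at h1'
      rw [ht4, Function.update_apply]
      split_ifs with hwu
      · rfl
      · refine h3 w hw ?_ h2'
        by_contra hlt
        exact cell_ne_of_lastBelow_le h1' (by omega) h2'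
    · intro w hw
      rw [ht4, Function.update_apply]
      split_ifs with hwu
      · rfl
      · exact h4 w hw
  · rintro t hf ⟨h1, h2, ⟨h3, h4, h5, h6, h7⟩, h8⟩
    simp at h8
    refine ⟨?_, h2, h6, fun u hu hcu => h5 u hu (by omega) hcu, h7⟩
    have : ((Finset.range (n + 1)).filter fun u => cell u = c ∧ u < s.ints rCur 0).card ≤
        ((Finset.range (n + 1)).filter fun u => cell u = c).card :=
      Finset.card_le_card fun w => by
        simp only [Finset.mem_filter]
        rintro ⟨h, h', -⟩
        exact ⟨h, h'⟩
    have := Nat.mul_le_mul_right (60 * d + 160) this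
    have e : ((Finset.range (n + 1)).filter fun u => s.ints rKey u + o = c).card =
        ((Finset.range (n + 1)).filter fun u => cell u = c).card := rfl
    rw [e]
    simp at h1
    omega

/-- Computes the list of the nodes near `V`. -/
def rowProgram : Program :=
  .setInt rStart (.var rV) (.var rTot) ;; .setInt rMark (.var rV) (.add (.var rV) (.lit 1)) ;;
  .forLoop rK (.lit 0) (.var rCnt)
    (.assign rCur (.get rHead (.add (.get rKey (.var rV)) (.get rOff (.var rK)))) ;;
      .loop (.intLt (.lit 0) (.var rCur)) scanProgram)

/-- Computes the lists of near nodes. -/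
def nearProgram : Program :=
  .assign rTot (.lit 0) ;;
  .forLoop rV (.lit 0) (.add (.get 0 (.lit 0)) (.lit 1)) rowProgram ;;
  .setInt rStart (.add (.get 0 (.lit 0)) (.lit 1)) (.var rTot)

open Classical in
/-- The number of nodes in the cells around node `v`, with multiplicity. -/
noncomputable def candCard (n d o : ℕ) (key off : ℕ → ℕ) (v : ℕ) : ℕ :=
  ∑ k ∈ Finset.range (3 ^ d), ((Finset.range (n + 1)).filter fun u => key u + o = key v + off k).card

/-- Marks left by earlier rows are at most `v` and therefore differ from `v + 1`, so they never have
to be cleared. Marking `v` at the start keeps it out of its own list. At the end all near nodes are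
marked, because `exists_offset` puts each of them in one of the cells searched. -/
theorem rowProgram_spec {s : Config} {S n d v L : ℕ} {x : ℕ → ℝ} {r : ℝ}
    (hd : s.ints 0 1 = d) (hx : s.reals qCoord = x) (hr : s.reals qRad 0 = r)
    (hv : s.ints rV 0 = v) (hvn : v ≤ n) (hcnt : s.ints rCnt 0 = 3 ^ d) (hL : GridLevel n r L)
    (ho : OffsetTable (4 * 2 ^ L) d (s.ints rOff))
    (hc : CellLists x d L (s.ints rOff 0) (n + 1) (s.ints rBase) (s.ints rKey) (s.ints rHead)
      (s.ints rNext))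
    (hm : ∀ u, s.ints rMark u ≤ v)
    (hS : s.space ≤ S) (hS0 : n + 2 ≤ S) (hS1 : s.ints rTot 0 + nearCard x n d r v ≤ S) :
    WP col inG rowProgram s fun t =>
      t.time ≤ s.time + (candCard n d (s.ints rOff 0) (s.ints rKey) (s.ints rOff) v *
        (60 * d + 160) + 3 ^ d * 60 + 60) ∧ t.space ≤ S ∧
      t.ints rStart = Function.update (s.ints rStart) v (s.ints rTot 0) ∧
      (∀ u, t.ints rMark u ≤ v + 1) ∧
      Row (fun u => flatDist x d u v) (s.ints rTot 0) (t.ints rTot 0) (t.ints rNbr) (t.reals qDist)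
        (IsNear x n d r v) ∧
      ∀ j < s.ints rTot 0, t.ints rNbr j = s.ints rNbr j ∧ t.reals qDist j = s.reals qDist j := by
  classical
  simp only [rowProgram, WP.seq_iff, WP.setInt_iff]
  refine (WP.forLoop (S := S) (lo := 0) (hi := 3 ^ d)
    (fun k => ((Finset.range (n + 1)).filter fun u =>
      s.ints rKey u + s.ints rOff 0 = s.ints rKey v + s.ints rOff k).card * (60 * d + 160) + 40)
    (fun k A R _ => (∀ u ≤ n, ∀ k' < k, s.ints rKey u + s.ints rOff 0 = s.ints rKey v + s.ints rOff k' →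
        A rMark u = v + 1) ∧
      RowState x n d r v (s.ints rTot 0) (A rTot 0) (A rMark) (A rNbr) (s.ints rNbr) (R qDist)
        (s.reals qDist)) ?_ (by omega) (by decide) rfl (by omega) ?_ ?_ ?_ ?_).conseq ?_
  · simp [hv]; omega
  · intro u hu
    simp [hu.ints rCnt (by decide), hcnt]
  · intro k A R C v h; simpa using h
  · simp [hv]
    refine ⟨⟨le_rfl, fun u => ?_, fun _ _ _ _ => by omega, fun _ _ => by omega⟩, by simp,
      fun u => ?_, by simp⟩
    · refine iff_of_false (fun ⟨j, h1, h2, _⟩ => by omega) ?_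
      rintro ⟨h1, h2⟩
      rw [Function.update_of_ne h1.2.1] at h2
      have := hm u
      omega
    · rw [Function.update_apply]
      have := hm u
      split_ifs <;> omega
  · rintro k u _ hk hu hus huk ⟨hI, hI'⟩
    simp only [WP.seq_iff, WP.assign_iff]
    have eO : u.ints rOff = s.ints rOff := by rw [hu.ints _ (by decide)]; simp
    have eB : u.ints rBase = s.ints rBase := by rw [hu.ints _ (by decide)]; simp
    have eK : u.ints rKey = s.ints rKey := by rw [hu.ints _ (by decide)]; simp
    have eH : u.ints rHead = s.ints rHead := by rw [hu.ints _ (by decide)]; simp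
    have eN : u.ints rNext = s.ints rNext := by rw [hu.ints _ (by decide)]; simp
    have eV : u.ints rV 0 = v := by rw [hu.ints _ (by decide)]; simp [hv]
    refine (scanLoop_spec (S := S) (n := n) (d := d) (v := v) (lo := s.ints rTot 0)
      (c := s.ints rKey v + s.ints rOff k) (L := L) (o := s.ints rOff 0) (x := x) (r := r)
      (nbr₀ := s.ints rNbr) (ds₀ := s.reals qDist)
      ?_ ?_ ?_ ?_ hvn ?_ ?_ ?_ (by omega) hS1 ?_).conseq ?_
    · simp [hu.ints 0 (by decide), hd]
    · simp [hu.reals 0 (by decide), hx]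
    · simp [hu.reals qRad (by decide), hr]
    · simp [eV]
    · simpa [eB, eK, eH, eN] using hc
    · simp [eH, eK, eO, eV, huk]
    · simp; omega
    · simpa using hI'
    rintro t hft ⟨ht1, ht2, ht3, ht4, ht5⟩
    simp [eK] at ht1 ht3 ht4
    refine ⟨by omega, ht2, fun w hw k' hk' hwk => ?_, ht5⟩
    rcases Nat.lt_or_eq_of_le (Nat.le_of_lt_succ hk') with hk' | rfl
    · exact ht3 w (hI w hw k' hk' hwk)
    · exact ht4 w hw hwk
  · rintro t hf ⟨h1, h2, h3, h4⟩
    refine ⟨?_, h2, ?_, h4.mark_le, ?_, h4.old⟩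
    · simp [Finset.sum_add_distrib, ← Finset.sum_mul] at h1
      rw [candCard]
      omega
    · rw [hf.ints _ (by decide)]; simp [hv]
    · refine h4.row.of_iff fun u => ⟨fun h => h.1, fun h => ⟨h, ?_⟩⟩
      obtain ⟨k, hk, hk'⟩ := exists_offset hL ho (hc.isKey u (Nat.lt_succ_of_le h.1))
        (hc.isKey v (by omega)) h.2.2
      exact h3 u h.1 k hk hk'

/-- The lists of near nodes: that of node `v` occupies the positions from `start v` to
`start (v + 1)` of `nbr`, and `ds` contains the distances. -/
def NearLists (x : ℕ → ℝ) (n d : ℕ) (r : ℝ) (start nbr : ℕ → ℕ) (ds : ℕ → ℝ) : Prop :=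
  ∀ v ≤ n, Row (fun u => flatDist x d u v) (start v) (start (v + 1)) nbr ds (IsNear x n d r v)

theorem nearProgram_spec {s : Config} {S n d L : ℕ} {x : ℕ → ℝ} {r : ℝ}
    (hn : s.ints 0 0 = n) (hd : s.ints 0 1 = d) (hx : s.reals qCoord = x) (hr : s.reals qRad 0 = r)
    (hcnt : s.ints rCnt 0 = 3 ^ d) (hL : GridLevel n r L)
    (ho : OffsetTable (4 * 2 ^ L) d (s.ints rOff))
    (hc : CellLists x d L (s.ints rOff 0) (n + 1) (s.ints rBase) (s.ints rKey) (s.ints rHead)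
      (s.ints rNext))
    (hm : ∀ u, s.ints rMark u = 0)
    (hS : s.space ≤ S) (hS0 : n + 2 ≤ S)
    (hS1 : ∑ v ∈ Finset.range (n + 1), nearCard x n d r v ≤ S) :
    WP col inG nearProgram s fun t =>
      t.time ≤ s.time + ((∑ v ∈ Finset.range (n + 1),
        candCard n d (s.ints rOff 0) (s.ints rKey) (s.ints rOff) v) *
        (60 * d + 160) + (n + 1) * (3 ^ d * 60 + 100) + 60) ∧ t.space ≤ S ∧
      NearLists x n d r (t.ints rStart) (t.ints rNbr) (t.reals qDist) := by
  classical
  simp only [nearProgram, WP.seq_iff, WP.setInt_iff, WP.assign_iff]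
  -- The entry `start (w + 1)` is written only when row `w + 1` begins. Until then the end of the
  -- latest row is the current total, which explains the case distinction; the entry for `n + 1` is
  -- written after the loop.
  refine (WP.forLoop (S := S) (lo := 0) (hi := n + 1)
    (fun v => candCard n d (s.ints rOff 0) (s.ints rKey) (s.ints rOff) v * (60 * d + 160) +
      3 ^ d * 60 + 60)
    (fun v A R _ => (∀ u, A rMark u ≤ v) ∧
      A rTot 0 = ∑ w ∈ Finset.range v, nearCard x n d r w ∧
      ∀ w < v, Row (fun u => flatDist x d u w) (A rStart w)
        (if w + 1 = v then A rTot 0 else A rStart (w + 1)) (A rNbr) (R qDist) (IsNear x n d r w) ∧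
        A rStart w ≤ A rTot 0 ∧ (w + 1 ≠ v → A rStart (w + 1) ≤ A rTot 0))
    ?_ (by omega) (by decide) rfl (by omega) ?_ ?_ ?_ ?_).conseq ?_
  · simp; omega
  · intro u hu
    simp [hu.ints 0 (by decide), hn]
  · intro k A R C v h; simpa using h
  · simp [hm]
  · rintro v u _ hv hu hus huv ⟨hI1, hI2, hI3⟩
    have eO : u.ints rOff = s.ints rOff := by rw [hu.ints _ (by decide)]; simp
    have eB : u.ints rBase = s.ints rBase := by rw [hu.ints _ (by decide)]; simp
    have eK : u.ints rKey = s.ints rKey := by rw [hu.ints _ (by decide)]; simp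
    have eH : u.ints rHead = s.ints rHead := by rw [hu.ints _ (by decide)]; simp
    have eN : u.ints rNext = s.ints rNext := by rw [hu.ints _ (by decide)]; simp
    have hsum : ∑ w ∈ Finset.range v, nearCard x n d r w + nearCard x n d r v ≤
        ∑ w ∈ Finset.range (n + 1), nearCard x n d r w := by
      rw [← Finset.sum_range_succ]
      exact Finset.sum_le_sum_of_subset (Finset.range_mono hv)
    refine (rowProgram_spec (S := S) (n := n) (d := d) (v := v) (L := L) (x := x) (r := r)
      ?_ ?_ ?_ huv (by omega) ?_ hL ?_ ?_ hI1 hus hS0 (by omega)).conseq ?_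
    · simp [hu.ints 0 (by decide), hd]
    · simp [hu.reals 0 (by decide), hx]
    · simp [hu.reals qRad (by decide), hr]
    · simp [hu.ints rCnt (by decide), hcnt]
    · rwa [eO]
    · rwa [eO, eB, eK, eH, eN]
    rintro t hft ⟨ht1, ht2, ht3, ht4, ht5, ht6⟩
    rw [eO, eK] at ht1
    have hle := ht5.le
    refine ⟨by omega, ht2, ht4, ?_, ?_⟩
    · rw [Finset.sum_range_succ, ← hI2]
      refine le_antisymm ?_ ?_
      · exact ht5.card_le fun w hw => by
          simp only [Finset.mem_filter, Finset.mem_range]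
          exact ⟨Nat.lt_succ_of_le hw.1, hw⟩
      · exact ht5.le_card fun w hw => (Finset.mem_filter.1 hw).2
    · intro w hw
      rcases Nat.lt_or_eq_of_le (Nat.le_of_lt_succ hw) with hw | rfl
      · obtain ⟨h1, h2, h3⟩ := hI3 w hw
        have e : (if w + 1 = v + 1 then t.ints rTot 0 else t.ints rStart (w + 1)) =
            if w + 1 = v then u.ints rTot 0 else u.ints rStart (w + 1) := by
          rw [if_neg (by omega), ht3, Function.update_apply]
        have hle' : (if w + 1 = v then u.ints rTot 0 else u.ints rStart (w + 1)) ≤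
            u.ints rTot 0 := by
          split_ifs with h'
          · exact le_rfl
          · exact h3 h'
        rw [e, ht3, Function.update_of_ne (by omega)]
        refine ⟨h1.congr (fun j hj => (ht6 j (by omega)).1) fun j hj => (ht6 j (by omega)).2,
          by omega, fun _ => ?_⟩
        rw [Function.update_apply]
        split_ifs with h'
        · exact hle
        · exact (h3 h').trans hle
      · rw [if_pos rfl, ht3, Function.update_self]
        exact ⟨ht5, hle, fun h => absurd rfl h⟩
  · rintro t hf ⟨h1, h2, h3, h4, h5⟩
    have e0 : t.ints 0 0 = n := by rw [hf.ints _ (by decide)]; simp [hn]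
    simp [e0]
    refine ⟨?_, by omega, ?_⟩
    · simp [Finset.sum_add_distrib, ← Finset.sum_mul] at h1
      nlinarith
    · intro v hv
      obtain ⟨h6, -, -⟩ := h5 v (by omega)
      rw [Function.update_of_ne (by omega)]
      by_cases h' : v = n
      · subst h'
        rw [if_pos rfl] at h6
        simpa using h6
      · rw [if_neg (by omega)] at h6
        rwa [Function.update_of_ne (by omega)]

end RAM

namespace RAM

variable {col : ℕ → ℕ → Prop} {inG : ℕ → Prop}

/-- Rule for while loops, with an invariant `I`, a variant `μ` and an account `acc` of the time
used so far. -/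
theorem WP.loop_acc {b : Test} {P : Program} {s : Config} {S : ℕ}
    (I : (ℕ → ℕ → ℕ) → (ℕ → ℕ → ℝ) → List (ℕ × ℕ) → Prop)
    (μ acc : (ℕ → ℕ → ℕ) → List (ℕ × ℕ) → ℕ) (hS : s.space ≤ S)
    (h0 : I s.ints s.reals s.calls)
    (hstep : ∀ u, Frame (.loop b P) s u → u.space ≤ S → I u.ints u.reals u.calls → b.Holds u →
      WP col inG P u fun t => μ t.ints t.calls < μ u.ints u.calls ∧
        t.time + acc u.ints u.calls + (b.size + 1) ≤ u.time + acc t.ints t.calls ∧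
        t.space ≤ S ∧ I t.ints t.reals t.calls) :
    WP col inG (.loop b P) s fun t => t.time + acc s.ints s.calls ≤
      s.time + acc t.ints t.calls + (b.size + 1) ∧ t.space ≤ S ∧
        I t.ints t.reals t.calls ∧ ¬ b.Holds t := by
  suffices H : ∀ k, ∀ u : Config, μ u.ints u.calls < k → Frame (.loop b P) s u →
      u.space ≤ S → I u.ints u.reals u.calls →
      WP col inG (.loop b P) u fun t => t.time + acc u.ints u.calls ≤
        u.time + acc t.ints t.calls + (b.size + 1) ∧ t.space ≤ S ∧
          I t.ints t.reals t.calls ∧ ¬ b.Holds t from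
    H _ s (Nat.lt_succ_self _) (Frame.refl _ _) hS h0
  intro k
  induction k with
  | zero => exact fun u hk => absurd hk (Nat.not_lt_zero _)
  | succ k ih =>
    intro u hk hf hu hI
    by_cases hb : b.Holds u
    · obtain ⟨t, ht, h1, h2, h3, h4⟩ := hstep (u.tick (b.size + 1)) ⟨hf.ints, hf.reals, hf.calls⟩ hu
        hI ((Test.holds_tick _ _).2 hb)
      simp only [Config.tick_time, Config.tick_ints, Config.tick_calls] at h1 h2
      have hf' := ht.frame
      obtain ⟨t', ht', h5, h6⟩ := ih t (by omega)
        (hf.trans ⟨hf'.ints, hf'.reals, hf'.calls⟩) h3 h4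
      exact ⟨t', .loopTrue _ _ _ _ _ hb ht ht', by omega, h6⟩
    · exact ⟨_, .loopFalse _ _ _ hb, by simp; omega, hu, hI, by simpa using hb⟩

/-! ### Tournament trees -/

/-- The winner of a match: of the numbers `v + 1` and `v' + 1`, that with the smaller weight
(`0` means no participant). -/
noncomputable def winner (w : ℕ → ℝ) (a b : ℕ) : ℕ :=
  if a = 0 then b else if b = 0 then a else if w (b - 1) < w (a - 1) then b else a

/-- `T` is a tournament of the numbers `v < N` with property `p`: the leaf of `v` is at position
`N + v`, and the matches are at the positions `1, …, N - 1`. -/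
structure Tournament (N : ℕ) (w : ℕ → ℝ) (p : ℕ → Prop) (T : ℕ → ℕ) : Prop where
  leaf : ∀ v < N, p v → T (N + v) = v + 1
  leaf' : ∀ v < N, ¬ p v → T (N + v) = 0
  node : ∀ i, 1 ≤ i → i < N → T i = winner w (T (i + i)) (T (i + i + 1))

namespace Tournament

variable {N : ℕ} {w w' : ℕ → ℝ} {p p' : ℕ → Prop} {T T' : ℕ → ℕ}

/-- A nonzero entry comes from one of its two children, and thus from a leaf below. `N` need not be
a power of two: the children of a match are always at positions below `2 * N`. -/
theorem entry (h : Tournament N w p T) {i : ℕ} (hi : 1 ≤ i) (hi' : i < 2 * N) (h0 : T i ≠ 0) :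
    ∃ v < N, p v ∧ T i = v + 1 := by
  induction hk : 2 * N - i using Nat.strong_induction_on generalizing i with
  | _ k ih =>
    by_cases hN : N ≤ i
    · obtain ⟨v, rfl⟩ := Nat.exists_eq_add_of_le hN
      by_cases hp : p v
      · exact ⟨v, by omega, hp, h.leaf v (by omega) hp⟩
      · exact absurd (h.leaf' v (by omega) hp) h0
    · have hnode := h.node i hi (by omega)
      have : T i = T (i + i) ∨ T i = T (i + i + 1) := by
        rw [hnode, winner]; split_ifs <;> simp
      rcases this with h' | h' <;> rw [h'] at h0 ⊢
      · exact ih _ (by omega) (by omega) (by omega) h0 rfl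
      · exact ih _ (by omega) (by omega) (by omega) h0 rfl

/-- Weights do not increase on the way up, and halving the position leads to the root. -/
theorem root_le (h : Tournament N w p T) {i : ℕ} (hi : 1 ≤ i) (hi' : i < 2 * N) (h0 : T i ≠ 0) :
    T 1 ≠ 0 ∧ w (T 1 - 1) ≤ w (T i - 1) := by
  induction i using Nat.strong_induction_on with
  | _ i ih =>
    by_cases h1 : i = 1
    · subst h1; exact ⟨h0, le_rfl⟩
    · have hnode := h.node (i / 2) (by omega) (by omega)
      have : T (i / 2) ≠ 0 ∧ w (T (i / 2) - 1) ≤ w (T i - 1) := by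
        rw [hnode, winner]
        rcases (by omega : i = i / 2 + i / 2 ∨ i = i / 2 + i / 2 + 1) with h2 | h2
        · rw [← h2]
          split_ifs with h3 h4
          · exact absurd h3 h0
          · exact ⟨h0, le_rfl⟩
          · exact ⟨h4, le_of_lt (by assumption)⟩
          · exact ⟨h0, le_rfl⟩
        · rw [← h2]
          split_ifs with h3
          · exact ⟨h0, le_rfl⟩
          · exact ⟨h0, le_rfl⟩
          · exact ⟨h3, not_lt.1 (by assumption)⟩
      obtain ⟨h2, h3⟩ := ih (i / 2) (by omega) (by omega) (by omega) this.1
      exact ⟨h2, h3.trans this.2⟩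

theorem empty (h : Tournament N w p T) (h1 : T 1 = 0) {v : ℕ} (hv : v < N) : ¬ p v := by
  intro hp
  have := h.leaf v hv hp
  exact (h.root_le (i := N + v) (by omega) (by omega) (by omega)).1 h1

theorem min (h : Tournament N w p T) (hN : 0 < N) (h1 : T 1 ≠ 0) :
    T 1 - 1 < N ∧ p (T 1 - 1) ∧ ∀ v < N, p v → w (T 1 - 1) ≤ w v := by
  obtain ⟨z, hz, hpz, hz'⟩ := h.entry le_rfl (by omega) h1
  refine ⟨by omega, by rwa [hz', Nat.add_sub_cancel], fun v hv hp => ?_⟩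
  have h2 := h.leaf v hv hp
  have := (h.root_le (i := N + v) (by omega) (by omega) (by omega)).2
  rwa [h2, Nat.add_sub_cancel] at this

/-- Weights of non-participants are irrelevant. This is needed because a newly connected node
receives its cost before it becomes open. -/
theorem congr (h : Tournament N w p T) (hw : ∀ v < N, p v → w' v = w v)
    (hp : ∀ v < N, p v ↔ p' v) : Tournament N w' p' T := by
  refine ⟨fun v hv h' => h.leaf v hv ((hp v hv).2 h'), fun v hv h' =>
    h.leaf' v hv fun h'' => h' ((hp v hv).1 h''), fun i hi hi' => ?_⟩
  have key : ∀ j, 1 ≤ j → j < 2 * N → T j ≠ 0 → w' (T j - 1) = w (T j - 1) := fun j h1 h2 h3 => by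
    obtain ⟨v, hv, hpv, hv'⟩ := h.entry h1 h2 h3
    rw [hv', Nat.add_sub_cancel, hw v hv hpv]
  rw [h.node i hi hi', winner, winner]
  split_ifs with h1 h2 h3 h4 h4
  · rfl
  · rfl
  · rfl
  · rw [key _ (by omega) (by omega) h1, key _ (by omega) (by omega) h2] at h4
    exact absurd h3 h4
  · rw [key _ (by omega) (by omega) h1, key _ (by omega) (by omega) h2] at h4
    exact absurd h4 h3
  · rfl

end Tournament

/-- Writes `Arg` to the leaf `P` and plays the matches on the way to the root again. -/
def updateProgram : Program :=
  .setInt rTree (.var rP) (.var rArg) ;;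
  .loop (.intLt (.lit 1) (.var rP))
    (.assign rP (.half (.var rP)) ;;
      .assign rA (.get rTree (.add (.var rP) (.var rP))) ;;
      .assign rB (.get rTree (.add (.add (.var rP) (.var rP)) (.lit 1))) ;;
      .branch (.intEq (.var rA) (.lit 0)) (.setInt rTree (.var rP) (.var rB))
        (.branch (.intEq (.var rB) (.lit 0)) (.setInt rTree (.var rP) (.var rA))
          (.branch (.realLt (.get qCost (.sub (.var rB) (.lit 1)))
              (.get qCost (.sub (.var rA) (.lit 1))))
            (.setInt rTree (.var rP) (.var rB)) (.setInt rTree (.var rP) (.var rA)))))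

theorem updateProgram_match {u : Config} {S P : ℕ} {w : ℕ → ℝ} (hw : u.reals qCost = w)
    (hP : u.ints rP 0 = P) (hS : u.space ≤ S) (hS0 : P / 2 < S) :
    WP col inG (.assign rP (.half (.var rP)) ;;
      .assign rA (.get rTree (.add (.var rP) (.var rP))) ;;
      .assign rB (.get rTree (.add (.add (.var rP) (.var rP)) (.lit 1))) ;;
      .branch (.intEq (.var rA) (.lit 0)) (.setInt rTree (.var rP) (.var rB))
        (.branch (.intEq (.var rB) (.lit 0)) (.setInt rTree (.var rP) (.var rA))
          (.branch (.realLt (.get qCost (.sub (.var rB) (.lit 1)))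
              (.get qCost (.sub (.var rA) (.lit 1))))
            (.setInt rTree (.var rP) (.var rB)) (.setInt rTree (.var rP) (.var rA))))) u
      fun t => t.time ≤ u.time + 80 ∧ t.space ≤ S ∧ t.ints rP 0 = P / 2 ∧
        t.ints rTree = Function.update (u.ints rTree) (P / 2)
          (winner w (u.ints rTree (P / 2 + P / 2)) (u.ints rTree (P / 2 + P / 2 + 1))) := by
  simp only [WP.seq_iff, WP.assign_iff, WP.branch_iff, WP.setInt_iff]
  refine ⟨fun h1 => ?_, fun h1 => ⟨fun h2 => ?_, fun h2 => ⟨fun h3 => ?_, fun h3 => ?_⟩⟩⟩ <;>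
    simp [hP, hw] at * <;> simp [winner, *] <;> try omega
  exact congrArg _ (if_neg (not_lt.2 h3)).symm

/-- During the climb only matches at proper ancestors of the current position `P` may have a wrong
winner. Replaying the match at `P / 2` repairs that position and moves the defect one level up. -/
theorem updateProgram_spec {s : Config} {S n v a : ℕ} {p p' : ℕ → Prop} (hv : v ≤ n)
    (hT : Tournament (n + 1) (s.reals qCost) p (s.ints rTree)) (hP : s.ints rP 0 = n + 1 + v)
    (ha : s.ints rArg 0 = a) (hp : ∀ u, u ≠ v → (p u ↔ p' u)) (hpv : p' v → a = v + 1)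
    (hpv' : ¬ p' v → a = 0) (hS : s.space ≤ S) (hS0 : 2 * n + 2 ≤ S) :
    WP col inG updateProgram s fun t => t.time ≤ s.time + (90 * lg n + 30) ∧ t.space ≤ S ∧
      Tournament (n + 1) (s.reals qCost) p' (t.ints rTree) := by
  -- The leaf position is below `2 * (n + 1)`, whose logarithm is `Nat.log 2 (n + 1) + 1`, that is
  -- `lg n`.
  have hlg : Nat.log 2 (n + 1 + v) ≤ lg n := by
    rw [lg, ← Nat.log_mul_base (by norm_num) (by omega)]
    exact Nat.log_mono_right (by omega)
  rw [updateProgram, WP.seq_iff, WP.setInt_iff]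
  set w := s.reals qCost with hw
  refine (WP.loop (S := S)
    (fun A _ _ => 1 ≤ A rP 0 ∧ A rP 0 < 2 * (n + 1) ∧ A rTree (n + 1 + v) = a ∧
      (∀ u < n + 1, u ≠ v → A rTree (n + 1 + u) = s.ints rTree (n + 1 + u)) ∧
      ∀ i, 1 ≤ i → i < n + 1 →
        A rTree i = winner w (A rTree (i + i)) (A rTree (i + i + 1)) ∨ ∃ k, A rP 0 / 2 ^ (k + 1) = i)
    (fun A _ _ => 90 * Nat.log 2 (A rP 0)) ?_ ?_ ?_).conseq ?_
  · simp [hP]; omega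
  · simp [hP, ha]
    refine ⟨by omega, by omega, fun u hu huv => ?_, fun i hi hi' => ?_⟩
    · rw [Function.update_of_ne (by omega)]
    · by_cases h : (n + 1 + v) / 2 = i
      · exact Or.inr ⟨0, by simpa using h⟩
      · left
        rw [Function.update_of_ne (by omega), Function.update_of_ne (by omega),
          Function.update_of_ne (by omega)]
        exact hT.node i hi (by omega)
  · rintro u hf hu ⟨h1, h2, h3, h4, h5⟩ hb
    simp at hb
    set P := u.ints rP 0 with hPdef
    refine (updateProgram_match (S := S) (P := P) (w := w) ?_ rfl hu (by omega)).conseq ?_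
    · rw [hf.reals _ (by decide)]; simp [hw]
    rintro t hft ⟨ht1, ht2, ht3, ht4⟩
    refine ⟨?_, ht2, by omega, by omega, ?_, fun w hw hwv => ?_, fun i hi hi' => ?_⟩
    · have : Nat.log 2 P = Nat.log 2 (P / 2) + 1 := Nat.log_of_one_lt_of_le (by norm_num) (by omega)
      rw [ht3]
      simp
      omega
    · rw [ht4, Function.update_of_ne (by omega), h3]
    · rw [ht4, Function.update_of_ne (by omega), h4 w hw hwv]
    · rw [ht4, ht3]
      by_cases h6 : i = P / 2
      · left
        subst h6
        rw [Function.update_self, Function.update_of_ne (by omega),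
          Function.update_of_ne (by omega)]
      · rcases h5 i hi hi' with h7 | ⟨k, h7⟩
        · by_cases h8 : P / 2 / 2 = i
          · exact Or.inr ⟨0, by simpa using h8⟩
          · left
            rw [Function.update_of_ne h6, Function.update_of_ne (by omega),
              Function.update_of_ne (by omega), h7]
        · right
          cases k with
          | zero => exact absurd (by simpa using h7.symm) h6
          | succ k => exact ⟨k, by rw [Nat.div_div_eq_div_mul, ← pow_succ', h7]⟩
  · rintro t hf ⟨h1, h2, ⟨h3, h4, h5, h6, h7⟩, h8⟩
    simp at h8
    have hP1 : t.ints rP 0 = 1 := by omega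
    simp [hP1, hP] at h1
    refine ⟨by omega, h2, fun u hu hpu => ?_, fun u hu hpu => ?_, fun i hi hi' => ?_⟩
    · by_cases huv : u = v
      · subst huv; rw [h5, hpv hpu]
      · rw [h6 u hu huv, hT.leaf u hu ((hp u huv).2 hpu)]
    · by_cases huv : u = v
      · subst huv; rw [h5, hpv' hpu]
      · rw [h6 u hu huv, hT.leaf' u hu fun h => hpu ((hp u huv).1 h)]
    · rcases h7 i hi hi' with h9 | ⟨k, h9⟩
      · exact h9
      -- The root has no proper ancestor: the quotient is `0`, which is not the position of a match.
      · rw [hP1, Nat.div_eq_of_lt (Nat.one_lt_two_pow (by omega))] at h9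
        omega

end RAM

namespace FMT

/-- `FMT.ForLoop` is built from the front of the list, while the program extends a completed part of
the loop at its end. -/
theorem ForLoop.snoc {d : ℕ} {Q : PlanningProblem d} {n : ℕ} {p : ℕ → EuclideanSpace ℝ (Fin d)}
    {r : ℝ} {l : List ℕ} {s t u : State} {x : ℕ} (h : ForLoop Q n p r l s t)
    (hx : Consider Q n p r x t u) : ForLoop Q n p r (l ++ [x]) s u := by
  induction h with
  | nil s => exact .cons _ _ _ _ _ hx (.nil _)
  | cons y l s t v hy _ ih => exact .cons _ _ _ _ _ hy (ih hx)

end FMT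

namespace RAM

variable {col : ℕ → ℕ → Prop} {inG : ℕ → Prop}

/-! ### The choice of the parent -/

theorem flatDist_comm (x : ℕ → ℝ) (d u v : ℕ) : flatDist x d u v = flatDist x d v u := by
  unfold flatDist
  congr 1
  exact Finset.sum_congr rfl fun i _ => by ring

theorem IsNear.symm {x : ℕ → ℝ} {n d u v : ℕ} {r : ℝ} (hv : v ≤ n) (h : IsNear x n d r v u) :
    IsNear x n d r u v :=
  ⟨hv, h.2.1.symm, flatDist_comm x d u v ▸ h.2.2⟩

/-- Determines the best parent of `Node` among the open nodes near it. -/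
def bestProgram : Program :=
  .assign rBest (.lit 0) ;;
  .forLoop rI (.get rStart (.var rNode)) (.get rStart (.add (.var rNode) (.lit 1)))
    (.branch (.intEq (.get rStat (.get rNbr (.var rI))) (.lit 1))
      (.assignReal qVal (.add (.get qCost (.get rNbr (.var rI))) (.get qDist (.var rI))) ;;
        .branch (.conj (.intLt (.lit 0) (.var rBest)) (.neg (.realLt (.var qVal) (.var qBest))))
          .skip
          (.assign rBest (.add (.get rNbr (.var rI)) (.lit 1)) ;; .assignReal qBest (.var qVal)))
      .skip)

theorem NearLists.length_le {x : ℕ → ℝ} {n d v : ℕ} {r : ℝ} {start nbr : ℕ → ℕ} {ds : ℕ → ℝ}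
    (h : NearLists x n d r start nbr ds) (hv : v ≤ n) :
    start (v + 1) - start v ≤ nearCard x n d r v := by
  classical
  have := (h v hv).card_le (s := (Finset.range (n + 1)).filter (IsNear x n d r v)) fun w hw => by
      simp only [Finset.mem_filter, Finset.mem_range]
      exact ⟨Nat.lt_succ_of_le hw.1, hw⟩
  rw [nearCard]
  omega

/-- The premise that an open near node exists always holds when this is used, since `z` is one.
Searching the stored list of `X` accounts for the summand `nearCard` in `weight`. -/
theorem bestProgram_spec {s : Config} {S n d X : ℕ} {x : ℕ → ℝ} {r : ℝ} (hS : s.space ≤ S)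
    (hS0 : 0 < S) (hX : s.ints rNode 0 = X) (hXn : X ≤ n)
    (hnear : NearLists x n d r (s.ints rStart) (s.ints rNbr) (s.reals qDist)) :
    WP col inG bestProgram s fun t =>
      t.time ≤ s.time + (nearCard x n d r X * 80 + 40) ∧ t.space ≤ S ∧
      ((∃ y, IsNear x n d r X y ∧ s.ints rStat y = 1) →
        ∃ y, t.ints rBest 0 = y + 1 ∧ IsNear x n d r X y ∧ s.ints rStat y = 1 ∧
          t.reals qBest 0 = s.reals qCost y + flatDist x d y X ∧
          ∀ y', IsNear x n d r X y' → s.ints rStat y' = 1 →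
            t.reals qBest 0 ≤ s.reals qCost y' + flatDist x d y' X) := by
  have hrow := hnear X hXn
  have hlen := hnear.length_le hXn
  set lo := s.ints rStart X with hlo
  set hi := s.ints rStart (X + 1) with hhi
  set nbr := s.ints rNbr with hnbr
  set ds := s.reals qDist with hds
  rw [bestProgram, WP.seq_iff, WP.assign_iff]
  refine (WP.forLoop (S := S) (lo := lo) (hi := hi) (fun _ => 60)
    (fun k A R _ =>
      (A rBest 0 = 0 ∧ ∀ j, lo ≤ j → j < k → s.ints rStat (nbr j) ≠ 1) ∨
      ∃ j, lo ≤ j ∧ j < k ∧ A rBest 0 = nbr j + 1 ∧ s.ints rStat (nbr j) = 1 ∧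
        R qBest 0 = s.reals qCost (nbr j) + ds j ∧
        ∀ j', lo ≤ j' → j' < k → s.ints rStat (nbr j') = 1 →
          R qBest 0 ≤ s.reals qCost (nbr j') + ds j')
    ?_ hS0 (by decide) ?_ hrow.le ?_ ?_ ?_ ?_).conseq ?_
  · simp; omega
  · simp [hX, hlo]
  · intro u hu
    simp [hu.ints rStart (by decide), hu.ints rNode (by decide), hX, hhi]
  · intro k A R C v h; simpa using h
  · left
    simp
    omega
  · rintro k u hlk hk hu hus huk hI
    have e1 : u.ints rStat = s.ints rStat := by rw [hu.ints _ (by decide)]; simp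
    have e2 : u.ints rNbr = nbr := by rw [hu.ints _ (by decide)]; simp [hnbr]
    have e3 : u.reals qCost = s.reals qCost := by rw [hu.reals _ (by decide)]; simp
    have e4 : u.reals qDist = ds := by rw [hu.reals _ (by decide)]; simp [hds]
    simp only [WP.seq_iff, WP.assign_iff, WP.assignReal_iff, WP.branch_iff, WP.skip_iff]
    constructor
    · intro hb
      simp [e1, e2, huk] at hb
      constructor
      · intro hb'
        simp [e2, e3, e4, huk] at hb'
        simp
        refine ⟨by omega, ?_⟩
        rcases hI with ⟨hI, -⟩ | ⟨j, h1, h2, h3, h4, h5, h6⟩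
        · omega
        · refine Or.inr ⟨j, h1, by omega, h3, h4, h5, fun j' h7 h8 h9 => ?_⟩
          rcases Nat.lt_or_eq_of_le h8 with h8 | rfl
          · exact h6 j' h7 h8 h9
          · exact hb'.2
      · intro hb'
        simp [e2, e3, e4, huk] at hb'
        simp [e2, e3, e4, huk]
        refine ⟨by omega, k, hlk, le_rfl, rfl, hb, rfl, fun j' h7 h8 h9 => ?_⟩
        rcases Nat.lt_or_eq_of_le h8 with h8 | rfl
        · rcases hI with ⟨-, hI⟩ | ⟨j, h1, h2, h3, h4, h5, h6⟩
          · exact absurd h9 (hI j' h7 h8)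
          · exact (hb' (by omega)).le.trans (h6 j' h7 h8 h9)
        · exact le_rfl
    · intro hb
      simp [e1, e2, huk] at hb
      simp
      refine ⟨by omega, ?_⟩
      rcases hI with ⟨hI, hI'⟩ | ⟨j, h1, h2, h3, h4, h5, h6⟩
      · refine Or.inl ⟨hI, fun j h1 h2 => ?_⟩
        rcases Nat.lt_or_eq_of_le h2 with h2 | rfl
        · exact hI' j h1 h2
        · exact hb
      · refine Or.inr ⟨j, h1, by omega, h3, h4, h5, fun j' h7 h8 h9 => ?_⟩
        rcases Nat.lt_or_eq_of_le h8 with h8 | rfl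
        · exact h6 j' h7 h8 h9
        · exact absurd h9 hb
  · rintro t hf ⟨h1, h2, h3⟩
    simp at h1
    refine ⟨by omega, h2, ?_⟩
    rintro ⟨y, hy, hy'⟩
    rcases h3 with ⟨h3, h4⟩ | ⟨j, h3, h4, h5, h6, h7, h8⟩
    · obtain ⟨j, hj, hj', rfl⟩ := (hrow.mem y).2 hy
      exact absurd hy' (h4 j hj hj')
    · refine ⟨nbr j, h5, (hrow.mem _).1 ⟨j, h3, h4, rfl⟩, h6, ?_, fun y' hy' hy'' => ?_⟩
      · rw [h7, hrow.dist j h3 h4]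
      · obtain ⟨j', hj, hj', rfl⟩ := (hrow.mem y').2 hy'
        rw [← hrow.dist j' hj hj']
        exact h8 j' hj hj' hy''

/-! ### The pass over the unvisited nodes near `z` -/

/-- The parents and the depths stored for the visited nodes describe a tree with root `0`, whose
edges belong to `edges`. -/
structure TreeInv (n : ℕ) (stat par dep : ℕ → ℕ) (edges : Finset (ℕ × ℕ)) : Prop where
  root : stat 0 ≠ 0
  dep_root : dep 0 = 0
  parent : ∀ v ≤ n, stat v ≠ 0 → v ≠ 0 →
    par v ≤ n ∧ stat (par v) ≠ 0 ∧ (par v, v) ∈ edges ∧ dep v = dep (par v) + 1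
  dep_lt : ∀ v ≤ n, stat v ≠ 0 → dep v < ((Finset.range (n + 1)).filter fun u => stat u ≠ 0).card

theorem TreeInv.congr {n : ℕ} {stat stat' par dep : ℕ → ℕ} {edges : Finset (ℕ × ℕ)}
    (h : TreeInv n stat par dep edges) (hs : ∀ v ≤ n, stat' v ≠ 0 ↔ stat v ≠ 0) :
    TreeInv n stat' par dep edges := by
  have : ((Finset.range (n + 1)).filter fun u => stat' u ≠ 0) =
      (Finset.range (n + 1)).filter fun u => stat u ≠ 0 :=
    Finset.filter_congr fun u hu => hs u (Nat.le_of_lt_succ (Finset.mem_range.1 hu))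
  refine ⟨(hs 0 (Nat.zero_le _)).2 h.root, h.dep_root, fun v hv h0 h1 => ?_, fun v hv h0 => ?_⟩
  · obtain ⟨h2, h3, h4⟩ := h.parent v hv ((hs v hv).1 h0) h1
    exact ⟨h2, (hs _ h2).2 h3, h4⟩
  · rw [this]; exact h.dep_lt v hv ((hs v hv).1 h0)

/-- The depth bound survives because the new node, one level below its parent, also increases the
number of visited nodes by one. Old nodes keep their parents, since none of these is the unvisited
`x`. -/
theorem TreeInv.connect {n x y : ℕ} {stat par dep : ℕ → ℕ} {edges : Finset (ℕ × ℕ)}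
    (h : TreeInv n stat par dep edges) (hx : x ≤ n) (hx0 : stat x = 0) (hy : y ≤ n)
    (hy0 : stat y ≠ 0) : TreeInv n (Function.update stat x 3) (Function.update par x y)
      (Function.update dep x (dep y + 1)) (insert (y, x) edges) := by
  have hx' : x ≠ 0 := by rintro rfl; exact h.root hx0
  have hyx : y ≠ x := by rintro rfl; exact hy0 hx0
  have hcard : ((Finset.range (n + 1)).filter fun u => stat u ≠ 0).card <
      ((Finset.range (n + 1)).filter fun u => Function.update stat x 3 u ≠ 0).card := by
    refine Finset.card_lt_card (Finset.ssubset_iff_of_subset ?_ |>.2 ⟨x, ?_, ?_⟩)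
    · intro w
      simp only [Finset.mem_filter, Function.update_apply]
      rintro ⟨h1, h2⟩
      refine ⟨h1, ?_⟩
      split_ifs <;> [norm_num; exact h2]
    · simp; omega
    · simp [hx0]
  refine ⟨?_, ?_, fun v hv h0 h1 => ?_, fun v hv h0 => ?_⟩
  · rw [Function.update_of_ne hx'.symm]; exact h.root
  · rw [Function.update_of_ne hx'.symm]; exact h.dep_root
  · by_cases hvx : v = x
    · subst hvx
      simp [hyx, hy, hy0]
    · rw [Function.update_of_ne hvx] at h0
      obtain ⟨h2, h3, h4, h5⟩ := h.parent v hv h0 h1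
      have : par v ≠ x := by intro h'; rw [h'] at h3; exact h3 hx0
      rw [Function.update_of_ne hvx, Function.update_of_ne hvx, Function.update_of_ne this,
        Function.update_of_ne this]
      exact ⟨h2, h3, Finset.mem_insert_of_mem h4, h5⟩
  · by_cases hvx : v = x
    · subst hvx
      rw [Function.update_self]
      have := h.dep_lt y hy hy0
      omega
    · rw [Function.update_of_ne hvx] at h0 ⊢
      exact (h.dep_lt v hv h0).trans hcard

/-- The time account for the consideration of one node. -/
noncomputable def weight (x : ℕ → ℝ) (n d : ℕ) (r : ℝ) (v : ℕ) : ℕ := nearCard x n d r v + lg n + 1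

/-- The time account for a list of calls. -/
noncomputable def callWeight (x : ℕ → ℝ) (n d : ℕ) (r : ℝ) (C : List (ℕ × ℕ)) : ℕ :=
  (C.map fun c => weight x n d r c.2).sum

/-- The coordinates `x` are those of the nodes. -/
def IsCoord {d : ℕ} (n : ℕ) (p : ℕ → EuclideanSpace ℝ (Fin d)) (x : ℕ → ℝ) : Prop :=
  ∀ u ≤ n, ∀ v ≤ n, flatDist x d u v = dist (p u) (p v)

theorem IsCoord.mem_near {d n u v : ℕ} {p : ℕ → EuclideanSpace ℝ (Fin d)} {x : ℕ → ℝ} {r : ℝ}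
    (h : IsCoord n p x) (hv : v ≤ n) : u ∈ FMT.near n p r v ↔ IsNear x n d r v u := by
  rw [FMT.near, Finset.mem_filter, Finset.mem_range, Nat.lt_succ_iff, IsNear]
  refine and_congr_right fun hu => ?_
  rw [h u hu v hv]

/-- The situation during the pass, after the entries `lo, …, k - 1` of the list have been
treated. -/
structure PassInv {d : ℕ} (Q : PlanningProblem d) (n : ℕ) (p : ℕ → EuclideanSpace ℝ (Fin d)) (r : ℝ)
    (x : ℕ → ℝ) (σ₀ : FMT.State) (stat₀ : ℕ → ℕ) (cost₀ : ℕ → ℝ) (nbr : ℕ → ℕ) (lo k : ℕ)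
    (σ : FMT.State) (stat par dep new : ℕ → ℕ) (num : ℕ) (cost : ℕ → ℝ) (C : List (ℕ × ℕ)) :
    Prop where
  loop : FMT.ForLoop Q n p r (((List.Ico lo k).map nbr).filter fun v => stat₀ v = 0) σ₀ σ
  unvisited : σ.unvisited = (Finset.range (n + 1)).filter fun v => stat v = 0
  opened : σ.opened = (Finset.range (n + 1)).filter fun v => stat v = 1
  openNew : σ.openNew = (Finset.range (n + 1)).filter fun v => stat v = 3
  cost_eq : σ.cost = cost
  calls_eq : σ.calls = C
  tree : TreeInv n stat par dep σ.edges
  new_row : Row (fun _ => 0) 0 num new (fun _ => 0) fun v => v ≤ n ∧ stat v = 3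
  untouched : ∀ v, (∀ j, lo ≤ j → j < k → nbr j ≠ v) → stat v = stat₀ v
  stat_cases : ∀ v, stat v = stat₀ v ∨ stat₀ v = 0 ∧ stat v = 3
  cost_old : ∀ v, stat₀ v ≠ 0 → cost v = cost₀ v
  account : callWeight x n d r C = callWeight x n d r σ₀.calls +
    ∑ j ∈ Finset.Ico lo k, if stat₀ (nbr j) = 0 then weight x n d r (nbr j) else 0
  num_le : num * (lg n + 1) ≤
    ∑ j ∈ Finset.Ico lo k, if stat₀ (nbr j) = 0 then weight x n d r (nbr j) else 0

namespace PassInv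

variable {d n lo k num : ℕ} {Q : PlanningProblem d} {p : ℕ → EuclideanSpace ℝ (Fin d)}
  {r : ℝ} {x : ℕ → ℝ} {σ₀ σ : FMT.State} {stat₀ nbr stat par dep new : ℕ → ℕ} {cost₀ cost : ℕ → ℝ}
  {C : List (ℕ × ℕ)}

theorem skip (h : PassInv Q n p r x σ₀ stat₀ cost₀ nbr lo k σ stat par dep new num cost C)
    (hlo : lo ≤ k) (hk : stat₀ (nbr k) ≠ 0) :
    PassInv Q n p r x σ₀ stat₀ cost₀ nbr lo (k + 1) σ stat par dep new num cost C where
  __ := h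
  loop := by
    rw [List.Ico.succ_top hlo]
    simpa [hk] using h.loop
  untouched := fun v hv => h.untouched v fun j h1 h2 => hv j h1 (by omega)
  account := by rw [Finset.sum_Ico_succ_top hlo, if_neg hk, add_zero]; exact h.account
  num_le := by rw [Finset.sum_Ico_succ_top hlo, if_neg hk, add_zero]; exact h.num_le

theorem callWeight_snoc (y v : ℕ) : callWeight x n d r (C ++ [(y, v)]) =
    callWeight x n d r C + weight x n d r v := by
  simp [callWeight]

theorem isBestParent {y v : ℕ}
    (h : PassInv Q n p r x σ₀ stat₀ cost₀ nbr lo k σ stat par dep new num cost C)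
    (hx : IsCoord n p x) (hv : v ≤ n) (hy : IsNear x n d r v y) (hys : stat y = 1)
    (hmin : ∀ y', IsNear x n d r v y' → stat y' = 1 →
      cost y + flatDist x d y v ≤ cost y' + flatDist x d y' v) :
    FMT.IsBestParent n p r σ v y := by
  refine ⟨?_, fun y' hy' => ?_⟩
  · rw [Finset.mem_inter, hx.mem_near hv, h.opened, Finset.mem_filter, Finset.mem_range]
    exact ⟨hy, Nat.lt_succ_of_le hy.1, hys⟩
  · rw [Finset.mem_inter, hx.mem_near hv, h.opened, Finset.mem_filter] at hy'
    rw [h.cost_eq, ← hx y hy.1 v hv, ← hx y' hy'.1.1 v hv]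
    exact hmin y' hy'.1 hy'.2.2

theorem reject {y : ℕ}
    (h : PassInv Q n p r x σ₀ stat₀ cost₀ nbr lo k σ stat par dep new num cost C)
    (hlo : lo ≤ k) (hk : stat₀ (nbr k) = 0) (hbest : FMT.IsBestParent n p r σ (nbr k) y)
    (hcol : ¬ Q.CollisionFree (p y) (p (nbr k))) :
    PassInv Q n p r x σ₀ stat₀ cost₀ nbr lo (k + 1) { σ with calls := σ.calls ++ [(y, nbr k)] }
      stat par dep new num cost (C ++ [(y, nbr k)]) where
  __ := h
  loop := by
    rw [List.Ico.succ_top hlo]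
    have := h.loop.snoc (.reject σ y hbest hcol)
    simpa [hk] using this
  calls_eq := by rw [h.calls_eq]
  untouched := fun v hv => h.untouched v fun j h1 h2 => hv j h1 (by omega)
  account := by
    rw [callWeight_snoc, Finset.sum_Ico_succ_top hlo, if_pos hk, h.account, add_assoc]
  num_le := by
    rw [Finset.sum_Ico_succ_top hlo]
    exact h.num_le.trans (Nat.le_add_right _ _)

/-- The new node gets status `3` and not `1`, so that it cannot serve as a parent in the same pass:
`V_open` changes only after all of `X_near` has been treated. -/
theorem connect {y : ℕ}
    (h : PassInv Q n p r x σ₀ stat₀ cost₀ nbr lo k σ stat par dep new num cost C)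
    (hlo : lo ≤ k) (hk : stat₀ (nbr k) = 0) (hkn : nbr k ≤ n) (hks : stat (nbr k) = 0)
    (hyn : y ≤ n) (hys : stat y = 1)
    (hbest : FMT.IsBestParent n p r σ (nbr k) y)
    (hcol : Q.CollisionFree (p y) (p (nbr k))) :
    PassInv Q n p r x σ₀ stat₀ cost₀ nbr lo (k + 1)
      { σ with
        edges := insert (y, nbr k) σ.edges
        openNew := insert (nbr k) σ.openNew
        unvisited := σ.unvisited.erase (nbr k)
        cost := Function.update σ.cost (nbr k) (σ.cost y + dist (p y) (p (nbr k)))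
        calls := σ.calls ++ [(y, nbr k)] }
      (Function.update stat (nbr k) 3) (Function.update par (nbr k) y)
      (Function.update dep (nbr k) (dep y + 1)) (Function.update new num (nbr k)) (num + 1)
      (Function.update cost (nbr k) (cost y + dist (p y) (p (nbr k)))) (C ++ [(y, nbr k)]) where
  loop := by
    rw [List.Ico.succ_top hlo]
    have := h.loop.snoc (.connect σ y hbest hcol)
    simpa [hk] using this
  unvisited := by
    ext v
    simp only [h.unvisited, Finset.mem_erase, Finset.mem_filter, Function.update_apply]
    by_cases hv : v = nbr k <;> simp [hv]
  opened := by
    ext v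
    simp only [h.opened, Finset.mem_filter, Function.update_apply]
    by_cases hv : v = nbr k <;> simp [hv, hks]
  openNew := by
    ext v
    simp only [h.openNew, Finset.mem_filter, Finset.mem_insert, Finset.mem_range,
      Function.update_apply]
    by_cases hv : v = nbr k <;> simp [hv]; omega
  cost_eq := by rw [h.cost_eq]
  calls_eq := by rw [h.calls_eq]
  tree := h.tree.connect hkn hks hyn (by omega)
  new_row := by
    have := h.new_row.snoc (u := nbr k) (by simp [hks])
    refine (this.of_iff fun v => ?_).congr (fun _ _ => rfl) fun j _ => ?_
    · rw [Function.update_apply]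
      by_cases hv : v = nbr k <;> simp [hv, hkn]
    · rw [Function.update_apply]; split_ifs <;> rfl
  untouched := fun v hv => by
    rw [Function.update_of_ne (hv k hlo (by omega)).symm]
    exact h.untouched v fun j h1 h2 => hv j h1 (by omega)
  stat_cases := fun v => by
    rw [Function.update_apply]
    split_ifs with hv
    · exact Or.inr ⟨hv ▸ hk, rfl⟩
    · exact h.stat_cases v
  cost_old := fun v hv => by
    rw [Function.update_of_ne (by rintro rfl; exact hv hk)]
    exact h.cost_old v hv
  account := by
    rw [callWeight_snoc, Finset.sum_Ico_succ_top hlo, if_pos hk, h.account, add_assoc]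
  num_le := by
    rw [Finset.sum_Ico_succ_top hlo, if_pos hk]
    have := h.num_le
    -- The consideration that connects a node also pays in advance for its later insertion into the
    -- tournament.
    have h2 : lg n + 1 ≤ weight x n d r (nbr k) := by unfold weight; omega
    rw [Nat.add_mul, one_mul]
    omega

end PassInv

/-- Considers the node at position `J` of the list of near nodes, if it is unvisited. -/
def passProgram : Program :=
  .assign rNode (.get rNbr (.var rJ)) ;;
  .branch (.intEq (.get rStat (.var rNode)) (.lit 0))
    (bestProgram ;;
      .collisionFree rFlag (.lit 0) (.sub (.var rBest) (.lit 1)) (.var rNode) ;;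
      .branch (.intEq (.var rFlag) (.lit 1))
        (.setInt rPar (.var rNode) (.sub (.var rBest) (.lit 1)) ;;
          .setInt rDep (.var rNode) (.add (.get rDep (.sub (.var rBest) (.lit 1))) (.lit 1)) ;;
          .setReal qCost (.var rNode) (.var qBest) ;;
          .setInt rStat (.var rNode) (.lit 3) ;;
          .setInt rNew (.var rNumNew) (.var rNode) ;;
          .assign rNumNew (.add (.var rNumNew) (.lit 1)))
        .skip)
    .skip

theorem passProgram_spec {s : Config} {S d n lo hi k z : ℕ} {Q : PlanningProblem d}
    {p : ℕ → EuclideanSpace ℝ (Fin d)} {r : ℝ} {x : ℕ → ℝ} {σ₀ σ : FMT.State} {stat₀ : ℕ → ℕ}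
    {cost₀ : ℕ → ℝ} (hx : IsCoord n p x) (hS : s.space ≤ S) (hS0 : n + 2 ≤ S)
    (hnear : NearLists x n d r (s.ints rStart) (s.ints rNbr) (s.reals qDist))
    (hz : z ≤ n) (hlo : s.ints rStart z = lo) (hhi : s.ints rStart (z + 1) = hi)
    (hlk : lo ≤ k) (hk : k < hi) (hJ : s.ints rJ 0 = k) (hzs : stat₀ z = 1)
    (h : PassInv Q n p r x σ₀ stat₀ cost₀ (s.ints rNbr) lo k σ (s.ints rStat) (s.ints rPar)
      (s.ints rDep) (s.ints rNew) (s.ints rNumNew 0) (s.reals qCost) s.calls) :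
    WP (fun u v => Q.CollisionFree (p u) (p v)) inG passProgram s fun t =>
      t.time ≤ s.time + (20 + if stat₀ (s.ints rNbr k) = 0 then
        200 * weight x n d r (s.ints rNbr k) else 0) ∧ t.space ≤ S ∧
      ∃ σ', PassInv Q n p r x σ₀ stat₀ cost₀ (s.ints rNbr) lo (k + 1) σ' (t.ints rStat)
        (t.ints rPar) (t.ints rDep) (t.ints rNew) (t.ints rNumNew 0) (t.reals qCost) t.calls := by
  have hrow := hnear z hz
  rw [hlo, hhi] at hrow
  set X := s.ints rNbr k with hX
  have hXz : IsNear x n d r z X := (hrow.mem X).1 ⟨k, hlk, hk, rfl⟩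
  -- The list of `z` has no repetitions, so `X` still has its status from the beginning of the pass.
  -- Testing it now is the same as having fixed `X_near` beforehand.
  have hun : s.ints rStat X = stat₀ X := h.untouched X fun j h1 h2 h3 => by
    have := hrow.inj j k h1 (by omega) hlk hk h3
    omega
  rw [passProgram, WP.seq_iff, WP.assign_iff, WP.branch_iff]
  constructor
  · intro hb
    simp [hJ, ← hX, hun] at hb
    rw [WP.seq_iff]
    refine (bestProgram_spec (S := S) (n := n) (d := d) (X := X) (x := x) (r := r) (by simp; omega)
      (by omega) (by simp [hJ, hX]) hXz.1 (by simpa using hnear)).conseq ?_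
    rintro t hft ⟨ht1, ht2, ht3⟩
    -- Only unvisited nodes change status during the pass, so `z` is still open and `X` has an open
    -- near node.
    have hzst : s.ints rStat z = 1 := by
      rcases h.stat_cases z with h' | h' <;> omega
    obtain ⟨y, hy1, hy2, hy3, hy4, hy5⟩ := ht3 ⟨z, hXz.symm hz, by simpa using hzst⟩
    simp at hy3 hy4 hy5 ht1
    have hbest : FMT.IsBestParent n p r σ X y :=
      h.isBestParent hx hXz.1 hy2 hy3 (by rwa [← hy4])
    have e1 : t.ints rNode 0 = X := by rw [hft.ints _ (by decide)]; simp [hJ, hX]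
    have e2 : t.calls = s.calls := by rw [hft.calls (by decide)]; simp
    have e3 : t.ints rStat = s.ints rStat := by rw [hft.ints _ (by decide)]; simp
    have e4 : t.ints rPar = s.ints rPar := by rw [hft.ints _ (by decide)]; simp
    have e5 : t.ints rDep = s.ints rDep := by rw [hft.ints _ (by decide)]; simp
    have e6 : t.ints rNew = s.ints rNew := by rw [hft.ints _ (by decide)]; simp
    have e7 : t.ints rNumNew = s.ints rNumNew := by rw [hft.ints _ (by decide)]; simp
    have e8 : t.reals qCost = s.reals qCost := by rw [hft.reals _ (by decide)]; simp
    have hXn := hXz.1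
    have hw : nearCard x n d r X + 1 ≤ weight x n d r X := by unfold weight; omega
    rw [WP.seq_iff, WP.collisionFree_iff, WP.branch_iff]
    constructor
    · intro hb'
      have hcol : Q.CollisionFree (p y) (p X) := by
        by_contra hcol
        simp [truthValue, hy1, e1, hcol] at hb'
      have hconn := h.connect hlk hb hXz.1 (by rw [hun, hb]) hy2.1 hy3 hbest hcol
      -- The new nodes are distinct nodes, so the list of them fits into `n + 1` entries.
      have hnum : s.ints rNumNew 0 + 1 ≤ 0 + (Finset.range (n + 1)).card :=
        hconn.new_row.card_le fun u hu => Finset.mem_range.2 (Nat.lt_succ_of_le hu.1)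
      rw [Finset.card_range] at hnum
      have hd : flatDist x d y X = dist (p y) (p X) := hx y hy2.1 X hXz.1
      simp [hy1, e1, e2, e3, e4, e5, e6, e7, e8, hb, hy4, hd]
      refine ⟨by omega, by omega, _, hconn⟩
    · intro hb'
      have hcol : ¬ Q.CollisionFree (p y) (p X) := by
        intro hcol
        simp [truthValue, hy1, e1, hcol] at hb'
      have hrej := h.reject hlk hb hbest hcol
      simp [hy1, e1, e2, e3, e4, e5, e6, e7, e8, hb]
      refine ⟨by omega, by omega, _, hrej⟩
  · intro hb
    simp [hJ, ← hX, hun] at hb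
    simp [hb]
    exact ⟨by omega, σ, h.skip hlk hb⟩

end RAM

namespace RAM

variable {col : ℕ → ℕ → Prop} {inG : ℕ → Prop}

/-! ### One iteration -/

/-- Opens the newly connected node number `K`. -/
def openProgram : Program :=
  .assign rNode (.get rNew (.var rK)) ;; .setInt rStat (.var rNode) (.lit 1) ;;
  .assign rArg (.add (.var rNode) (.lit 1)) ;;
  .assign rP (.add (.add (.get 0 (.lit 0)) (.lit 1)) (.var rNode)) ;; updateProgram

/-- Status and tournament are changed together, one node at a time, so the tournament always
describes the nodes of status `1`. Each node costs one climb to the root. -/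
theorem openLoop_spec {s : Config} {S n num : ℕ} {new stat : ℕ → ℕ} (hn : s.ints 0 0 = n)
    (hS : s.space ≤ S) (hS0 : 2 * n + 2 ≤ S) (hnum : s.ints rNumNew 0 = num)
    (hnew : s.ints rNew = new) (hstat : s.ints rStat = stat)
    (hrow : Row (fun _ => 0) 0 num new (fun _ => 0) fun v => v ≤ n ∧ stat v = 3)
    (hT : Tournament (n + 1) (s.reals qCost) (fun v => stat v = 1) (s.ints rTree)) :
    WP col inG (.forLoop rK (.lit 0) (.var rNumNew) openProgram) s fun t =>
      t.time ≤ s.time + (num * (90 * lg n + 100) + 20) ∧ t.space ≤ S ∧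
      (∀ v ≤ n, t.ints rStat v = if stat v = 3 then 1 else stat v) ∧
      Tournament (n + 1) (s.reals qCost) (fun v => t.ints rStat v = 1) (t.ints rTree) := by
  refine (WP.forLoop (S := S) (lo := 0) (hi := num) (fun _ => 90 * lg n + 80)
    (fun k A _ _ => (∀ v, (∃ j < k, new j = v) → A rStat v = 1) ∧
      (∀ v, (¬ ∃ j < k, new j = v) → A rStat v = stat v) ∧
      Tournament (n + 1) (s.reals qCost) (fun v => A rStat v = 1) (A rTree))
    hS (by omega) (by decide) rfl (by omega) ?_ ?_ ?_ ?_).conseq ?_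
  · intro u hu
    simp [hu.ints rNumNew (by decide), hnum]
  · intro k A R C v h; simpa using h
  · simpa [hstat] using hT
  · rintro k u _ hk hu hus huk ⟨h1, h2, h3⟩
    have e1 : u.ints rNew = new := by rw [hu.ints _ (by decide), hnew]
    have e2 : u.reals qCost = s.reals qCost := hu.reals _ (by decide)
    have e3 : u.ints 0 0 = n := by rw [hu.ints _ (by decide), hn]
    obtain ⟨hXn, hX3⟩ := (hrow.mem (new k)).1 ⟨k, Nat.zero_le _, hk, rfl⟩
    rw [openProgram]
    simp only [WP.seq_iff, WP.assign_iff, WP.setInt_iff]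
    refine (updateProgram_spec (S := S) (n := n) (v := new k) (a := new k + 1)
      (p := fun v => u.ints rStat v = 1)
      (p' := fun v => Function.update (u.ints rStat) (new k) 1 v = 1) hXn ?_ ?_ ?_ ?_ ?_ ?_ ?_
      hS0).conseq ?_
    · simpa [e2] using h3
    · simp [e1, e3, huk]
    · simp [e1, huk]
    · intro v hv
      rw [Function.update_of_ne hv]
    · simp
    · simp
    · simp [e1, huk]; omega
    rintro t hft ⟨ht1, ht2, ht3⟩
    have e4 : t.ints rStat = Function.update (u.ints rStat) (new k) 1 := by
      rw [hft.ints _ (by decide)]; simp [huk, e1]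
    simp at ht1
    refine ⟨by omega, ht2, ?_, ?_, ?_⟩
    · rintro v ⟨j, hj, rfl⟩
      rw [e4, Function.update_apply]
      split_ifs with hjk
      · rfl
      · refine h1 _ ⟨j, ?_, rfl⟩
        by_contra h
        exact hjk (by rw [show j = k by omega])
    · intro v hv
      rw [e4, Function.update_of_ne, h2 v]
      · rintro ⟨j, hj, hj'⟩; exact hv ⟨j, by omega, hj'⟩
      · rintro rfl; exact hv ⟨k, by omega, rfl⟩
    · rw [e4]; simpa [e2] using ht3
  · rintro t hf ⟨h1, h2, h3, h4, h5⟩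
    simp at h1
    refine ⟨by nlinarith, h2, fun v hv => ?_, h5⟩
    split_ifs with h
    · obtain ⟨j, -, hj, hj'⟩ := (hrow.mem v).2 ⟨hv, h⟩
      exact h3 v ⟨j, hj, hj'⟩
    · refine h4 v ?_
      rintro ⟨j, hj, hj'⟩
      exact h ((hrow.mem v).1 ⟨j, Nat.zero_le _, hj, hj'⟩).2

/-- Closes `z` and determines its successor. -/
def closeProgram : Program :=
  .setInt rStat (.var rZ) (.lit 2) ;; .assign rArg (.lit 0) ;;
  .assign rP (.add (.add (.get 0 (.lit 0)) (.lit 1)) (.var rZ)) ;; updateProgram ;;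
  .branch (.intEq (.get rTree (.lit 1)) (.lit 0)) (.assign rDone (.lit 2))
    (.assign rZ (.sub (.get rTree (.lit 1)) (.lit 1)))

theorem closeProgram_spec {s : Config} {S n z : ℕ} (hn : s.ints 0 0 = n)
    (hz : s.ints rZ 0 = z) (hzn : z ≤ n) (hd : s.ints rDone 0 = 0)
    (hS : s.space ≤ S) (hS0 : 2 * n + 2 ≤ S)
    (hT : Tournament (n + 1) (s.reals qCost) (fun v => s.ints rStat v = 1) (s.ints rTree)) :
    WP col inG closeProgram s fun t =>
      t.time ≤ s.time + (90 * lg n + 90) ∧ t.space ≤ S ∧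
      t.ints rStat = Function.update (s.ints rStat) z 2 ∧
      Tournament (n + 1) (s.reals qCost) (fun v => t.ints rStat v = 1) (t.ints rTree) ∧
      (t.ints rDone 0 = 2 ∧ (∀ v ≤ n, t.ints rStat v ≠ 1) ∨
        t.ints rDone 0 = 0 ∧ t.ints rZ 0 ≤ n ∧ t.ints rStat (t.ints rZ 0) = 1 ∧
          ∀ v ≤ n, t.ints rStat v = 1 → s.reals qCost (t.ints rZ 0) ≤ s.reals qCost v) := by
  rw [closeProgram]
  simp only [WP.seq_iff, WP.assign_iff, WP.setInt_iff]
  refine (updateProgram_spec (S := S) (n := n) (v := z) (a := 0)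
      (p := fun v => s.ints rStat v = 1)
      (p' := fun v => Function.update (s.ints rStat) z 2 v = 1) hzn ?_ ?_ ?_ ?_ ?_ ?_ ?_
      hS0).conseq ?_
  · simpa using hT
  · simp [hz, hn]
  · simp
  · intro v hv
    rw [Function.update_of_ne hv]
  · simp
  · simp
  · simp [hz]; omega
  rintro t hft ⟨ht1, ht2, ht3⟩
  have e1 : t.ints rStat = Function.update (s.ints rStat) z 2 := by
    rw [hft.ints _ (by decide)]; simp [hz]
  have e2 : t.ints rDone 0 = 0 := by rw [hft.ints _ (by decide)]; simp [hd]
  simp at ht1 ht3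
  rw [WP.branch_iff]
  constructor
  · intro hb
    simp at hb
    simp [e1]
    refine ⟨by omega, by omega, ht3, fun v hv => ht3.empty hb (by omega)⟩
  · intro hb
    simp at hb
    obtain ⟨h1, h2, h3⟩ := ht3.min (by omega) hb
    simp [e1, e2]
    exact ⟨by omega, by omega, ht3, by omega, h2, fun v hv h => h3 v (by omega) h⟩

/-- The memory represents the state `σ` of the algorithm. -/
structure Rep (n : ℕ) (σ : FMT.State) (stat par dep tree : ℕ → ℕ) (z : ℕ) (cost : ℕ → ℝ)
    (C : List (ℕ × ℕ)) : Prop where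
  z_eq : σ.z = z
  z_le : z ≤ n
  z_open : stat z = 1
  stat_le : ∀ v ≤ n, stat v ≤ 2
  unvisited : σ.unvisited = (Finset.range (n + 1)).filter fun v => stat v = 0
  opened : σ.opened = (Finset.range (n + 1)).filter fun v => stat v = 1
  cost_eq : σ.cost = cost
  calls_eq : σ.calls = C
  tree_inv : TreeInv n stat par dep σ.edges
  tourn : Tournament (n + 1) cost (fun v => stat v = 1) tree

/-- One iteration of FMT*. -/
def iterationProgram : Program :=
  .assign rNumNew (.lit 0) ;;
  .forLoop rJ (.get rStart (.var rZ)) (.get rStart (.add (.var rZ) (.lit 1))) passProgram ;;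
  .forLoop rK (.lit 0) (.var rNumNew) openProgram ;; closeProgram

theorem Rep.passInv {d n z : ℕ} {Q : PlanningProblem d} {p : ℕ → EuclideanSpace ℝ (Fin d)} {r : ℝ}
    {x : ℕ → ℝ} {σ : FMT.State} {stat par dep tree nbr new : ℕ → ℕ} {cost : ℕ → ℝ}
    {C : List (ℕ × ℕ)} (h : Rep n σ stat par dep tree z cost C) (lo : ℕ) :
    PassInv Q n p r x { σ with openNew := ∅ } stat cost nbr lo lo { σ with openNew := ∅ } stat par
      dep new 0 cost C where
  loop := by simpa using FMT.ForLoop.nil _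
  unvisited := h.unvisited
  opened := h.opened
  openNew := by
    symm
    rw [Finset.filter_eq_empty_iff]
    intro v hv
    have := h.stat_le v (Nat.le_of_lt_succ (Finset.mem_range.1 hv))
    omega
  cost_eq := h.cost_eq
  calls_eq := h.calls_eq
  tree := h.tree_inv
  new_row := ⟨le_rfl, fun u => by
    constructor
    · rintro ⟨j, h1, h2, -⟩; omega
    · rintro ⟨h1, h2⟩
      have := h.stat_le u h1
      omega, fun _ _ _ _ => by omega, fun _ _ => by omega⟩
  untouched := fun _ _ => rfl
  stat_cases := fun _ => Or.inl rfl
  cost_old := fun _ _ => rfl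
  account := by simp [h.calls_eq]
  num_le := by simp

/-- The list required by the pseudocode is the stored list of `z`, restricted to the nodes that were
unvisited at the start; the program's order is one of those permitted. -/
theorem PassInv.iteration {d n lo hi z num : ℕ} {Q : PlanningProblem d}
    {p : ℕ → EuclideanSpace ℝ (Fin d)} {r : ℝ} {x : ℕ → ℝ} {σ σ' : FMT.State}
    {stat₀ nbr stat par dep new : ℕ → ℕ} {cost₀ cost : ℕ → ℝ} {ds : ℕ → ℝ} {C : List (ℕ × ℕ)}
    (h : PassInv Q n p r x { σ with openNew := ∅ } stat₀ cost₀ nbr lo hi σ' stat par dep new num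
      cost C) (hx : IsCoord n p x) (hz : z ≤ n) (hσz : σ.z = z)
    (hun : σ.unvisited = (Finset.range (n + 1)).filter fun v => stat₀ v = 0)
    (hrow : Row (fun u => flatDist x d u z) lo hi nbr ds (IsNear x n d r z)) :
    FMT.Iteration Q n p r σ { σ' with
      opened := (σ'.opened ∪ σ'.openNew).erase z, closed := insert z σ'.closed } := by
  subst hσz
  refine .mk σ σ' _ ?_ (fun v => ?_) h.loop
  · refine List.Nodup.filter _ (List.Nodup.map_on (fun j hj j' hj' heq => ?_) (List.Ico.nodup _ _))
    rw [List.Ico.mem] at hj hj'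
    exact hrow.inj j j' hj.1 hj.2 hj'.1 hj'.2 heq
  · rw [Finset.mem_inter, hx.mem_near hz, ← hrow.mem v, hun]
    simp only [List.mem_filter, List.mem_map, List.Ico.mem, decide_eq_true_eq, Finset.mem_filter,
      Finset.mem_range]
    constructor
    · rintro ⟨⟨j, ⟨h1, h2⟩, h3⟩, h4⟩
      have := ((hrow.mem v).1 ⟨j, h1, h2, h3⟩).1
      exact ⟨⟨j, h1, h2, h3⟩, by omega, h4⟩
    · rintro ⟨⟨j, h1, h2, h3⟩, -, h4⟩
      exact ⟨⟨j, ⟨h1, h2⟩, h3⟩, h4⟩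

/-- Running through the list of `z` and closing `z` is charged to `weight x n d r z`. Each
consideration makes exactly one call, so its cost appears as the growth of `callWeight`; openings
are covered by `num_le`. -/
theorem iterationProgram_spec {s : Config} {S d n z : ℕ} {Q : PlanningProblem d}
    {p : ℕ → EuclideanSpace ℝ (Fin d)} {r : ℝ} {x : ℕ → ℝ} {σ : FMT.State}
    (hx : IsCoord n p x) (hS : s.space ≤ S) (hS0 : 2 * n + 2 ≤ S)
    (hn : s.ints 0 0 = n) (hd : s.ints rDone 0 = 0)
    (hnear : NearLists x n d r (s.ints rStart) (s.ints rNbr) (s.reals qDist))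
    (hz : s.ints rZ 0 = z)
    (h : Rep n σ (s.ints rStat) (s.ints rPar) (s.ints rDep) (s.ints rTree) z (s.reals qCost)
      s.calls) :
    WP (fun u v => Q.CollisionFree (p u) (p v)) inG iterationProgram s fun t =>
      t.time + 400 * callWeight x n d r s.calls ≤
        s.time + 400 * (weight x n d r z + callWeight x n d r t.calls) ∧
      callWeight x n d r s.calls ≤ callWeight x n d r t.calls ∧ t.space ≤ S ∧
      (∀ v ≤ n, t.ints rStat v = 2 ↔ s.ints rStat v = 2 ∨ v = z) ∧
      ∃ τ, FMT.Iteration Q n p r σ τ ∧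
        (t.ints rDone 0 = 2 ∧ τ.opened = ∅ ∧ τ.calls = t.calls ∨
          t.ints rDone 0 = 0 ∧ t.ints rZ 0 ∈ τ.opened ∧
            (∀ y ∈ τ.opened, τ.cost (t.ints rZ 0) ≤ τ.cost y) ∧
            Rep n { τ with z := t.ints rZ 0 } (t.ints rStat) (t.ints rPar) (t.ints rDep)
              (t.ints rTree) (t.ints rZ 0) (t.reals qCost) t.calls) := by
  have hzn := h.z_le
  have hrow := hnear z hzn
  have hlen := hnear.length_le hzn
  set lo := s.ints rStart z with hlo
  set hi := s.ints rStart (z + 1) with hhi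
  set nbr := s.ints rNbr with hnbr
  set stat₀ := s.ints rStat with hstat₀
  rw [iterationProgram, WP.seq_iff, WP.assign_iff, WP.seq_iff]
  refine (WP.forLoop (S := S) (lo := lo) (hi := hi)
    (fun k => 20 + if stat₀ (nbr k) = 0 then 200 * weight x n d r (nbr k) else 0)
    (fun k A R C => ∃ σ', PassInv Q n p r x { σ with openNew := ∅ } stat₀ (s.reals qCost) nbr lo k
      σ' (A rStat) (A rPar) (A rDep) (A rNew) (A rNumNew 0) (R qCost) C)
    (by simp; omega) (by omega) (by decide) ?_ hrow.le ?_ ?_ ?_ ?_).conseq ?_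
  · simp [hz, hlo]
  · intro u hu
    simp [hu.ints rStart (by decide), hu.ints rZ (by decide), hz, hhi]
  · intro k A R C v h; simpa using h
  · refine ⟨{ σ with openNew := ∅ }, ?_⟩
    simpa using h.passInv lo
  · rintro k u hlk hk hu hus huk ⟨σ', hσ'⟩
    have e1 : u.ints rStart = s.ints rStart := by rw [hu.ints _ (by decide)]; simp
    have e2 : u.ints rNbr = nbr := by rw [hu.ints _ (by decide)]; simp [hnbr]
    have e3 : u.reals qDist = s.reals qDist := by rw [hu.reals _ (by decide)]; simp
    have := passProgram_spec (inG := inG) (s := u) (S := S) (hi := hi) (z := z) (n := n) (k := k)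
      (lo := lo) hx hus (by have := h.tree_inv.dep_lt 0; omega) (by rw [e1, e2, e3]; exact hnear) hzn
      (by rw [e1]) (by rw [e1]) hlk hk huk h.z_open (by rw [e2]; exact hσ')
    rw [e2] at this
    exact this
  rintro t hft ⟨ht1, ht2, σ', hσ'⟩
  have f1 : t.ints rDone 0 = 0 := by rw [hft.ints _ (by decide)]; simp [hd]
  have f2 : t.ints 0 0 = n := by rw [hft.ints _ (by decide)]; simp [hn]
  have f3 : t.ints rTree = s.ints rTree := by rw [hft.ints _ (by decide)]; simp
  have f4 : t.ints rZ 0 = z := by rw [hft.ints _ (by decide)]; simp [hz]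
  set stat₁ := t.ints rStat with hstat₁
  set num := t.ints rNumNew 0 with hnum
  -- The pass has written costs only of nodes that were not open, so the old tournament is still
  -- valid for the new costs.
  have hT : Tournament (n + 1) (t.reals qCost) (fun v => stat₁ v = 1) (t.ints rTree) := by
    rw [f3]
    refine h.tourn.congr (fun v _ hv => hσ'.cost_old v (by omega)) fun v _ => ?_
    rcases hσ'.stat_cases v with h' | h' <;> omega
  rw [WP.seq_iff]
  refine (openLoop_spec (S := S) (n := n) (num := num) (new := t.ints rNew) (stat := stat₁) f2 ht2
    hS0 rfl rfl rfl hσ'.new_row hT).conseq ?_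
  rintro u hfu ⟨hu1, hu2, hu3, hu4⟩
  have g1 : u.ints rDone 0 = 0 := by rw [hfu.ints _ (by decide), f1]
  have g2 : u.ints 0 0 = n := by rw [hfu.ints _ (by decide), f2]
  have g3 : u.ints rZ 0 = z := by rw [hfu.ints _ (by decide), f4]
  have g4 : u.reals qCost = t.reals qCost := hfu.reals _ (by decide)
  refine (closeProgram_spec (S := S) (n := n) (z := z) g2 g3 hzn g1 hu2 hS0
    (by rw [g4]; exact hu4)).conseq ?_
  rintro v hfv ⟨hv1, hv2, hv3, hv4, hv5⟩
  have k1 : v.calls = t.calls := by rw [hfv.calls (by decide), hfu.calls (by decide)]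
  have k2 : v.reals qCost = t.reals qCost := by rw [hfv.reals _ (by decide), g4]
  have k3 : v.ints rPar = t.ints rPar := by rw [hfv.ints _ (by decide), hfu.ints _ (by decide)]
  have k4 : v.ints rDep = t.ints rDep := by rw [hfv.ints _ (by decide), hfu.ints _ (by decide)]
  rw [g4] at hv4 hv5
  have hz1 : stat₁ z = 1 := by
    have := h.z_open
    rcases hσ'.stat_cases z with h' | h' <;> omega
  have hst : ∀ w ≤ n, v.ints rStat w = if w = z then 2 else if stat₁ w = 3 then 1 else stat₁ w := by
    intro w hw
    rw [hv3, Function.update_apply, hu3 w hw]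
  have hst0 : ∀ w ≤ n, (v.ints rStat w = 0 ↔ stat₁ w = 0) := by
    intro w hw
    rw [hst w hw]
    split_ifs with h1 h2
    · simp [h1, hz1]
    · simp [h2]
    · rfl
  have hit := hσ'.iteration hx hzn h.z_eq h.unvisited hrow
  have hopen : (σ'.opened ∪ σ'.openNew).erase z =
      (Finset.range (n + 1)).filter fun w => v.ints rStat w = 1 := by
    ext w
    rw [hσ'.opened, hσ'.openNew, Finset.mem_erase, Finset.mem_union, Finset.mem_filter,
      Finset.mem_filter, Finset.mem_filter, Finset.mem_range]
    by_cases hw : w < n + 1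
    · rw [hst w (by omega)]
      by_cases h1 : w = z <;> by_cases h2 : stat₁ w = 3 <;> simp [h1, h2, hw]
    · simp [hw]
  refine ⟨?_, ?_, hv2, fun w hw => ?_, _, hit, ?_⟩
  · have hacc := hσ'.account
    have hnum := hσ'.num_le
    simp only [h.calls_eq] at hacc
    rw [k1, hacc]
    simp only [IntExp.size_get, IntExp.size_var, IntExp.size_add, IntExp.size_lit,
      Config.writeInt_time, Config.tick_time, Finset.sum_add_distrib, Finset.sum_const,
      Nat.card_Ico, smul_eq_mul] at ht1
    have e : (∑ j ∈ Finset.Ico lo hi, if stat₀ (nbr j) = 0 then 200 * weight x n d r (nbr j) else 0) =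
        200 * ∑ j ∈ Finset.Ico lo hi, if stat₀ (nbr j) = 0 then weight x n d r (nbr j) else 0 := by
      rw [Finset.mul_sum]
      exact Finset.sum_congr rfl fun j _ => by split_ifs <;> rfl
    rw [e] at ht1
    have hw : weight x n d r z = nearCard x n d r z + lg n + 1 := rfl
    have : num * (90 * lg n + 100) ≤ 100 * (num * (lg n + 1)) := by nlinarith
    omega
  · rw [k1, hσ'.account]
    simp only [h.calls_eq]
    exact Nat.le_add_right _ _
  · rw [hst w hw]
    have h1 := h.stat_le w hw
    have h2 := hσ'.stat_cases w
    split_ifs with h3 h4 <;> omega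
  · rcases hv5 with ⟨h1, h2⟩ | ⟨h1, h2, h3, h4⟩
    · refine Or.inl ⟨h1, ?_, ?_⟩
      · rw [hopen, Finset.filter_eq_empty_iff]
        exact fun w hw => h2 w (Nat.le_of_lt_succ (Finset.mem_range.1 hw))
      · rw [k1]; exact hσ'.calls_eq
    · refine Or.inr ⟨h1, ?_, fun y hy => ?_, ⟨rfl, h2, h3, fun w hw => ?_, ?_, hopen, ?_, ?_, ?_, ?_⟩⟩
      · rw [hopen, Finset.mem_filter, Finset.mem_range]
        exact ⟨by omega, h3⟩
      · rw [hopen, Finset.mem_filter, Finset.mem_range] at hy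
        simp only [hσ'.cost_eq]
        exact h4 y (by omega) hy.2
      · rw [hst w hw]
        have h1 := h.stat_le w hw
        have h2 := hσ'.stat_cases w
        split_ifs with h3 h4 <;> omega
      · simp only [hσ'.unvisited]
        exact Finset.filter_congr fun w hw =>
          (hst0 w (Nat.le_of_lt_succ (Finset.mem_range.1 hw))).symm
      · rw [k2]; exact hσ'.cost_eq
      · rw [k1]; exact hσ'.calls_eq
      · rw [k3, k4]
        exact hσ'.tree.congr fun w hw => not_congr (hst0 w hw)
      · rw [k2]; exact hv4

end RAM

namespace RAM

variable {col : ℕ → ℕ → Prop} {inG : ℕ → Prop}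

/-! ### The main loop -/

/-- The main loop of FMT*. -/
def mainLoop : Program :=
  .loop (.intEq (.var rDone) (.lit 0))
    (.inGoal rFlag (.lit 0) (.var rZ) ;;
      .branch (.intEq (.var rFlag) (.lit 1)) (.assign rDone (.lit 1)) iterationProgram)

/-- Every way to complete the run from state `σ` is a way to complete the run from the start. -/
def Reached {d : ℕ} (Q : PlanningProblem d) (n : ℕ) (p : ℕ → EuclideanSpace ℝ (Fin d)) (r : ℝ)
    (σ : FMT.State) : Prop :=
  ∀ result calls, FMT.WhileLoop Q n p r σ result calls →
    FMT.WhileLoop Q n p r (FMT.start n) result calls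

/-- The number of calls is not known in advance, so time is compared with an account of what has
happened so far instead of a potential. `FMT.WhileLoop` is defined from the end of a run; `Reached`
carries the completed part as a continuation. -/
theorem mainLoop_spec {s : Config} {S d n : ℕ} {Q : PlanningProblem d}
    {p : ℕ → EuclideanSpace ℝ (Fin d)} {r : ℝ} {x : ℕ → ℝ}
    (hx : IsCoord n p x) (hS : s.space ≤ S) (hS0 : 2 * n + 2 ≤ S)
    (hn : s.ints 0 0 = n) (hd : s.ints rDone 0 = 0)
    (hnear : NearLists x n d r (s.ints rStart) (s.ints rNbr) (s.reals qDist))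
    (h : Rep n (FMT.start n) (s.ints rStat) (s.ints rPar) (s.ints rDep) (s.ints rTree)
      (s.ints rZ 0) (s.reals qCost) s.calls) :
    WP (fun u v => Q.CollisionFree (p u) (p v)) (fun u => p u ∈ Q.goal) mainLoop s fun t =>
      t.time ≤ s.time + (450 * (∑ v ∈ Finset.range (n + 1), weight x n d r v +
        callWeight x n d r t.calls) + 100) ∧ t.space ≤ S ∧
      ((t.ints rDone 0 = 1 ∧ ∃ σ, Reached Q n p r σ ∧ p (t.ints rZ 0) ∈ Q.goal ∧
          Rep n σ (t.ints rStat) (t.ints rPar) (t.ints rDep) (t.ints rTree)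
            (t.ints rZ 0) (t.reals qCost) t.calls) ∨
        (t.ints rDone 0 = 2 ∧ FMT.WhileLoop Q n p r (FMT.start n) none t.calls)) := by
  rw [mainLoop]
  -- The variant is the number of nodes that are not closed, plus one, and `0` once a result is
  -- determined. Each closed node is charged its weight once, and the `50` allows for the pass that
  -- detects the goal.
  refine (WP.loop_acc (S := S)
    (fun A R C =>
      ((A rDone 0 = 0 ∨ A rDone 0 = 1 ∧ p (A rZ 0) ∈ Q.goal) ∧ ∃ σ, Reached Q n p r σ ∧
          Rep n σ (A rStat) (A rPar) (A rDep) (A rTree) (A rZ 0) (R qCost) C) ∨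
        (A rDone 0 = 2 ∧ FMT.WhileLoop Q n p r (FMT.start n) none C))
    (fun A _ => if A rDone 0 = 0 then
      1 + ((Finset.range (n + 1)).filter fun v => A rStat v ≠ 2).card else 0)
    (fun A C => 450 * ∑ v ∈ (Finset.range (n + 1)).filter (fun v => A rStat v = 2),
      weight x n d r v + 450 * callWeight x n d r C + if A rDone 0 = 0 then 0 else 50)
    hS (Or.inl ⟨Or.inl hd, _, fun _ _ h => h, h⟩) ?_).conseq ?_
  · rintro u hu hus hI hb
    simp at hb
    obtain ⟨σ, hσ, hrep⟩ : ∃ σ, Reached Q n p r σ ∧ Rep n σ (u.ints rStat) (u.ints rPar)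
        (u.ints rDep) (u.ints rTree) (u.ints rZ 0) (u.reals qCost) u.calls := by
      rcases hI with ⟨-, h⟩ | h
      · exact h
      · omega
    rw [WP.seq_iff, WP.inGoal_iff, WP.branch_iff]
    constructor
    · intro hb'
      have hg : p (u.ints rZ 0) ∈ Q.goal := by
        by_contra hg
        simp [truthValue, hg] at hb'
      simp [hb, hg]
      refine ⟨by omega, by omega, σ, hσ, hrep⟩
    · intro hb'
      have hg : p (u.ints rZ 0) ∉ Q.goal := by
        intro hg
        simp [truthValue, hg] at hb'
      refine (iterationProgram_spec (S := S) (n := n) (z := u.ints rZ 0) (σ := σ) (r := r) hx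
        (by simp; omega) hS0 ?_ ?_ ?_ ?_ ?_).conseq ?_
      · simp [hu.ints 0 (by decide), hn]
      · simp [hb]
      · simpa [hu.ints rStart (by decide), hu.ints rNbr (by decide), hu.reals qDist (by decide)]
          using hnear
      · simp
      · simpa using hrep
      rintro t hft ⟨ht1, ht5, ht2, ht3, τ, hτ, ht4⟩
      simp at ht1 ht3 ht5
      have hzn := hrep.z_le
      have hmem : u.ints rZ 0 ∉ (Finset.range (n + 1)).filter (fun v => u.ints rStat v = 2) := by
        have := hrep.z_open
        simp [this]
      have hset : (Finset.range (n + 1)).filter (fun v => t.ints rStat v = 2) =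
          insert (u.ints rZ 0) ((Finset.range (n + 1)).filter (fun v => u.ints rStat v = 2)) := by
        ext v
        simp only [Finset.mem_filter, Finset.mem_insert, Finset.mem_range]
        constructor
        · rintro ⟨h1, h2⟩
          rcases (ht3 v (by omega)).1 h2 with h3 | h3
          · exact Or.inr ⟨h1, h3⟩
          · exact Or.inl h3
        · rintro (rfl | ⟨h1, h2⟩)
          · exact ⟨by omega, (ht3 _ hzn).2 (Or.inr rfl)⟩
          · exact ⟨h1, (ht3 v (by omega)).2 (Or.inl h2)⟩
      have hw : 1 ≤ weight x n d r (u.ints rZ 0) := by unfold weight; omega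
      have hgz : p σ.z ∉ Q.goal := by rwa [hrep.z_eq]
      refine ⟨?_, ?_, ht2, ?_⟩
      · rw [if_pos hb]
        split_ifs with hdone
        · have : ((Finset.range (n + 1)).filter fun v => t.ints rStat v ≠ 2).card <
              ((Finset.range (n + 1)).filter fun v => u.ints rStat v ≠ 2).card := by
            refine Finset.card_lt_card (Finset.ssubset_iff_of_subset ?_ |>.2 ⟨u.ints rZ 0, ?_, ?_⟩)
            · intro v
              simp only [Finset.mem_filter, Finset.mem_range]
              rintro ⟨h1, h2⟩
              exact ⟨h1, fun h3 => h2 ((ht3 v (by omega)).2 (Or.inl h3))⟩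
            · have := hrep.z_open
              simp [this]; omega
            · have := (ht3 _ hzn).2 (Or.inr rfl)
              simp [this]
          omega
        · omega
      · rw [hset, Finset.sum_insert hmem, if_pos hb]
        simp
        omega
      · rcases ht4 with ⟨h1, h2, h3⟩ | ⟨h1, h2, h3, h4⟩
        · refine Or.inr ⟨h1, ?_⟩
          rw [← h3]
          exact hσ _ _ (.failure σ τ hgz hτ h2)
        · exact Or.inl ⟨Or.inl h1, _, fun res calls h => hσ _ _ (.step σ τ _ _ _ hgz hτ h2 h3 h), h4⟩
  · rintro t hft ⟨ht1, ht2, ht3, ht4⟩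
    simp at ht1 ht4
    refine ⟨?_, ht2, ?_⟩
    · have : ∑ v ∈ (Finset.range (n + 1)).filter (fun v => t.ints rStat v = 2), weight x n d r v ≤
          ∑ v ∈ Finset.range (n + 1), weight x n d r v :=
        Finset.sum_le_sum_of_subset (Finset.filter_subset _ _)
      split_ifs at ht1
      omega
    · rcases ht3 with ⟨h1 | h1, h2⟩ | h1
      · exact absurd h1 ht4
      · obtain ⟨σ, h3, h4⟩ := h2
        exact Or.inl ⟨h1.1, σ, h3, h1.2, h4⟩
      · exact Or.inr h1

/-! ### The path -/

/-- Writes the path to `z` in the tree to the output. -/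
def pathProgram : Program :=
  .branch (.intEq (.var rDone) (.lit 1))
    (.assign rNode (.var rZ) ;; .setInt 1 (.lit 0) (.add (.get rDep (.var rZ)) (.lit 1)) ;;
      .forLoop rI (.lit 0) (.add (.get rDep (.var rZ)) (.lit 1))
        (.setInt 1 (.add (.get rDep (.var rNode)) (.lit 1)) (.var rNode) ;;
          .assign rNode (.get rPar (.var rNode))))
    .skip

/-- The path is traced from `z` back to the root, but a node of depth `k` is written to entry `k +
1`, so the output comes out in forward order. -/
theorem pathProgram_spec {s : Config} {S n z : ℕ} {edges : Finset (ℕ × ℕ)} {stat : ℕ → ℕ}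
    (hS : s.space ≤ S) (hS0 : 2 * n + 2 ≤ S) (hd : s.ints rDone 0 = 1) (hz : s.ints rZ 0 = z)
    (hzn : z ≤ n) (hzs : stat z ≠ 0)
    (h : TreeInv n stat (s.ints rPar) (s.ints rDep) edges) :
    WP col inG pathProgram s fun t =>
      t.time ≤ s.time + ((n + 1) * 60 + 60) ∧ t.space ≤ S ∧
      ∃ path, t.output = some path ∧ FMT.IsTreePath edges z path := by
  set dep := s.ints rDep with hdep
  set par := s.ints rPar with hpar
  -- Depths are smaller than the number of visited nodes; this bounds both the length of the loop
  -- and the indices written.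
  have hdz : dep z ≤ n := by
    have h1 := h.dep_lt z hzn hzs
    have h2 := Finset.card_filter_le (Finset.range (n + 1)) fun u => stat u ≠ 0
    rw [Finset.card_range] at h2
    omega
  rw [pathProgram, WP.branch_iff]
  refine ⟨fun _ => ?_, fun hb => absurd (by simpa using hd) hb⟩
  rw [WP.seq_iff, WP.assign_iff, WP.seq_iff, WP.setInt_iff]
  -- Before pass `i` the variable `Node` holds the ancestor of `z` at depth `dep z - i`. Nothing is
  -- claimed about it after the last pass, which reads the meaningless parent of the root.
  refine (WP.forLoop (S := S) (lo := 0) (hi := dep z + 1) (fun _ => 40)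
    (fun i A _ _ => A 1 0 = dep z + 1 ∧
      (i ≤ dep z → A rNode 0 ≤ n ∧ stat (A rNode 0) ≠ 0 ∧ dep (A rNode 0) + i = dep z ∧
        (0 < i → (A rNode 0, A 1 (dep (A rNode 0) + 2)) ∈ edges)) ∧
      (i = 0 → A rNode 0 = z) ∧ (0 < i → A 1 (dep z + 1) = z) ∧
      (i = dep z + 1 → A 1 1 = 0) ∧
      ∀ j, dep z < j + i → j < dep z → (A 1 (j + 1), A 1 (j + 2)) ∈ edges)
    ?_ (by omega) (by decide) rfl (by omega) ?_ ?_ ?_ ?_).conseq ?_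
  · simp; omega
  · intro u hu
    simp [hu.ints rDep (by decide), hu.ints rZ (by decide), hz, hdep]
  · intro k A R C v h; simpa using h
  · simp [hz, hzn, hzs, hdep]
    omega
  · rintro i u _ hi hu hus hui ⟨h1, h2, h3, h4, h5, h6⟩
    obtain ⟨h7, h8, h9, h10⟩ := h2 (by omega)
    have e1 : u.ints rDep = dep := by rw [hu.ints _ (by decide)]; simp [hdep]
    have e2 : u.ints rPar = par := by rw [hu.ints _ (by decide)]; simp [hpar]
    set v := u.ints rNode 0 with hv
    simp [e1, e2, ← hv]
    refine ⟨by omega, h1, fun hi' => ?_, ?_, ?_,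
      fun j hj hj' => ?_⟩
    · have hv0 : v ≠ 0 := by
        intro hv0
        rw [hv0, h.dep_root] at h9
        omega
      obtain ⟨k1, k2, k3, k4⟩ := h.parent v h7 h8 hv0
      refine ⟨k1, k2, by omega, ?_⟩
      rw [Function.update_apply, if_pos (by omega)]
      exact k3
    · by_cases hi0 : i = 0
      · rw [show dep v = dep z by omega, Function.update_self]
        exact h3 hi0
      · rw [Function.update_of_ne (by omega)]
        exact h4 (by omega)
    · intro hi'
      rw [show dep v = 0 by omega, Function.update_self]
      by_contra hv0
      have := (h.parent v h7 h8 hv0).2.2.2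
      omega
    · by_cases hjv : j = dep v
      · subst hjv
        rw [Function.update_self, Function.update_of_ne (by omega)]
        exact h10 (by omega)
      · rw [Function.update_of_ne (by omega), Function.update_of_ne (by omega)]
        exact h6 j (by omega) hj'
  · rintro t hft ⟨ht1, ht2, h1, -, -, h4, h5, h6⟩
    simp at ht1
    refine ⟨by nlinarith, ht2, _, by rw [Config.output, if_neg (by omega)], ?_, ?_, ?_⟩
    · rw [h1, List.range_succ_eq_map]
      simp [h5]
    · rw [h1, List.range_succ]
      simp [h4]
    · rw [h1, List.isChain_map, List.isChain_range_succ]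
      intro j hj
      exact h6 j (by omega) hj

end RAM

namespace RAM

variable {col : ℕ → ℕ → Prop} {inG : ℕ → Prop}

/-! ### The complete program -/

/-- FMT*, given the lists of near nodes. -/
def mainProgram : Program :=
  .setInt rStat (.lit 0) (.lit 1) ;; .assign rZ (.lit 0) ;; .assign rDone (.lit 0) ;;
  .assign rArg (.lit 1) ;; .assign rP (.add (.get 0 (.lit 0)) (.lit 1)) ;; updateProgram ;;
  mainLoop ;; pathProgram

theorem mainProgram_spec {s : Config} {S d n : ℕ} {Q : PlanningProblem d}
    {p : ℕ → EuclideanSpace ℝ (Fin d)} {r : ℝ} {x : ℕ → ℝ}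
    (hx : IsCoord n p x) (hS : s.space ≤ S) (hS0 : 2 * n + 2 ≤ S) (hn : s.ints 0 0 = n)
    (hnear : NearLists x n d r (s.ints rStart) (s.ints rNbr) (s.reals qDist))
    (hout : ∀ i, s.ints 1 i = 0) (hstat : ∀ i, s.ints rStat i = 0) (htree : ∀ i, s.ints rTree i = 0)
    (hdep : ∀ i, s.ints rDep i = 0) (hcost : ∀ i, s.reals qCost i = 0) (hcalls : s.calls = []) :
    WP (fun u v => Q.CollisionFree (p u) (p v)) (fun u => p u ∈ Q.goal) mainProgram s fun t =>
      t.time ≤ s.time + 1000 * (∑ v ∈ Finset.range (n + 1), weight x n d r v +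
        callWeight x n d r t.calls) ∧ t.space ≤ S ∧
      FMT.WhileLoop Q n p r (FMT.start n) t.output t.calls := by
  have hwn : ∑ v ∈ Finset.range (n + 1), (lg n + 1) ≤
      ∑ v ∈ Finset.range (n + 1), weight x n d r v :=
    Finset.sum_le_sum fun v _ => by unfold weight; omega
  rw [Finset.sum_const, Finset.card_range, smul_eq_mul] at hwn
  have hlg : lg n + n + 1 ≤ (n + 1) * (lg n + 1) := by nlinarith [Nat.zero_le (n * lg n)]
  rw [mainProgram]
  simp only [WP.seq_iff, WP.setInt_iff, WP.assign_iff]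
  -- Memory full of zeros is a tournament without participants; node `0` is inserted into it like
  -- any other node.
  refine (updateProgram_spec (S := S) (n := n) (v := 0) (a := 1) (p := fun _ => False)
      (p' := fun v => v = 0) (Nat.zero_le _) ⟨?_, ?_, ?_⟩ ?_ ?_ ?_ ?_ ?_ ?_ hS0).conseq ?_
  · simp
  · simp [htree]
  · simp [htree, winner]
  · simp [hn]
  · simp
  · simp
  · simp
  · simp
  · simp; omega
  rintro t hft ⟨ht1, ht2, ht3⟩
  have e1 : t.ints rStat = Function.update (s.ints rStat) 0 1 := by
    rw [hft.ints _ (by decide)]; simp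
  have e2 : t.reals qCost = fun _ => 0 := by
    rw [hft.reals _ (by decide)]; funext i; simp [hcost]
  have e3 : t.ints rZ 0 = 0 := by rw [hft.ints _ (by decide)]; simp
  have e4 : t.ints rDep 0 = 0 := by rw [hft.ints _ (by decide)]; simp [hdep]
  have e5 : t.calls = [] := by rw [hft.calls (by decide)]; simp [hcalls]
  have e6 : t.ints 1 = s.ints 1 := by rw [hft.ints _ (by decide)]; simp
  have hst : ∀ v, t.ints rStat v = if v = 0 then 1 else 0 := by
    intro v
    rw [e1, Function.update_apply, hstat]
  have hrep : Rep n (FMT.start n) (t.ints rStat) (t.ints rPar) (t.ints rDep) (t.ints rTree)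
      (t.ints rZ 0) (t.reals qCost) t.calls := by
    refine ⟨e3.symm, by omega, by rw [e3, hst, if_pos rfl], fun v _ => ?_, ?_, ?_, e2.symm, e5.symm,
      ⟨by simp [hst], e4, fun v _ h1 h2 => ?_, fun v hv hv0 => ?_⟩, ?_⟩
    · rw [hst]; split_ifs <;> omega
    · ext v
      simp only [FMT.start, Finset.mem_erase, Finset.mem_filter, hst]
      by_cases hv : v = 0 <;> simp [hv]
    · ext v
      simp only [FMT.start, Finset.mem_singleton, Finset.mem_filter, hst]
      by_cases hv : v = 0 <;> simp [hv]
    · exact absurd (by rw [hst, if_neg h2]) h1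
    · obtain rfl : v = 0 := by
        by_contra h
        exact hv0 (by rw [hst, if_neg h])
      rw [e4]
      exact Finset.card_pos.2 ⟨0, by simp [hst]⟩
    · have : (fun v => t.ints rStat v = 1) = fun v => v = 0 := by
        funext v
        rw [hst]
        by_cases hv : v = 0 <;> simp [hv]
      rw [this, e2]
      have h' : s.reals qCost = fun _ => 0 := funext hcost
      simpa [h'] using ht3
  refine (mainLoop_spec (S := S) (n := n) (r := r) (Q := Q) hx ht2 hS0 ?_ ?_ ?_ hrep).conseq ?_
  · rw [hft.ints _ (by decide)]; simp [hn]
  · rw [hft.ints _ (by decide)]; simp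
  · rw [hft.ints _ (by decide), hft.ints _ (by decide), hft.reals _ (by decide)]
    simpa using hnear
  rintro u hfu ⟨hu1, hu2, hu3⟩
  -- An output array that has never been written encodes failure, so in that case nothing remains to
  -- be done.
  have f1 : u.ints 1 0 = 0 := by rw [hfu.ints _ (by decide), e6, hout]
  simp at ht1
  rcases hu3 with ⟨hd, σ, hσ, hg, hrep'⟩ | ⟨hd, hfail⟩
  · refine (pathProgram_spec (S := S) (n := n) (z := u.ints rZ 0) (edges := σ.edges)
      (stat := u.ints rStat) hu2 hS0 hd rfl hrep'.z_le (by rw [hrep'.z_open]; omega)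
      hrep'.tree_inv).conseq ?_
    rintro v hfv ⟨hv1, hv2, path, hv3, hv4⟩
    have g1 : v.calls = u.calls := hfv.calls (by decide)
    refine ⟨by rw [g1]; omega, hv2, ?_⟩
    rw [hv3, g1, ← hrep'.calls_eq]
    exact hσ _ _ (.success σ path (by rwa [hrep'.z_eq]) (by rwa [hrep'.z_eq]))
  · rw [pathProgram, WP.branch_iff]
    refine ⟨fun hb => absurd hb (by simp [hd]), fun _ => ?_⟩
    rw [WP.skip_iff]
    simp only [Config.tick_time, Config.tick_calls, Config.tick_space, Test.size_intEq,
      IntExp.size_var, IntExp.size_lit]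
    refine ⟨by omega, hu2, ?_⟩
    rw [Config.output, if_pos (by simpa using f1)]
    exact hfail

/-- An implementation of FMT*. -/
def fmtProgram : Program :=
  gridProgram ;; offsetProgram ;; cellProgram ;; nearProgram ;; mainProgram

/-- The bound for the space that the program needs. -/
noncomputable def spaceBound (x : ℕ → ℝ) (n d : ℕ) (r : ℝ) (L : ℕ) : ℕ :=
  2 * n + 2 + (n + 1) * d + 3 ^ d + ∑ v ∈ Finset.range (n + 1), nearCard x n d r v +
    (4 * 2 ^ L) ^ d

open Classical in
/-- The number of nodes within distance `ρ` of node `v` (including itself). -/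
noncomputable def closeCard {d : ℕ} (n : ℕ) (p : ℕ → EuclideanSpace ℝ (Fin d)) (ρ : ℝ) (v : ℕ) : ℕ :=
  ((Finset.range (n + 1)).filter fun u => dist (p u) (p v) ≤ ρ).card

theorem flatDist_eq {d n : ℕ} {p : ℕ → EuclideanSpace ℝ (Fin d)} {x : ℕ → ℝ}
    (hx : ∀ v ≤ n, ∀ i : Fin d, x (v * d + i) = p v i) : IsCoord n p x := by
  intro u hu v hv
  rw [flatDist, EuclideanSpace.dist_eq, Finset.sum_range]
  congr 1
  refine Finset.sum_congr rfl fun i _ => ?_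
  rw [hx u hu, hx v hv, Real.dist_eq, sq_abs, sq]

/-- The factor `d` instead of `√d` is wasteful but keeps square roots out of the constants. -/
theorem dist_le_of_coord {d : ℕ} {u v : EuclideanSpace ℝ (Fin d)} {ρ : ℝ} (hρ : 0 ≤ ρ)
    (h : ∀ i, |u i - v i| ≤ ρ) : dist u v ≤ d * ρ := by
  rw [EuclideanSpace.dist_eq]
  refine Real.sqrt_le_iff.2 ⟨by positivity, ?_⟩
  calc ∑ i, dist (u i) (v i) ^ 2 ≤ ∑ _i : Fin d, ρ ^ 2 :=
        Finset.sum_le_sum fun i _ => by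
          rw [Real.dist_eq]; exact pow_le_pow_left₀ (abs_nonneg _) (h i) 2
    _ = d * ρ ^ 2 := by simp
    _ ≤ (d * ρ) ^ 2 := by
        rw [mul_pow]
        refine mul_le_mul_of_nonneg_right ?_ (sq_nonneg _)
        rcases Nat.eq_zero_or_pos d with rfl | hd
        · simp
        · have : (1 : ℝ) ≤ d := by exact_mod_cast hd
          nlinarith

theorem nearCard_eq {d n v : ℕ} {p : ℕ → EuclideanSpace ℝ (Fin d)} {x : ℕ → ℝ} {r : ℝ}
    (hx : IsCoord n p x) (hv : v ≤ n) : nearCard x n d r v = (FMT.near n p r v).card := by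
  classical
  rw [nearCard]
  congr 1
  ext u
  rw [hx.mem_near hv, Finset.mem_filter, Finset.mem_range]
  exact ⟨fun h => h.2, fun h => ⟨Nat.lt_succ_of_le h.1, h⟩⟩

/-- Every node counted lies within two cell widths in each coordinate; the factor `3 ^ d` is the
number of cells searched. -/
theorem candCard_le {d n L v o : ℕ} {p : ℕ → EuclideanSpace ℝ (Fin d)} {x : ℕ → ℝ}
    {base key head next off : ℕ → ℕ} (hx : ∀ v ≤ n, ∀ i : Fin d, x (v * d + i) = p v i)
    (hc : CellLists x d L o (n + 1) base key head next) (ho : OffsetTable (4 * 2 ^ L) d off)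
    (ho' : off 0 = o) (hv : v ≤ n) :
    candCard n d o key off v ≤ 3 ^ d * closeCard n p (d * (2 / 2 ^ L)) v := by
  classical
  rw [candCard]
  calc _ ≤ ∑ _k ∈ Finset.range (3 ^ d), closeCard n p (d * (2 / 2 ^ L)) v := by
        refine Finset.sum_le_sum fun k hk => Finset.card_le_card fun u hu => ?_
        rw [Finset.mem_filter, Finset.mem_range] at hu ⊢
        refine ⟨hu.1, dist_le_of_coord (by positivity) fun i => ?_⟩
        have h1 := abs_sub_le_of_offset (u := u) (v := v) ho (hc.isKey u hu.1)
          (hc.isKey v (by omega)) (Finset.mem_range.1 hk) (ho' ▸ hu.2) i i.2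
        rw [hx u (by omega), hx v hv] at h1
        rwa [le_div_iff₀ (by positivity)]
    _ = _ := by simp

theorem input_coord {d : ℕ} (n : ℕ) (p : ℕ → EuclideanSpace ℝ (Fin d)) (r : ℝ) :
    ∀ v ≤ n, ∀ i : Fin d, (input n p r).reals qCoord (v * d + i) = p v i := by
  intro v hv i
  have h1 : (v * d + i) % d = i := by
    rw [Nat.add_comm, Nat.add_mul_mod_self_right, Nat.mod_eq_of_lt i.2]
  have h2 : (v * d + i) / d = v := by
    rw [Nat.add_comm, Nat.add_mul_div_right _ _ (by have := i.2; omega), Nat.div_eq_of_lt i.2,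
      zero_add]
  simp only [input, if_true]
  rw [dif_pos (by rw [h1, h2]; exact ⟨i.2, hv⟩)]
  have key : ∀ a b (hb : b < d), a = v → b = i → p a ⟨b, hb⟩ = p v i := by
    rintro _ _ _ rfl rfl; rfl
  exact key _ _ _ h2 h1

/-- Here `P` stands for `3 ^ d`, `N` for `n + 1`, `l` for `lg n`, `A` for the sum of the weights,
`B` for the sum of `closeCard` and `W` for the weight of the calls. Since `N * (l + 1) ≤ A`, all
preprocessing terms are absorbed; the products involved are supplied explicitly. -/
theorem time_arith {P d N l L A B W cand t1 t2 t3 t4 t5 : ℕ} (hP : 0 < P) (hd : 0 < d) (hL : L ≤ l)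
    (hN : 0 < N) (hA : N * (l + 1) ≤ A) (hcand : cand ≤ P * B) (h1 : t1 ≤ 0 + 100 * (l + 1))
    (h2 : t2 ≤ t1 + d * (P * (30 * (L + 3) + 100) + 60) + 30)
    (h3 : t3 ≤ t2 + (N * (d * (60 * L + 150) + 130) + 30))
    (h4 : t4 ≤ t3 + (cand * (60 * d + 160) + N * (P * 60 + 100) + 60))
    (h5 : t5 ≤ t4 + 1000 * (A + W)) : t5 ≤ (P * 1000 * (d + 1)) * (A + B + W) := by
  have a1 : N * (L + 1) ≤ A := (Nat.mul_le_mul_left N (by omega)).trans hA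
  have a2 : l + 1 ≤ A := (Nat.le_mul_of_pos_left _ hN).trans hA
  have a3 : N ≤ A := (Nat.le_mul_of_pos_right _ (Nat.succ_pos _)).trans hA
  have b0 : A ≤ P * A := Nat.le_mul_of_pos_left _ hP
  have b1 : d * (P * (L + 1)) ≤ d * (P * A) :=
    Nat.mul_le_mul_left d (Nat.mul_le_mul_left P (by omega))
  have b2 : d * (P * 1) ≤ d * (P * A) := Nat.mul_le_mul_left d (Nat.mul_le_mul_left P (by omega))
  have b3 : d * A ≤ d * (P * A) := Nat.mul_le_mul_left d b0
  have b4 : d * (N * (L + 1)) ≤ d * A := Nat.mul_le_mul_left d a1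
  have b5 : d * N ≤ d * A := Nat.mul_le_mul_left d a3
  have b6 : P * N ≤ P * A := Nat.mul_le_mul_left P a3
  have b7 : cand * (d + 1) ≤ P * B * (d + 1) := Nat.mul_le_mul_right _ hcand
  have b8 : W ≤ P * (d + 1) * W := Nat.le_mul_of_pos_left _ (by positivity)
  have b9 : P * A ≤ d * (P * A) := Nat.le_mul_of_pos_left _ hd
  have b10 : d * 1 ≤ d * A := Nat.mul_le_mul_left d (by omega)
  have b11 : cand ≤ cand * (d + 1) := Nat.le_mul_of_pos_right _ (Nat.succ_pos _)
  nlinarith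

/-- The level `L` is exposed because the size of the grid and the radius of the search depend on it;
both are estimated later by means of `GridLevel`. -/
theorem fmtProgram_spec {d n : ℕ} {Q : PlanningProblem d} {p : ℕ → EuclideanSpace ℝ (Fin d)} {r : ℝ}
    (hp : ∀ v ≤ n, ∀ i, 0 ≤ p v i ∧ p v i ≤ 1) (hd : 0 < d) :
    ∃ L, GridLevel n r L ∧
    WP (fun u v => Q.CollisionFree (p u) (p v)) (fun u => p u ∈ Q.goal) fmtProgram (input n p r)
      fun t => t.time ≤ (3 ^ d * 1000 * (d + 1)) *
        (∑ v ∈ Finset.range (n + 1), (weight ((input n p r).reals qCoord) n d r v +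
          closeCard n p (d * (2 / 2 ^ L)) v) +
          callWeight ((input n p r).reals qCoord) n d r t.calls) ∧
        t.space ≤ spaceBound ((input n p r).reals qCoord) n d r L ∧
        FMT.WhileLoop Q n p r (FMT.start n) t.output t.calls := by
  set s := input n p r with hs
  set x := s.reals qCoord with hxdef
  have hx := input_coord n p r
  rw [← hs, ← hxdef] at hx
  have hs0 : s.ints 0 0 = n := by simp [hs, input]
  have hs1 : s.ints 0 1 = d := by simp [hs, input]
  have hs2 : ∀ a i, a ≠ 0 → s.ints a i = 0 := by
    intro a i ha
    simp [hs, input, ha]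
  have hs3 : s.reals qRad 0 = r := by simp [hs, input]
  have hs4 : ∀ i, s.reals qCost i = 0 := by simp [hs, input]
  have hspace : s.space ≤ 2 * n + 2 + (n + 1) * d := by
    simp [hs, input]; omega
  have htime : s.time = 0 := rfl
  -- The space bound involves `L`, which exists only after this phase. So the phase is given the
  -- part of the bound that does not mention `L`.
  obtain ⟨t1, ht1, h1a, h1b, hL⟩ := gridProgram_spec (col := fun u v => Q.CollisionFree (p u) (p v))
    (inG := fun u => p u ∈ Q.goal) (s := s) (S := 2 * n + 2 + (n + 1) * d) (n := n) (r := r) hs0 hs3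
    hspace (by omega)
  have f1 := ht1.frame
  have hpow : 0 < 3 ^ d := by positivity
  set L := t1.ints rLev 0 with hLdef
  refine ⟨L, hL, ?_⟩
  set S := spaceBound x n d r L with hSdef
  have hSle : 2 * n + 2 + (n + 1) * d + 3 ^ d + ∑ v ∈ Finset.range (n + 1), nearCard x n d r v +
    (4 * 2 ^ L) ^ d = S := rfl
  obtain ⟨t2, ht2, h2a, h2b, hcnt, hoff⟩ := offsetProgram_spec
    (col := fun u v => Q.CollisionFree (p u) (p v))
    (inG := fun u => p u ∈ Q.goal) (s := t1) (S := S) (L := L) (d := d) rfl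
    (by rw [f1.ints _ (by decide), hs1]) (by omega) (by omega)
  have f2 := ht2.frame
  obtain ⟨t3, ht3, h3a, h3b, hcell⟩ := cellProgram_spec
    (col := fun u v => Q.CollisionFree (p u) (p v))
    (inG := fun u => p u ∈ Q.goal) (s := t2) (S := S) (L := L) (d := d) (n := n)
    (o := t2.ints rOff 0) (x := x)
    (by rw [f2.ints _ (by decide)])
    (by rw [f2.ints _ (by decide), f1.ints _ (by decide), hs0])
    (by rw [f2.ints _ (by decide), f1.ints _ (by decide), hs1])
    (by rw [f2.reals _ (by decide), f1.reals _ (by decide)])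
    (fun v hv i hi => by rw [hx v hv ⟨i, hi⟩]; exact hp v hv _) rfl hoff.first
    (fun c => by rw [f2.ints _ (by decide), f1.ints _ (by decide), hs2 _ _ (by decide)])
    h2b (by omega) (by omega)
  have f3 := ht3.frame
  have e3 : t3.ints rOff = t2.ints rOff := f3.ints _ (by decide)
  obtain ⟨t4, ht4, h4a, h4b, hnear⟩ := nearProgram_spec
    (col := fun u v => Q.CollisionFree (p u) (p v))
    (inG := fun u => p u ∈ Q.goal) (s := t3) (S := S) (L := L) (d := d) (n := n) (r := r) (x := x)
    (by rw [f3.ints _ (by decide), f2.ints _ (by decide), f1.ints _ (by decide), hs0])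
    (by rw [f3.ints _ (by decide), f2.ints _ (by decide), f1.ints _ (by decide), hs1])
    (by rw [f3.reals _ (by decide), f2.reals _ (by decide), f1.reals _ (by decide)])
    (by rw [f3.reals _ (by decide), f2.reals _ (by decide), f1.reals _ (by decide), hs3])
    (by rw [f3.ints _ (by decide), hcnt]) hL (by rw [e3]; exact hoff) (by rw [e3]; exact hcell)
    (fun c => by rw [f3.ints _ (by decide), f2.ints _ (by decide), f1.ints _ (by decide),
      hs2 _ _ (by decide)])
    h3b (by omega) (by omega)
  have f4 := ht4.frame
  obtain ⟨t5, ht5, h5a, h5b, hrun⟩ := mainProgram_spec (s := t4) (S := S) (n := n) (r := r) (x := x)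
    (p := p) (Q := Q) (flatDist_eq hx) h4b (by omega)
    (by rw [f4.ints _ (by decide), f3.ints _ (by decide), f2.ints _ (by decide),
      f1.ints _ (by decide), hs0]) hnear
    (fun c => by rw [f4.ints _ (by decide), f3.ints _ (by decide), f2.ints _ (by decide),
      f1.ints _ (by decide), hs2 _ _ (by decide)])
    (fun c => by rw [f4.ints _ (by decide), f3.ints _ (by decide), f2.ints _ (by decide),
      f1.ints _ (by decide), hs2 _ _ (by decide)])
    (fun c => by rw [f4.ints _ (by decide), f3.ints _ (by decide), f2.ints _ (by decide),
      f1.ints _ (by decide), hs2 _ _ (by decide)])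
    (fun c => by rw [f4.ints _ (by decide), f3.ints _ (by decide), f2.ints _ (by decide),
      f1.ints _ (by decide), hs2 _ _ (by decide)])
    (fun c => by rw [f4.reals _ (by decide), f3.reals _ (by decide), f2.reals _ (by decide),
      f1.reals _ (by decide), hs4])
    (by rw [f4.calls (by decide), f3.calls (by decide), f2.calls (by decide),
      f1.calls (by decide)]; rfl)
  refine ⟨t5, .seq _ _ _ _ _ ht1 (.seq _ _ _ _ _ ht2 (.seq _ _ _ _ _ ht3
    (.seq _ _ _ _ _ ht4 ht5))), ?_, h5b, hrun⟩
  have hcand : ∑ v ∈ Finset.range (n + 1),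
      candCard n d (t3.ints rOff 0) (t3.ints rKey) (t3.ints rOff) v ≤
      3 ^ d * ∑ v ∈ Finset.range (n + 1), closeCard n p (d * (2 / 2 ^ L)) v := by
    rw [Finset.mul_sum]
    refine Finset.sum_le_sum fun v hv => ?_
    rw [e3]
    exact candCard_le hx hcell hoff rfl (Nat.le_of_lt_succ (Finset.mem_range.1 hv))
  have hwn : ∑ v ∈ Finset.range (n + 1), (lg n + 1) ≤
      ∑ v ∈ Finset.range (n + 1), weight x n d r v :=
    Finset.sum_le_sum fun v _ => by unfold weight; omega
  rw [Finset.sum_const, Finset.card_range, smul_eq_mul] at hwn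
  have hLlg := hL.le_lg
  rw [Finset.sum_add_distrib]
  rw [htime] at h1a
  exact time_arith hpow hd hLlg (Nat.succ_pos n) hwn hcand h1a h2a h3a h4a h5a

end RAM

/-! ## The number of calls of a run -/

namespace FMT

variable {d n : ℕ} {Q : PlanningProblem d} {p : ℕ → EuclideanSpace ℝ (Fin d)} {r : ℝ}

theorem mem_near {u v : ℕ} : u ∈ near n p r v ↔ u ≤ n ∧ u ≠ v ∧ dist (p u) (p v) < r := by
  rw [near, Finset.mem_filter, Finset.mem_range, Nat.lt_succ_iff]

/-- Connections of a node far from the obstacles are free of collisions. -/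
theorem collisionFree_of_far {u v : EuclideanSpace ℝ (Fin d)} (h : dist u v < r)
    (hv : v ∉ Metric.thickening r Q.obs) : Q.CollisionFree u v := by
  refine Set.disjoint_left.2 fun w hw hw' => hv ?_
  have hr : 0 < r := dist_nonneg.trans_lt h
  have := (convex_ball v r).segment_subset (Metric.mem_ball.2 h) (Metric.mem_ball_self hr) hw
  exact Metric.mem_thickening_iff.2 ⟨w, hw', by rw [dist_comm]; exact this⟩

/-- How often `v` has been considered. -/
def State.count (s : State) (v : ℕ) : ℕ := (s.calls.map Prod.snd).count v

variable (Q n p r) in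
open Classical in
/-- A bound for the number of considerations of `v` from now on. -/
noncomputable def State.budget (s : State) (v : ℕ) : ℕ :=
  if v ∈ s.unvisited then
    if p v ∈ Metric.thickening r Q.obs then (near n p r v \ s.closed).card else 1
  else 0

theorem Consider.effect {x : ℕ} {s t : State} (h : Consider Q n p r x s t) :
    t.closed = s.closed ∧ t.opened = s.opened ∧ t.unvisited ⊆ s.unvisited ∧
    t.openNew ⊆ insert x s.openNew ∧
    ((∀ v ∈ s.openNew, v ∉ s.unvisited) → ∀ v ∈ t.openNew, v ∉ t.unvisited) ∧
    (∀ v, t.count v = s.count v + if v = x then 1 else 0) ∧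
    (p x ∉ Metric.thickening r Q.obs → x ∉ t.unvisited) := by
  have hcount : ∀ (l : List (ℕ × ℕ)) (y v : ℕ), ((l ++ [(y, x)]).map Prod.snd).count v =
      (l.map Prod.snd).count v + if v = x then 1 else 0 := by
    intro l y v
    rw [List.map_append, List.count_append]
    congr 1
    rw [List.map_singleton]
    by_cases hv : v = x
    · subst hv
      simp
    · rw [if_neg hv]
      exact List.count_eq_zero.2 (by simpa using hv)
  cases h with
  | connect y hy hfree =>
    refine ⟨rfl, rfl, Finset.erase_subset _ _, subset_rfl, fun h v hv => ?_, hcount _ _, fun _ => ?_⟩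
    · simp only [Finset.mem_insert, Finset.mem_erase] at hv ⊢
      rintro ⟨h1, h2⟩
      rcases hv with hv | hv
      · exact h1 hv
      · exact h v hv h2
    · simp
  | reject y hy hcoll =>
    refine ⟨rfl, rfl, subset_rfl, Finset.subset_insert _ _, fun h => h, hcount _ _, fun hx => ?_⟩
    exact absurd (collisionFree_of_far (mem_near.1 (Finset.mem_inter.1 hy.1).1).2.2 hx) hcoll

theorem ForLoop.effect {l : List ℕ} {s t : State} (h : ForLoop Q n p r l s t) (hl : l.Nodup) :
    t.closed = s.closed ∧ t.opened = s.opened ∧ t.unvisited ⊆ s.unvisited ∧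
    t.openNew ⊆ s.openNew ∪ l.toFinset ∧
    ((∀ v ∈ s.openNew, v ∉ s.unvisited) → ∀ v ∈ t.openNew, v ∉ t.unvisited) ∧
    (∀ v, t.count v = s.count v + if v ∈ l then 1 else 0) ∧
    (∀ v ∈ l, p v ∉ Metric.thickening r Q.obs → v ∉ t.unvisited) := by
  induction h with
  | nil s => simp
  | cons x l s t u hx _ ih =>
    rw [List.nodup_cons] at hl
    obtain ⟨a1, a2, a3, a4, a5, a6, a7⟩ := hx.effect
    obtain ⟨b1, b2, b3, b4, b5, b6, b7⟩ := ih hl.2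
    refine ⟨b1.trans a1, b2.trans a2, b3.trans a3, fun v hv => ?_, fun h => b5 (a5 h), fun v => ?_,
      fun v hv hv' => ?_⟩
    · have := b4 hv
      simp only [Finset.mem_union, List.mem_toFinset, List.mem_cons] at this ⊢
      rcases this with h | h
      · have := a4 h
        rw [Finset.mem_insert] at this
        tauto
      · tauto
    · rw [b6, a6]
      by_cases hvx : v = x
      · subst hvx; simp [hl.1]
      · simp [hvx]
    · rcases List.mem_cons.1 hv with rfl | hv
      · exact fun h => a7 hv' (b3 h)
      · exact b7 v hv hv'

variable (Q n p r) in
/-- An invariant of the while loop: `K v` bounds the number of considerations of `v`. -/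
structure CountInv (K : ℕ → ℕ) (s : State) : Prop where
  z_open : s.z ∈ s.opened
  opened_le : ∀ v ∈ s.opened, v ≤ n
  unvisited_le : ∀ v ∈ s.unvisited, v ≤ n
  opened_closed : ∀ v ∈ s.opened, v ∉ s.closed
  unvisited_closed : ∀ v ∈ s.unvisited, v ∉ s.closed
  opened_unvisited : ∀ v ∈ s.opened, v ∉ s.unvisited
  count_le : ∀ v, s.count v + s.budget n Q p r v ≤ K v

/-- Considerations made plus remaining budget never increase. If `v` is considered, its budget drops
by at least one: either `z`, which is near `v`, becomes closed, or `v` is far from the obstacles and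
leaves `V_unvisited` at once. -/
theorem Iteration.countInv {K : ℕ → ℕ} {s t : State} (h : Iteration Q n p r s t)
    (hs : CountInv n Q p r K s) :
    (∀ v, t.count v ≤ K v) ∧ ∀ z ∈ t.opened, CountInv n Q p r K { t with z := z } := by
  classical
  obtain ⟨t, l, hl, hmem, hloop⟩ := h
  obtain ⟨a1, a2, a3, a4, a5, a6, a7⟩ := hloop.effect hl
  simp only [Finset.empty_union, Finset.notMem_empty, false_implies, implies_true,
    true_implies] at a1 a2 a3 a4 a5 a6 a7
  set t' : State := { t with
    opened := (t.opened ∪ t.openNew).erase s.z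
    closed := insert s.z t.closed } with ht'
  have hnew : ∀ v ∈ t.openNew, v ∈ s.unvisited := fun v hv =>
    (Finset.mem_inter.1 ((hmem v).1 (List.mem_toFinset.1 (a4 hv)))).2
  have key : ∀ v, t'.count v + t'.budget n Q p r v ≤ K v := by
    intro v
    refine le_trans ?_ (hs.count_le v)
    have hc : t'.count v = s.count v + if v ∈ l then 1 else 0 := a6 v
    rw [hc]
    have hsub : near n p r v \ insert s.z t.closed ⊆ near n p r v \ s.closed := by
      rw [a1]
      exact Finset.sdiff_subset_sdiff le_rfl (Finset.subset_insert _ _)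
    by_cases hvl : v ∈ l
    · obtain ⟨h1, h2⟩ := Finset.mem_inter.1 ((hmem v).1 hvl)
      rw [if_pos hvl, State.budget, State.budget, if_pos h2]
      by_cases hobs : p v ∈ Metric.thickening r Q.obs
      · rw [if_pos hobs, if_pos hobs]
        -- Nearness is symmetric, so `z` is one of the near nodes of `v`; it was open, hence not
        -- closed, before the iteration and is closed after it.
        have hlt : (near n p r v \ insert s.z t.closed).card < (near n p r v \ s.closed).card := by
          refine Finset.card_lt_card (Finset.ssubset_iff_of_subset hsub |>.2 ⟨s.z, ?_, ?_⟩)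
          · rw [Finset.mem_sdiff, mem_near]
            have := mem_near.1 h1
            exact ⟨⟨hs.opened_le _ hs.z_open, this.2.1.symm, by rw [dist_comm]; exact this.2.2⟩,
              hs.opened_closed _ hs.z_open⟩
          · simp
        have : (t'.closed) = insert s.z t.closed := rfl
        rw [this]
        split_ifs <;> omega
      -- Far from the obstacles the budget falls from `1` to `0`, because the connection cannot be
      -- rejected.
      · rw [if_neg (a7 v hvl hobs : v ∉ t'.unvisited), if_neg hobs]
    · rw [if_neg hvl, add_zero]
      refine Nat.add_le_add_left ?_ _
      rw [State.budget, State.budget]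
      by_cases hu : v ∈ t'.unvisited
      · rw [if_pos hu, if_pos (a3 hu)]
        split_ifs
        · exact Finset.card_le_card hsub
        · exact le_rfl
      · rw [if_neg hu]
        exact Nat.zero_le _
  refine ⟨fun v => (Nat.le_add_right _ _).trans (key v), fun z hz => ?_⟩
  have hopen : ∀ v ∈ t'.opened, v ≠ s.z ∧ (v ∈ s.opened ∨ v ∈ t.openNew) := by
    intro v hv
    have := Finset.mem_erase.1 hv
    rw [Finset.mem_union, a2] at this
    exact this
  refine ⟨hz, fun v hv => ?_, fun v hv => hs.unvisited_le v (a3 hv), fun v hv => ?_, fun v hv => ?_,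
    fun v hv => ?_, key⟩
  · rcases (hopen v hv).2 with h | h
    · exact hs.opened_le v h
    · exact hs.unvisited_le v (hnew v h)
  · have : t'.closed = insert s.z s.closed := by rw [← a1]
    rw [show ({ t' with z := z } : State).closed = insert s.z s.closed from this, Finset.mem_insert]
    rintro (h | h)
    · exact (hopen v hv).1 h
    · rcases (hopen v hv).2 with h' | h'
      · exact hs.opened_closed v h' h
      · exact hs.unvisited_closed v (hnew v h') h
  · have : t'.closed = insert s.z s.closed := by rw [← a1]
    rw [show ({ t' with z := z } : State).closed = insert s.z s.closed from this, Finset.mem_insert]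
    rintro (h | h)
    · exact hs.opened_unvisited _ hs.z_open (h ▸ a3 hv)
    · exact hs.unvisited_closed v (a3 hv) h
  · rcases (hopen v hv).2 with h | h
    · exact fun h' => hs.opened_unvisited v h (a3 h')
    · exact a5 v h

theorem WhileLoop.count_le {K : ℕ → ℕ} {s : State} {result : Option (List ℕ)}
    {calls : List (ℕ × ℕ)} (h : WhileLoop Q n p r s result calls) (hs : CountInv n Q p r K s)
    (v : ℕ) : (calls.map Prod.snd).count v ≤ K v := by
  revert hs
  induction h with
  | success s path hgoal hpath => exact fun hs => (Nat.le_add_right _ _).trans (hs.count_le v)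
  | failure s t hgoal hit hempty => exact fun hs => (hit.countInv hs).1 v
  | step s t z result calls hgoal hit hz hmin hrest ih => exact fun hs => ih ((hit.countInv hs).2 z hz)

open Classical in
/-- The sum of `f` over the nodes considered in a run. -/
theorem WhileLoop.sum_le {result : Option (List ℕ)} {calls : List (ℕ × ℕ)}
    (h : WhileLoop Q n p r (start n) result calls) (f : ℕ → ℕ) :
    (calls.map fun c => f c.2).sum ≤ ∑ v ∈ Finset.Ico 1 (n + 1),
      (if p v ∈ Metric.thickening r Q.obs then (near n p r v).card else 1) * f v := by
  -- At the start no calls have been made and no node is closed, so the initial budget itself serves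
  -- as the bound `K`.
  have hinv : CountInv n Q p r ((start n).budget n Q p r) (start n) := by
    refine ⟨by simp [start], by simp [start], fun v hv => ?_, by simp [start], by simp [start],
      by simp [start], fun v => by simp [State.count, start]⟩
    simp [start] at hv
    exact hv.2
  have hcount := h.count_le hinv
  have hmap : (calls.map fun c => f c.2) = (calls.map Prod.snd).map f := by simp
  rw [hmap, Finset.sum_list_map_count]
  -- Node `0` is visited from the start and has budget `0`; the same holds for numbers above `n`.
  -- Neither is ever considered.
  have hsub : (calls.map Prod.snd).toFinset ⊆ Finset.Ico 1 (n + 1) := by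
    intro v hv
    have h1 : 0 < (calls.map Prod.snd).count v :=
      List.count_pos_iff.2 (List.mem_toFinset.1 hv)
    have h2 := h1.trans_le (hcount v)
    rw [State.budget] at h2
    split_ifs at h2 with h3 h4
    all_goals
      simp [start] at h3
      rw [Finset.mem_Ico]
      omega
  refine (Finset.sum_le_sum fun v hv => ?_).trans (Finset.sum_le_sum_of_subset hsub)
  rw [smul_eq_mul]
  refine Nat.mul_le_mul_right _ ((hcount v).trans ?_)
  rw [State.budget]
  split_ifs
  · simp [start]
  · exact le_rfl
  · exact Nat.zero_le _
  · exact Nat.zero_le _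

end FMT

/-! ## Moments of the number of samples close to a sample -/

namespace Sampling

variable {n : ℕ}

theorem lintegral_indicator_sample {E : Type*} [MeasurableSpace E]
    {μ : Measure E} [IsProbabilityMeasure μ] {A : Set E} (hA : MeasurableSet A) (i : Fin n) :
    ∫⁻ ω, A.indicator 1 (ω i) ∂(Measure.pi fun _ : Fin n => μ) = μ A := by
  rw [(measurePreserving_eval (fun _ => μ) i).lintegral_comp (f := A.indicator 1)
    (measurable_one.indicator hA), lintegral_indicator_one hA]

theorem measurable_indicator_sample {E : Type*} [MeasurableSpace E] {A : Set E} (hA : MeasurableSet A) (i : Fin n) :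
    Measurable fun ω : Fin n → E => (A.indicator 1 (ω i) : ℝ≥0∞) :=
  (measurable_one.indicator hA).comp (measurable_pi_apply i)

variable {E : Type*} [PseudoMetricSpace E]

/-- `1` if sample `j` is at distance at most `R` from sample `i`, and `0` if not. -/
noncomputable def hit (R : ℝ) (i j : Fin n) (ω : Fin n → E) : ℝ≥0∞ :=
  (Metric.closedBall (ω i) R).indicator 1 (ω j)

/-- Two plus the number of samples in `s` at distance at most `R` from sample `i`. -/
noncomputable def crowd (R : ℝ) (i : Fin n) (s : Finset (Fin n)) (ω : Fin n → E) : ℝ≥0∞ :=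
  2 + ∑ j ∈ s, hit R i j ω

theorem hit_le_one (R : ℝ) (i j : Fin n) (ω : Fin n → E) : hit R i j ω ≤ 1 :=
  indicator_le_self' (f := (1 : E → ℝ≥0∞)) (fun _ _ => zero_le) _

theorem hit_update (R : ℝ) {i j k : Fin n} (hi : i ≠ k) (hj : j ≠ k) (ω : Fin n → E) (t : E) :
    hit R i j (Function.update ω k t) = hit R i j ω := by
  rw [hit, hit, Function.update_of_ne hi, Function.update_of_ne hj]

theorem crowd_update (R : ℝ) {i k : Fin n} {s : Finset (Fin n)} (hi : i ≠ k) (hk : k ∉ s)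
    (ω : Fin n → E) (t : E) : crowd R i s (Function.update ω k t) = crowd R i s ω := by
  rw [crowd, crowd]
  congr 1
  exact Finset.sum_congr rfl fun j hj => hit_update R hi (fun h => hk (h ▸ hj)) ω t

/-- Decoupling: a hit of sample `j` adds at most `1` to the crowd, and the crowd without `j` does
not depend on the position of sample `j`. -/
theorem crowd_mul_hit_le (R : ℝ) (i : Fin n) {j : Fin n} {s : Finset (Fin n)} (hj : j ∈ s)
    (ω : Fin n → E) :
    crowd R i s ω * hit R i j ω ≤ (1 + crowd R i (s.erase j) ω) * hit R i j ω := by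
  refine mul_le_mul_left ?_ _
  rw [crowd, crowd, ← Finset.add_sum_erase s _ hj, ← add_assoc, ← add_assoc, add_comm 1 2]
  gcongr
  exact hit_le_one R i j ω

variable [MeasurableSpace E] [OpensMeasurableSpace E] {μ : Measure E} [IsProbabilityMeasure μ]
  {R : ℝ} {q : ℝ≥0∞}

/-- One plus the number of samples at distance at most `R` from `x`. -/
noncomputable def crowdAt (R : ℝ) (x : E) (ω : Fin n → E) : ℝ≥0∞ :=
  1 + ∑ j, (Metric.closedBall x R).indicator 1 (ω j)

theorem measurable_crowdAt (R : ℝ) (x : E) : Measurable (crowdAt (n := n) R x) :=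
  measurable_const.add (Finset.measurable_sum _ fun j _ =>
    measurable_indicator_sample Metric.isClosed_closedBall.measurableSet j)

theorem lintegral_crowdAt_le (hq : ∀ x, μ (Metric.closedBall x R) ≤ q) (x : E) :
    ∫⁻ ω, crowdAt R x ω ∂(Measure.pi fun _ : Fin n => μ) ≤ 2 + n * q := by
  have hm : MeasurableSet (Metric.closedBall x R) := Metric.isClosed_closedBall.measurableSet
  simp only [crowdAt]
  rw [lintegral_add_left measurable_const, lintegral_const, measure_univ, mul_one,
    lintegral_finsetSum _ fun j _ => measurable_indicator_sample hm j]
  simp only [lintegral_indicator_sample hm]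
  rw [Finset.sum_const, Finset.card_univ, Fintype.card_fin, nsmul_eq_mul]
  gcongr
  · exact one_le_two
  · exact hq x

variable [SecondCountableTopology E]

theorem measurable_hit (R : ℝ) (i j : Fin n) : Measurable (hit (E := E) R i j) := by
  have : hit (E := E) R i j = {ω : Fin n → E | dist (ω j) (ω i) ≤ R}.indicator 1 := by
    ext ω
    simp only [hit, indicator, Metric.mem_closedBall, mem_ofPred_eq, Pi.one_apply]
  rw [this]
  exact measurable_one.indicator (measurableSet_le
    ((measurable_pi_apply j).dist (measurable_pi_apply i)) measurable_const)

theorem measurable_crowd (R : ℝ) (i : Fin n) (s : Finset (Fin n)) :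
    Measurable (crowd (E := E) R i s) :=
  measurable_const.add (Finset.measurable_sum _ fun j _ => measurable_hit R i j)

/-- By independence sample `k` may be integrated out first. The factor `f` is constant in it, and
the hit contributes the measure of a ball, which is at most `q` wherever sample `i` lies. -/
theorem lintegral_mul_hit_le (hq : ∀ x, μ (Metric.closedBall x R) ≤ q) {i k : Fin n} (hik : i ≠ k)
    {f : (Fin n → E) → ℝ≥0∞} (hf : Measurable f)
    (hfk : ∀ ω t, f (Function.update ω k t) = f ω) :
    ∫⁻ ω, f ω * hit R i k ω ∂(Measure.pi fun _ => μ) ≤ q * ∫⁻ ω, f ω ∂(Measure.pi fun _ => μ) := by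
  -- Marginal integrals are taken at a base point, which must exist.
  rcases isEmpty_or_nonempty (Fin n → E) with h | ⟨⟨x⟩⟩
  · simp
  rw [← lintegral_const_mul _ hf, lintegral_eq_lmarginal_univ x, lintegral_eq_lmarginal_univ x,
    lmarginal_erase' (fun ω => f ω * hit R i k ω) (hf.mul (measurable_hit R i k)) (Finset.mem_univ k),
    lmarginal_erase' (fun ω => q * f ω) (hf.const_mul q) (Finset.mem_univ k)]
  refine lmarginal_mono (fun ω => ?_) x
  simp only [hfk, lintegral_const, measure_univ, mul_one, hit, Function.update_of_ne hik,
    Function.update_self]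
  have hm : MeasurableSet (Metric.closedBall (ω i) R) := Metric.isClosed_closedBall.measurableSet
  rw [lintegral_const_mul _ (measurable_one.indicator hm), lintegral_indicator_one hm, mul_comm]
  exact mul_le_mul_left (hq _) _

theorem lintegral_crowd_le (hq : ∀ x, μ (Metric.closedBall x R) ≤ q) {A : Set E}
    (hA : MeasurableSet A) {i : Fin n} {s : Finset (Fin n)} (hi : i ∉ s) :
    ∫⁻ ω, A.indicator 1 (ω i) * crowd R i s ω ∂(Measure.pi fun _ => μ) ≤ μ A * (2 + n * q) := by
  have hm := measurable_indicator_sample (n := n) hA i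
  simp only [crowd, mul_add, Finset.mul_sum]
  have hh : ∀ j, Measurable fun ω : Fin n → E => A.indicator 1 (ω i) * hit R i j ω :=
    fun j => hm.mul (measurable_hit R i j)
  rw [lintegral_add_left (hm.mul_const 2), lintegral_mul_const _ hm,
    lintegral_indicator_sample hA, lintegral_finsetSum _ fun j _ => hh j]
  gcongr
  calc _ ≤ ∑ _j ∈ s, q * μ A := by
        refine Finset.sum_le_sum fun j hj => ?_
        have hij : i ≠ j := fun h => hi (h ▸ hj)
        rw [← lintegral_indicator_sample (μ := μ) hA i]
        exact lintegral_mul_hit_le hq hij hm fun ω t => by rw [Function.update_of_ne hij]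
    _ ≤ n * (q * μ A) := by
        rw [Finset.sum_const, nsmul_eq_mul]
        gcongr
        exact (Finset.card_le_univ s).trans_eq (Fintype.card_fin n)
    _ = _ := by ring

/-- One factor `crowd` is expanded into its constant `2` and the hits. In each product of the other
factor with a hit, `crowd_mul_hit_le` removes the dependence on the sample that hits, and the first
moment bound finishes the estimate. -/
theorem lintegral_crowd_sq_le (hq : ∀ x, μ (Metric.closedBall x R) ≤ q) {A : Set E}
    (hA : MeasurableSet A) {i : Fin n} {s : Finset (Fin n)} (hi : i ∉ s) :
    ∫⁻ ω, A.indicator 1 (ω i) * crowd R i s ω * crowd R i s ω ∂(Measure.pi fun _ => μ) ≤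
      2 * μ A * (2 + n * q) ^ 2 := by
  have hm := measurable_indicator_sample (n := n) hA i
  have hc := measurable_crowd (E := E) R i
  have hsplit : ∀ ω : Fin n → E, A.indicator 1 (ω i) * crowd R i s ω * crowd R i s ω =
      A.indicator 1 (ω i) * crowd R i s ω * 2 +
        ∑ j ∈ s, A.indicator 1 (ω i) * crowd R i s ω * hit R i j ω := fun ω => by
    rw [← Finset.mul_sum, ← mul_add, crowd]
  simp only [hsplit]
  have hmc : Measurable fun ω : Fin n → E => A.indicator 1 (ω i) * crowd R i s ω :=
    hm.mul (hc s)
  have hh : ∀ j, Measurable fun ω : Fin n → E =>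
      A.indicator 1 (ω i) * crowd R i s ω * hit R i j ω := fun j => hmc.mul (measurable_hit R i j)
  rw [lintegral_add_left (hmc.mul_const 2), lintegral_mul_const _ hmc,
    lintegral_finsetSum _ fun j _ => hh j]
  have hterm : ∀ j ∈ s, ∫⁻ ω, A.indicator 1 (ω i) * crowd R i s ω * hit R i j ω
      ∂(Measure.pi fun _ => μ) ≤ q * (μ A + μ A * (2 + n * q)) := by
    intro j hj
    have hij : i ≠ j := fun h => hi (h ▸ hj)
    have hf : Measurable fun ω : Fin n → E =>
        (A.indicator 1 (ω i) + A.indicator 1 (ω i) * crowd R i (s.erase j) ω : ℝ≥0∞) :=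
      hm.add (hm.mul (hc _))
    calc _ ≤ ∫⁻ ω, (A.indicator 1 (ω i) + A.indicator 1 (ω i) * crowd R i (s.erase j) ω) *
            hit R i j ω ∂(Measure.pi fun _ => μ) := by
          refine lintegral_mono fun ω => ?_
          calc _ = A.indicator 1 (ω i) * (crowd R i s ω * hit R i j ω) := mul_assoc _ _ _
            _ ≤ A.indicator 1 (ω i) * ((1 + crowd R i (s.erase j) ω) * hit R i j ω) :=
              mul_le_mul_right (crowd_mul_hit_le R i hj ω) _
            _ = _ := by ring
      _ ≤ q * ∫⁻ ω, (A.indicator 1 (ω i) + A.indicator 1 (ω i) * crowd R i (s.erase j) ω)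
            ∂(Measure.pi fun _ => μ) :=
          lintegral_mul_hit_le hq hij hf fun ω t => by
            rw [Function.update_of_ne hij, crowd_update R hij (Finset.notMem_erase j s)]
      _ ≤ _ := by
          rw [lintegral_add_left hm, lintegral_indicator_sample hA]
          gcongr
          exact lintegral_crowd_le hq hA fun h => hi (Finset.mem_of_mem_erase h)
  calc _ ≤ μ A * (2 + n * q) * 2 + ∑ _j ∈ s, q * (μ A + μ A * (2 + n * q)) :=
        add_le_add (mul_le_mul_left (lintegral_crowd_le hq hA hi) _) (Finset.sum_le_sum hterm)
    _ ≤ μ A * (2 + n * q) * 2 + n * (q * (μ A + μ A * (2 + n * q))) := by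
        rw [Finset.sum_const, nsmul_eq_mul]
        gcongr
        exact (Finset.card_le_univ s).trans_eq (Fintype.card_fin n)
    _ = μ A * (2 + n * q) ^ 2 + μ A * (n * q) := by ring
    -- A number that is at least `1` is at most its square, so `n * q ≤ 2 + n * q ≤ (2 + n * q) ^
    -- 2`.
    _ ≤ μ A * (2 + n * q) ^ 2 + μ A * (2 + n * q) ^ 2 := by
        gcongr
        refine le_add_self.trans (le_self_pow ?_ two_ne_zero)
        exact one_le_two.trans le_self_add
    _ = _ := by ring

end Sampling

/-! ## Costs in terms of the number of close nodes -/

theorem PlanningProblem.node_mem_free {d n : ℕ} {Q : PlanningProblem d}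
    {ω : Fin n → EuclideanSpace ℝ (Fin d)} (hω : ∀ i, ω i ∈ Q.free) (v : ℕ) :
    Q.node ω v ∈ Q.free := by
  cases v with
  | zero => exact Q.init_mem
  | succ k =>
    rw [PlanningProblem.node]
    split_ifs with h
    · exact hω _
    · exact Q.init_mem

theorem isClosed_unitCube (d : ℕ) : IsClosed (unitCube d) := by
  have : unitCube d = ⋂ i, ({x | 0 ≤ x i} ∩ {x | x i ≤ 1}) := by
    ext x
    simp [unitCube]
  rw [this]
  exact isClosed_iInter fun i => (isClosed_le continuous_const (by fun_prop)).inter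
    (isClosed_le (by fun_prop) continuous_const)

theorem PlanningProblem.free_subset_unitCube {d : ℕ} (Q : PlanningProblem d) :
    Q.free ⊆ unitCube d :=
  closure_minimal sdiff_subset (isClosed_unitCube d)

namespace RAM

theorem near_card_le_closeCard {d n : ℕ} {p : ℕ → EuclideanSpace ℝ (Fin d)} {r R : ℝ} (h : r ≤ R)
    (v : ℕ) : (FMT.near n p r v).card ≤ closeCard n p R v := by
  classical
  refine Finset.card_le_card fun u hu => ?_
  rw [FMT.mem_near] at hu
  exact Finset.mem_filter.2 ⟨Finset.mem_range.2 (Nat.lt_succ_of_le hu.1), hu.2.2.le.trans h⟩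

theorem closeCard_mono {d n : ℕ} {p : ℕ → EuclideanSpace ℝ (Fin d)} {r R : ℝ} (h : r ≤ R)
    (v : ℕ) : closeCard n p r v ≤ closeCard n p R v := by
  classical
  refine Finset.card_le_card fun u hu => ?_
  rw [Finset.mem_filter] at hu ⊢
  exact ⟨hu.1, hu.2.trans h⟩

/-- A bound for the number of neighbours of `v` that are examined. -/
noncomputable def degreeBound {d : ℕ} (Q : PlanningProblem d) (n : ℕ) (r : ℝ)
    (ω : Fin n → EuclideanSpace ℝ (Fin d)) (v : ℕ) : ℕ := closeCard n (Q.node ω) (4 * d * r) v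

open Classical in
/-- A bound for the number of calls to `CollisionFree` for `v`. -/
noncomputable def callBound {d : ℕ} (Q : PlanningProblem d) (n : ℕ) (r : ℝ)
    (ω : Fin n → EuclideanSpace ℝ (Fin d)) (v : ℕ) : ℕ :=
  if Q.node ω v ∈ Metric.thickening r Q.obs then degreeBound Q n r ω v else 1

variable {d n : ℕ} {Q : PlanningProblem d} {r : ℝ} {ω : Fin n → EuclideanSpace ℝ (Fin d)}

theorem near_card_le_degreeBound (hd : 0 < d) (hr : 0 ≤ r) (v : ℕ) :
    (FMT.near n (Q.node ω) r v).card ≤ degreeBound Q n r ω v := by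
  refine near_card_le_closeCard ?_ v
  have : (1 : ℝ) ≤ d := by exact_mod_cast hd
  nlinarith

/-- Used twice: `f = 1` counts the calls, and `f` equal to `weight` bounds the time charged to them.
-/
theorem run_sum_le (hd : 0 < d) (hr : 0 ≤ r) {result : Option (List ℕ)} {calls : List (ℕ × ℕ)}
    (h : FMT.IsRun Q n r ω result calls) (f : ℕ → ℕ) :
    (calls.map fun c => f c.2).sum ≤ ∑ v ∈ Finset.Ico 1 (n + 1), callBound Q n r ω v * f v := by
  classical
  refine (h.sum_le f).trans (Finset.sum_le_sum fun v _ => Nat.mul_le_mul_right _ ?_)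
  rw [callBound]
  split_ifs
  · exact near_card_le_degreeBound hd hr v
  · exact le_rfl

theorem collisionCalls_le (hd : 0 < d) (hr : 0 ≤ r) :
    FMT.collisionCalls Q n r ω ≤ ∑ v ∈ Finset.Ico 1 (n + 1), (callBound Q n r ω v : ℝ≥0∞) := by
  refine iSup_le fun result => iSup_le fun calls => iSup_le fun h => ?_
  have := run_sum_le hd hr h fun _ => 1
  simp only [List.map_const', List.sum_replicate, smul_eq_mul, mul_one] at this
  exact_mod_cast this

theorem prmStarCalls_length_le (hd : 0 < d) (hr : 0 ≤ r) :
    ((prmStarCalls n (Q.node ω) r).length : ℝ≥0∞) ≤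
      ∑ v ∈ Finset.range (n + 1), (degreeBound Q n r ω v : ℝ≥0∞) := by
  classical
  have h : (prmStarCalls n (Q.node ω) r).length =
      ∑ v ∈ Finset.range (n + 1), (FMT.near n (Q.node ω) r v).card := by
    rw [prmStarCalls, List.length_flatMap, Finset.sum_eq_multiset_sum, Finset.range_val,
      Multiset.range, Multiset.map_coe, Multiset.sum_coe]
    congr 1
    refine List.map_congr_left fun v _ => ?_
    rw [List.length_map]
    rfl
  rw [h]
  exact_mod_cast Finset.sum_le_sum fun v _ => near_card_le_degreeBound hd hr v

/-- Correctness and termination hold for every radius; only the cost estimates need `r` to be of the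
right size. -/
theorem fmtProgram_performs (hd : 0 < d) (hω : ∀ i, ω i ∈ Q.free) :
    PerformsFMT fmtProgram Q n r ω := by
  obtain ⟨L, -, t, ht, -, -, hrun⟩ := fmtProgram_spec (Q := Q) (p := Q.node ω) (r := r) (n := n)
    (fun v _ i => Q.free_subset_unitCube (Q.node_mem_free hω v) i) hd
  exact ⟨t, ht, hrun⟩

/-- Translates the specification into quantities that depend on the samples only. The condition `1 ≤
n * r` ensures that the cap of the grid at about `n` cells per coordinate does not make its cells
too wide. -/
theorem fmtProgram_cost (hd : 0 < d) (hr : 1 ≤ n * r) (hω : ∀ i, ω i ∈ Q.free) :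
    runTime fmtProgram Q n r ω ≤ (3 ^ d * 1000 * (d + 1)) *
      (∑ v ∈ Finset.range (n + 1), (2 * (degreeBound Q n r ω v : ℝ≥0∞) + (lg n + 1)) +
        ∑ v ∈ Finset.Ico 1 (n + 1), (callBound Q n r ω v : ℝ≥0∞) *
          (degreeBound Q n r ω v + (lg n + 1))) ∧
    runSpace fmtProgram Q n r ω ≤ 2 * n + 2 + (n + 1) * d + 3 ^ d +
      ∑ v ∈ Finset.range (n + 1), (degreeBound Q n r ω v : ℝ≥0∞) +
      ENNReal.ofReal (4 ^ d * (1 + (1 / r) ^ d)) := by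
  have hn : (0 : ℝ) < n := by
    rcases Nat.eq_zero_or_pos n with rfl | h
    · norm_num at hr
    · exact_mod_cast h
  have hr0 : 0 < r := pos_of_mul_pos_right (one_pos.trans_le hr) hn.le
  obtain ⟨L, hL, t, ht, htime, hspace, hrun⟩ := fmtProgram_spec (Q := Q) (p := Q.node ω) (r := r)
    (n := n) (fun v _ i => Q.free_subset_unitCube (Q.node_mem_free hω v) i) hd
  set x := (input n (Q.node ω) r).reals qCoord with hx
  have hL0 : (0 : ℝ) < 2 ^ L := by positivity
  -- Origin of the radius `4 * d * r`: two cell widths are at most `4 * r`, from `1 < 2 * 2 ^ L * r`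
  -- in one case and from `2 / 2 ^ L ≤ 2 / n ≤ 2 * r` in the other.
  have hcell : (d : ℝ) * (2 / 2 ^ L) ≤ 4 * d * r := by
    have : 2 / 2 ^ L ≤ 4 * r := by
      rw [div_le_iff₀ hL0]
      rcases hL.fine with h | h
      · have h' : (n : ℝ) ≤ 2 ^ L := by exact_mod_cast h
        nlinarith
      · nlinarith
    nlinarith [Nat.cast_nonneg (α := ℝ) d]
  have hnear : ∀ v ≤ n, nearCard x n d r v ≤ degreeBound Q n r ω v := fun v hv => by
    rw [nearCard_eq (flatDist_eq (input_coord n (Q.node ω) r)) hv]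
    exact near_card_le_degreeBound hd hr0.le v
  constructor
  · refine (iInf₂_le t ht).trans ?_
    have h1 : callWeight x n d r t.calls ≤ ∑ v ∈ Finset.Ico 1 (n + 1), callBound Q n r ω v *
        (degreeBound Q n r ω v + (lg n + 1)) := by
      refine (run_sum_le hd hr0.le hrun _).trans (Finset.sum_le_sum fun v hv => ?_)
      refine Nat.mul_le_mul_left _ ?_
      rw [weight, add_assoc]
      exact Nat.add_le_add_right (hnear v (Nat.le_of_lt_succ (Finset.mem_Ico.1 hv).2)) _
    have h2 : ∑ v ∈ Finset.range (n + 1), (weight x n d r v +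
        closeCard n (Q.node ω) (d * (2 / 2 ^ L)) v) ≤
        ∑ v ∈ Finset.range (n + 1), (2 * degreeBound Q n r ω v + (lg n + 1)) := by
      refine Finset.sum_le_sum fun v hv => ?_
      have a1 := hnear v (Nat.le_of_lt_succ (Finset.mem_range.1 hv))
      have a2 : closeCard n (Q.node ω) (d * (2 / 2 ^ L)) v ≤ degreeBound Q n r ω v :=
        closeCard_mono hcell v
      rw [weight]
      omega
    have h3 := htime.trans (Nat.mul_le_mul_left _ (Nat.add_le_add h2 h1))
    exact_mod_cast h3
  · refine (iInf₂_le t ht).trans ?_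
    -- By `coarse` the grid has a single cell or at most `1 / r` cells per coordinate; the sum
    -- covers both cases.
    have h1 : ((4 * 2 ^ L) ^ d : ℕ) ≤ ENNReal.ofReal (4 ^ d * (1 + (1 / r) ^ d)) := by
      rw [← ENNReal.ofReal_natCast]
      refine ENNReal.ofReal_le_ofReal ?_
      push_cast
      rw [mul_pow]
      refine mul_le_mul_of_nonneg_left ?_ (by positivity)
      rcases hL.coarse with h | h
      · rw [h]
        simp only [pow_zero, one_pow, le_add_iff_nonneg_right]
        positivity
      · have : (2 ^ L : ℝ) ^ d ≤ (1 / r) ^ d :=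
          pow_le_pow_left₀ hL0.le ((le_div_iff₀ hr0).2 h) d
        linarith
    have h2 : ∑ v ∈ Finset.range (n + 1), nearCard x n d r v ≤
        ∑ v ∈ Finset.range (n + 1), degreeBound Q n r ω v :=
      Finset.sum_le_sum fun v hv => hnear v (Nat.le_of_lt_succ (Finset.mem_range.1 hv))
    have h3 : (t.space : ℝ≥0∞) ≤ (2 * n + 2 + (n + 1) * d + 3 ^ d +
        ∑ v ∈ Finset.range (n + 1), degreeBound Q n r ω v + (4 * 2 ^ L) ^ d : ℕ) := by
      refine Nat.cast_le.2 (hspace.trans ?_)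
      rw [spaceBound]
      omega
    refine h3.trans ?_
    rw [Nat.cast_add _ ((4 * 2 ^ L) ^ d)]
    refine add_le_add (le_of_eq ?_) h1
    push_cast
    rfl

end RAM

/-! ## Expected costs -/

/-- A measurable majorant suffices, so neither the running time nor the worst number of calls over
all runs has to be shown measurable. -/
theorem expectation_le {Ω : Type*} [MeasurableSpace Ω] {μ : Measure Ω} {f g : Ω → ℝ≥0∞}
    (hg : Measurable g) (h : f ≤ᵐ[μ] g) : expectation μ f ≤ ∫⁻ ω, g ω ∂μ :=
  iInf_le_of_le g (iInf_le_of_le hg (iInf_le _ h))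

namespace PlanningProblem

variable {d : ℕ} (Q : PlanningProblem d)

theorem isClosed_free : IsClosed Q.free := isClosed_closure

/-- The initial condition lies in the closure of the open set of collision-free points, so this set
is not empty and has positive volume. -/
theorem volume_free_ne_zero : volume Q.free ≠ 0 := by
  have hne : (unitCube d \ Q.obs).Nonempty := closure_nonempty_iff.1 ⟨_, Q.init_mem⟩
  exact (Q.isOpen_diff.measure_pos volume hne |>.trans_le (measure_mono subset_closure)).ne'

theorem volume_free_ne_top : volume Q.free ≠ ∞ := by
  have hb : Bornology.IsBounded (unitCube d) := by
    refine Metric.isBounded_closedBall (x := (0 : EuclideanSpace ℝ (Fin d))) (r := d * 1) |>.subset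
      fun x hx => RAM.dist_le_of_coord zero_le_one fun i => ?_
    rw [PiLp.zero_apply, sub_zero, abs_le]
    exact ⟨by linarith [(hx i).1], (hx i).2⟩
  exact (hb.subset Q.free_subset_unitCube).measure_lt_top.ne

instance isProbabilityMeasure_cond :
    IsProbabilityMeasure (ProbabilityTheory.cond volume Q.free) :=
  ProbabilityTheory.cond_isProbabilityMeasure_of_finite Q.volume_free_ne_zero Q.volume_free_ne_top

instance isProbabilityMeasure_sampleLaw (n : ℕ) : IsProbabilityMeasure (Q.sampleLaw n) :=
  inferInstanceAs (IsProbabilityMeasure (Measure.pi _))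

theorem ae_mem_free (n : ℕ) : ∀ᵐ ω ∂(Q.sampleLaw n), ∀ i, ω i ∈ Q.free := by
  rw [ae_all_iff]
  intro i
  exact (measurePreserving_eval (fun _ : Fin n => ProbabilityTheory.cond volume Q.free)
    i).quasiMeasurePreserving.ae (ProbabilityTheory.ae_cond_mem Q.isClosed_free.measurableSet)

theorem cond_apply_le {B : Set (EuclideanSpace ℝ (Fin d))} {b : ℝ}
    (h : volume (Q.free ∩ B) ≤ ENNReal.ofReal b) :
    ProbabilityTheory.cond volume Q.free B ≤ ENNReal.ofReal ((volume Q.free).toReal⁻¹ * b) := by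
  rw [ProbabilityTheory.cond_apply Q.isClosed_free.measurableSet,
    ENNReal.ofReal_mul (by positivity), ENNReal.ofReal_inv_of_pos
      (ENNReal.toReal_pos Q.volume_free_ne_zero Q.volume_free_ne_top),
    ENNReal.ofReal_toReal Q.volume_free_ne_top]
  exact mul_le_mul_right h _

end PlanningProblem

namespace RAM

open Sampling

variable {d n : ℕ} {Q : PlanningProblem d} {r : ℝ}

/-- A bound for `degreeBound` at sample `i`. -/
noncomputable def neighbours (n : ℕ) (r : ℝ) (i : Fin n)
    (ω : Fin n → EuclideanSpace ℝ (Fin d)) : ℝ≥0∞ :=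
  crowd (4 * d * r) i (Finset.univ.erase i) ω

theorem closeCard_eq_sum (p : ℕ → EuclideanSpace ℝ (Fin d)) (R : ℝ) (v : ℕ) :
    (closeCard n p R v : ℝ≥0∞) =
      ∑ u ∈ Finset.range (n + 1), (Metric.closedBall (p v) R).indicator 1 (p u) := by
  classical
  rw [closeCard, Finset.card_filter]
  push_cast
  rfl

theorem node_succ (ω : Fin n → EuclideanSpace ℝ (Fin d)) (i : Fin n) :
    Q.node ω (i + 1) = ω i := by
  rw [PlanningProblem.node, dif_pos i.2]

theorem degreeBound_zero_le (ω : Fin n → EuclideanSpace ℝ (Fin d)) :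
    (degreeBound Q n r ω 0 : ℝ≥0∞) ≤ crowdAt (4 * d * r) Q.init ω := by
  rw [degreeBound, closeCard_eq_sum, Finset.sum_range_succ', Finset.sum_range, crowdAt, add_comm]
  refine add_le_add (indicator_le_self' (f := (1 : EuclideanSpace ℝ (Fin d) → ℝ≥0∞)) (fun _ _ => zero_le) _)
    (Finset.sum_le_sum fun i _ => ?_)
  rw [node_succ]
  rfl

/-- The constant `2` in `crowd` accounts for the sample itself and for the initial condition, which
is not random. -/
theorem degreeBound_succ_le (ω : Fin n → EuclideanSpace ℝ (Fin d)) (i : Fin n) :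
    (degreeBound Q n r ω (i + 1) : ℝ≥0∞) ≤ neighbours n r i ω := by
  have h1 : ∀ x y : EuclideanSpace ℝ (Fin d),
      ((Metric.closedBall x (4 * d * r)).indicator 1 y : ℝ≥0∞) ≤ 1 := fun x y =>
    indicator_le_self' (f := (1 : EuclideanSpace ℝ (Fin d) → ℝ≥0∞)) (fun _ _ => zero_le) _
  rw [degreeBound, closeCard_eq_sum, Finset.sum_range_succ', Finset.sum_range, neighbours, crowd,
    ← Finset.add_sum_erase _ _ (Finset.mem_univ i)]
  calc _ ≤ (1 + ∑ j ∈ Finset.univ.erase i, hit (4 * d * r) i j ω) + 1 := by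
        refine add_le_add (add_le_add (h1 _ _) (Finset.sum_le_sum fun j _ => ?_)) (h1 _ _)
        rw [node_succ, node_succ]
        rfl
    _ = _ := by
        rw [add_right_comm, one_add_one_eq_two]

/-- A bound for `callBound` at sample `i`. -/
noncomputable def callNumber (Q : PlanningProblem d) (n : ℕ) (r : ℝ) (i : Fin n)
    (ω : Fin n → EuclideanSpace ℝ (Fin d)) : ℝ≥0∞ :=
  1 + (Metric.thickening r Q.obs).indicator 1 (ω i) * neighbours n r i ω

theorem callBound_succ_le (ω : Fin n → EuclideanSpace ℝ (Fin d)) (i : Fin n) :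
    (callBound Q n r ω (i + 1) : ℝ≥0∞) ≤ callNumber Q n r i ω := by
  rw [callBound, node_succ, callNumber]
  split_ifs with h
  · rw [indicator_of_mem h, Pi.one_apply, one_mul]
    exact (degreeBound_succ_le ω i).trans le_add_self
  · rw [Nat.cast_one]
    exact le_self_add

theorem measurable_neighbours (i : Fin n) : Measurable (neighbours (d := d) n r i) :=
  measurable_crowd _ _ _

theorem measurable_callNumber (i : Fin n) : Measurable (callNumber Q n r i) :=
  measurable_const.add ((measurable_indicator_sample Metric.isOpen_thickening.measurableSet i).mul
    (measurable_neighbours i))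

/-- A bound for the sum of `degreeBound` over all nodes. -/
noncomputable def totalNeighbours (Q : PlanningProblem d) (n : ℕ) (r : ℝ)
    (ω : Fin n → EuclideanSpace ℝ (Fin d)) : ℝ≥0∞ :=
  crowdAt (4 * d * r) Q.init ω + ∑ i, neighbours n r i ω

theorem sum_degreeBound_le (ω : Fin n → EuclideanSpace ℝ (Fin d)) :
    ∑ v ∈ Finset.range (n + 1), (degreeBound Q n r ω v : ℝ≥0∞) ≤ totalNeighbours Q n r ω := by
  rw [Finset.sum_range_succ', Finset.sum_range, totalNeighbours, add_comm]
  exact add_le_add (degreeBound_zero_le ω) (Finset.sum_le_sum fun i _ => degreeBound_succ_le ω i)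

theorem measurable_totalNeighbours : Measurable (totalNeighbours Q n r) :=
  (measurable_crowdAt _ _).add (Finset.measurable_sum _ fun i _ => measurable_neighbours i)

theorem sum_Ico_eq_sum_fin (f : ℕ → ℝ≥0∞) :
    ∑ v ∈ Finset.Ico 1 (n + 1), f v = ∑ i : Fin n, f (i + 1) := by
  rw [Finset.sum_Ico_eq_sum_range, Nat.add_sub_cancel, Finset.sum_range]
  simp only [add_comm]

variable {q a : ℝ≥0∞}

/-- The measure of a ball of the radius that is relevant for `degreeBound` is at most `q`, and that
of the neighbourhood of the obstacles is at most `a`. -/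
structure MassBounds (Q : PlanningProblem d) (r : ℝ) (q a : ℝ≥0∞) : Prop where
  ball_le : ∀ x, ProbabilityTheory.cond volume Q.free (Metric.closedBall x (4 * d * r)) ≤ q
  thickening_le : ProbabilityTheory.cond volume Q.free (Metric.thickening r Q.obs) ≤ a

namespace MassBounds

theorem lintegral_neighbours_le (h : MassBounds Q r q a) (i : Fin n) :
    ∫⁻ ω, neighbours n r i ω ∂(Q.sampleLaw n) ≤ 2 + n * q := by
  have := lintegral_crowd_le (μ := ProbabilityTheory.cond volume Q.free) h.ball_le
    MeasurableSet.univ (Finset.notMem_erase i Finset.univ)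
  simpa [neighbours, PlanningProblem.sampleLaw] using this

theorem lintegral_totalNeighbours_le (h : MassBounds Q r q a) :
    ∫⁻ ω, totalNeighbours Q n r ω ∂(Q.sampleLaw n) ≤ (n + 1) * (2 + n * q) := by
  simp only [totalNeighbours]
  rw [lintegral_add_left (measurable_crowdAt _ _),
    lintegral_finsetSum _ fun i _ => measurable_neighbours i, add_mul, one_mul, add_comm]
  refine add_le_add ((Finset.sum_le_sum fun i _ => h.lintegral_neighbours_le i).trans_eq ?_)
    (lintegral_crowdAt_le h.ball_le _)
  rw [Finset.sum_const, Finset.card_univ, Fintype.card_fin, nsmul_eq_mul]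

theorem lintegral_near_le (h : MassBounds Q r q a) (i : Fin n) :
    ∫⁻ ω, (Metric.thickening r Q.obs).indicator 1 (ω i) * neighbours n r i ω ∂(Q.sampleLaw n) ≤
      a * (2 + n * q) :=
  (lintegral_crowd_le h.ball_le Metric.isOpen_thickening.measurableSet
    (Finset.notMem_erase i Finset.univ)).trans (mul_le_mul_left h.thickening_le _)

theorem lintegral_callNumber_le (h : MassBounds Q r q a) (i : Fin n) :
    ∫⁻ ω, callNumber Q n r i ω ∂(Q.sampleLaw n) ≤ 1 + a * (2 + n * q) := by
  simp only [callNumber]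
  rw [lintegral_add_left measurable_const, lintegral_const]
  rw [measure_univ, mul_one]
  exact add_le_add_right (h.lintegral_near_le i) _

/-- Time charged to the calls for sample `i`: one consideration costs a degree, and in the shell
there may be as many considerations as near nodes. The second moment restricted to the shell keeps
the small factor `a`. -/
theorem lintegral_callNumber_mul_le (h : MassBounds Q r q a) (i : Fin n) :
    ∫⁻ ω, callNumber Q n r i ω * neighbours n r i ω ∂(Q.sampleLaw n) ≤
      (2 + n * q) + 2 * a * (2 + n * q) ^ 2 := by
  simp only [callNumber, add_mul, one_mul]
  rw [lintegral_add_left (measurable_neighbours i)]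
  refine add_le_add (h.lintegral_neighbours_le i) ?_
  refine (lintegral_crowd_sq_le h.ball_le Metric.isOpen_thickening.measurableSet
    (Finset.notMem_erase i Finset.univ)).trans ?_
  gcongr
  exact h.thickening_le

theorem expectation_collisionCalls_le (h : MassBounds Q r q a) (hd : 0 < d) (hr : 0 ≤ r) :
    expectation (Q.sampleLaw n) (FMT.collisionCalls Q n r) ≤ n * (1 + a * (2 + n * q)) := by
  refine (expectation_le (g := fun ω => ∑ i, callNumber Q n r i ω)
    (Finset.measurable_sum _ fun i _ => measurable_callNumber i)
    (Eventually.of_forall fun ω => ?_)).trans ?_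
  · refine (collisionCalls_le hd hr).trans ?_
    rw [sum_Ico_eq_sum_fin]
    exact Finset.sum_le_sum fun i _ => callBound_succ_le ω i
  · rw [lintegral_finsetSum _ fun i _ => measurable_callNumber i]
    refine (Finset.sum_le_sum fun i _ => h.lintegral_callNumber_le i).trans_eq ?_
    rw [Finset.sum_const, Finset.card_univ, Fintype.card_fin, nsmul_eq_mul]

theorem expectation_prmStarCalls_le (h : MassBounds Q r q a) (hd : 0 < d) (hr : 0 ≤ r) :
    expectation (Q.sampleLaw n) (fun ω => ((prmStarCalls n (Q.node ω) r).length : ℝ≥0∞)) ≤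
      (n + 1) * (2 + n * q) :=
  (expectation_le measurable_totalNeighbours (Eventually.of_forall fun ω =>
    (prmStarCalls_length_le hd hr).trans (sum_degreeBound_le ω))).trans
    h.lintegral_totalNeighbours_le

theorem expectation_runSpace_le (h : MassBounds Q r q a) (hd : 0 < d) (hr : 1 ≤ n * r) :
    expectation (Q.sampleLaw n) (runSpace fmtProgram Q n r) ≤
      2 * n + 2 + (n + 1) * d + 3 ^ d + (n + 1) * (2 + n * q) +
        ENNReal.ofReal (4 ^ d * (1 + (1 / r) ^ d)) := by
  refine (expectation_le (g := fun ω => 2 * n + 2 + (n + 1) * d + 3 ^ d + totalNeighbours Q n r ω +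
    ENNReal.ofReal (4 ^ d * (1 + (1 / r) ^ d)))
    ((measurable_const.add measurable_totalNeighbours).add measurable_const) ?_).trans ?_
  · filter_upwards [Q.ae_mem_free n] with ω hω
    refine (fmtProgram_cost hd hr hω).2.trans ?_
    gcongr
    exact sum_degreeBound_le ω
  · rw [lintegral_add_right _ measurable_const, lintegral_add_left measurable_const,
      lintegral_const, lintegral_const, measure_univ, mul_one, mul_one]
    gcongr
    exact h.lintegral_totalNeighbours_le

/-- The first two summands come from preprocessing and from closing nodes, the last from
considerations, where the number of calls multiplies degree plus `lg n + 1`. -/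
theorem expectation_runTime_le (h : MassBounds Q r q a) (hd : 0 < d) (hr : 1 ≤ n * r) :
    expectation (Q.sampleLaw n) (runTime fmtProgram Q n r) ≤ (3 ^ d * 1000 * (d + 1)) *
      (2 * ((n + 1) * (2 + n * q)) + (n + 1) * (lg n + 1) +
        n * ((2 + n * q) + 2 * a * (2 + n * q) ^ 2 + (1 + a * (2 + n * q)) * (lg n + 1))) := by
  have hc := fun i : Fin n => measurable_callNumber (Q := Q) (r := r) i
  have hb := fun i : Fin n => measurable_neighbours (d := d) (r := r) i
  have m1 : ∀ i : Fin n, Measurable fun ω => callNumber Q n r i ω * neighbours n r i ω :=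
    fun i => (hc i).mul (hb i)
  have m2 : ∀ i : Fin n, Measurable fun ω => callNumber Q n r i ω * (lg n + 1) :=
    fun i => (hc i).mul_const _
  have m3 : ∀ i : Fin n, Measurable fun ω =>
      callNumber Q n r i ω * neighbours n r i ω + callNumber Q n r i ω * (lg n + 1) :=
    fun i => (m1 i).add (m2 i)
  have m4 : Measurable fun ω => 2 * totalNeighbours Q n r ω + (n + 1) * (lg n + 1) :=
    (measurable_totalNeighbours.const_mul _).add_const _
  have m5 : Measurable fun ω => ∑ i, (callNumber Q n r i ω * neighbours n r i ω +
      callNumber Q n r i ω * (lg n + 1)) := Finset.measurable_sum _ fun i _ => m3 i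
  have m6 : Measurable fun ω => 2 * totalNeighbours Q n r ω + (n + 1) * (lg n + 1) +
      ∑ i, (callNumber Q n r i ω * neighbours n r i ω + callNumber Q n r i ω * (lg n + 1)) :=
    m4.add m5
  refine (expectation_le (m6.const_mul (3 ^ d * 1000 * (d + 1))) ?_).trans ?_
  · filter_upwards [Q.ae_mem_free n] with ω hω
    refine (fmtProgram_cost hd hr hω).1.trans ?_
    rw [Finset.sum_add_distrib, ← Finset.mul_sum, Finset.sum_const, Finset.card_range,
      nsmul_eq_mul, sum_Ico_eq_sum_fin]
    push_cast
    simp only [← mul_add]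
    gcongr with i
    · exact sum_degreeBound_le ω
    · exact callBound_succ_le ω i
    · exact degreeBound_succ_le ω i
  · rw [lintegral_const_mul _ m6, lintegral_add_left m4,
      lintegral_add_right _ measurable_const, lintegral_const_mul _ measurable_totalNeighbours,
      lintegral_const, measure_univ, mul_one, lintegral_finsetSum _ fun i _ => m3 i]
    have hi : ∀ i : Fin n, ∫⁻ ω, (callNumber Q n r i ω * neighbours n r i ω +
        callNumber Q n r i ω * (lg n + 1)) ∂(Q.sampleLaw n) ≤
        (2 + n * q) + 2 * a * (2 + n * q) ^ 2 + (1 + a * (2 + n * q)) * (lg n + 1) := fun i => by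
      rw [lintegral_add_left (m1 i), lintegral_mul_const _ (hc i)]
      exact add_le_add (h.lintegral_callNumber_mul_le i)
        (mul_le_mul_left (h.lintegral_callNumber_le i) _)
    have hsum := Finset.sum_le_sum fun i (_ : i ∈ Finset.univ) => hi i
    rw [Finset.sum_const, Finset.card_univ, Fintype.card_fin, nsmul_eq_mul] at hsum
    have ht := h.lintegral_totalNeighbours_le (n := n)
    gcongr

end MassBounds

end RAM

/-! ## Growth rates -/

theorem connectionRadius_pow {γ : ℝ} {d : ℕ} (hd : 0 < d) (n : ℕ) :
    connectionRadius γ d n ^ d = γ ^ d * (Real.log n / n) := by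
  rw [connectionRadius, mul_pow, one_div,
    Real.rpow_inv_natCast_pow (div_nonneg (Real.log_natCast_nonneg n) n.cast_nonneg) hd.ne']

theorem connectionRadius_nonneg {γ : ℝ} (hγ : 0 ≤ γ) (d n : ℕ) : 0 ≤ connectionRadius γ d n :=
  mul_nonneg hγ (Real.rpow_nonneg (div_nonneg (Real.log_natCast_nonneg n) n.cast_nonneg) _)

theorem eventually_one_le_log : ∀ᶠ n : ℕ in atTop, 1 ≤ Real.log n :=
  (Real.tendsto_log_atTop.comp tendsto_natCast_atTop_atTop).eventually_ge_atTop 1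

/-- The `d`-th power of `n * r` is `n ^ (d - 2) * (n * γ ^ d) * log n`, a product of factors that
are eventually at least `1`. Splitting off `n * γ ^ d` in this way uses `d ≥ 2`. -/
theorem eventually_one_le_mul_connectionRadius {γ : ℝ} (hγ : 0 < γ) {d : ℕ} (hd : 2 ≤ d) :
    ∀ᶠ n : ℕ in atTop, 1 ≤ n * connectionRadius γ d n := by
  have h1 : ∀ᶠ n : ℕ in atTop, 1 / γ ^ d ≤ (n : ℝ) :=
    tendsto_natCast_atTop_atTop.eventually_ge_atTop _
  filter_upwards [h1, eventually_one_le_log, eventually_ge_atTop 1] with n hn hlog hn1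
  have hn1' : (1 : ℝ) ≤ n := by exact_mod_cast hn1
  have hr := connectionRadius_nonneg hγ.le d n
  refine le_of_pow_le_pow_left₀ (n := d) (by omega) (by positivity) ?_
  rw [one_pow, mul_pow, connectionRadius_pow (by omega)]
  have hγd : 0 < γ ^ d := by positivity
  obtain ⟨k, rfl⟩ := Nat.exists_eq_add_of_le' hd
  have h2 : (n : ℝ) ^ (k + 2) * (γ ^ (k + 2) * (Real.log n / n)) =
      n ^ k * (n * γ ^ (k + 2)) * Real.log n := by
    field_simp
    ring
  rw [h2]
  rw [div_le_iff₀ hγd] at hn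
  exact one_le_mul_of_one_le_of_one_le (one_le_mul_of_one_le_of_one_le (one_le_pow₀ hn1') hn) hlog

/-- After taking `d`-th powers this is `(log n) ^ (d + 1) ≤ n`. It is the estimate that makes the
extra work in the shell negligible. -/
theorem eventually_connectionRadius_mul_log_le {γ : ℝ} (hγ : 0 < γ) {d : ℕ} (hd : 0 < d) :
    ∀ᶠ n : ℕ in atTop, connectionRadius γ d n * Real.log n ≤ γ := by
  have h1 : ∀ᶠ n : ℕ in atTop, ‖Real.log n ^ (d + 1)‖ ≤ 1 * ‖(n : ℝ)‖ :=
    tendsto_natCast_atTop_atTop.eventually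
      ((Real.isLittleO_pow_log_id_atTop (n := d + 1)).bound one_pos)
  filter_upwards [h1, eventually_one_le_log, eventually_ge_atTop 1] with n hn hlog hn1
  have hn1' : (0 : ℝ) < n := by exact_mod_cast hn1
  have hr := connectionRadius_nonneg hγ.le d n
  refine le_of_pow_le_pow_left₀ (n := d) hd.ne' hγ.le ?_
  rw [mul_pow, connectionRadius_pow hd, mul_assoc]
  refine mul_le_of_le_one_right (by positivity) ?_
  rw [div_mul_eq_mul_div, div_le_one hn1', ← pow_succ']
  rwa [one_mul, Real.norm_of_nonneg (by positivity), Real.norm_of_nonneg hn1'.le] at hn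

theorem ofReal_mul_log (n : ℕ) :
    ENNReal.ofReal (n * Real.log n) = n * ENNReal.ofReal (Real.log n) := by
  rw [ENNReal.ofReal_mul n.cast_nonneg, ENNReal.ofReal_natCast]

namespace RAM

theorem lg_add_one_le {n : ℕ} (h : 1 ≤ Real.log n) : (lg n + 1 : ℝ) ≤ 6 * Real.log n := by
  have hn : 1 ≤ n := by
    by_contra hn
    rw [Nat.lt_one_iff.1 (not_le.1 hn)] at h
    norm_num at h
  have hn' : (1 : ℝ) ≤ n := by exact_mod_cast hn
  have h1 : ((2 ^ Nat.log 2 (n + 1) : ℕ) : ℝ) ≤ 2 * n := by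
    have : 2 ^ Nat.log 2 (n + 1) ≤ n + 1 := Nat.pow_log_le_self 2 (Nat.succ_ne_zero n)
    exact_mod_cast this.trans (by omega)
  have h2 := Real.log_le_log (by positivity) h1
  rw [Nat.cast_pow, Real.log_pow, Nat.cast_ofNat, Real.log_mul two_ne_zero (by positivity)] at h2
  have h3 := Real.log_two_gt_d9
  have h4 := Real.log_two_lt_d9
  rw [lg]
  push_cast
  nlinarith [Nat.cast_nonneg (α := ℝ) (Nat.log 2 (n + 1))]

/-- Balls are bounded by their full volume, which scales with `r ^ d = γ ^ d * log n / n`. The shell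
is bounded by the assumption on the surface of the obstacles, which enters nowhere else. -/
theorem exists_massBounds {d : ℕ} {Q : PlanningProblem d} (hQ : Q.FiniteObstacleSurface)
    (hd : 0 < d) {γ : ℝ} (hγ : 0 < γ) :
    ∃ c : ℝ, 0 ≤ c ∧ ∀ n : ℕ, 2 ≤ n → MassBounds Q (connectionRadius γ d n)
      (ENNReal.ofReal (c * (Real.log n / n))) (ENNReal.ofReal (c * connectionRadius γ d n)) := by
  obtain ⟨S, hS⟩ := hQ
  set κ := (volume Q.free).toReal⁻¹
  set b := (volume (Metric.ball (0 : EuclideanSpace ℝ (Fin d)) 1)).toReal with hb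
  set c₁ := κ * ((4 * d) ^ d * γ ^ d * b)
  set c₂ := κ * |S|
  have h₁ : 0 ≤ c₁ := by positivity
  have h₂ : 0 ≤ c₂ := by positivity
  refine ⟨c₁ + c₂, by positivity, fun n hn => ?_⟩
  have hlog : 0 < Real.log n := Real.log_pos (by exact_mod_cast hn)
  have hn0 : (0 : ℝ) < n := by exact_mod_cast (by omega : 0 < n)
  -- The assumption on the shell is available for positive widths only, hence `2 ≤ n`.
  have hr : 0 < connectionRadius γ d n := mul_pos hγ (Real.rpow_pos_of_pos (by positivity) _)
  constructor
  · intro x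
    have hball : volume (Q.free ∩ Metric.closedBall x (4 * d * connectionRadius γ d n)) ≤
        ENNReal.ofReal ((4 * d) ^ d * γ ^ d * b * (Real.log n / n)) := by
      refine (measure_mono inter_subset_right).trans ?_
      rw [Measure.addHaar_closedBall _ _ (by positivity), finrank_euclideanSpace_fin, mul_pow,
        connectionRadius_pow hd, ← ENNReal.ofReal_toReal measure_ball_lt_top.ne, ← hb,
        ← ENNReal.ofReal_mul (by positivity)]
      exact (congrArg ENNReal.ofReal (by ring)).le
    refine (Q.cond_apply_le hball).trans (ENNReal.ofReal_le_ofReal ?_)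
    rw [← mul_assoc]
    exact mul_le_mul_of_nonneg_right (le_add_of_nonneg_right h₂) (by positivity)
  · refine (Q.cond_apply_le (hS _ hr)).trans (ENNReal.ofReal_le_ofReal ?_)
    rw [← mul_assoc]
    refine mul_le_mul_of_nonneg_right (le_add_of_nonneg_of_le h₁ ?_) hr.le
    exact mul_le_mul_of_nonneg_left (le_abs_self S) (by positivity)

/-- The quantities on which the expected costs depend have the right order of magnitude. -/
structure Rates {d : ℕ} (Q : PlanningProblem d) (n : ℕ) (r : ℝ) (k q a : ℝ≥0∞) : Prop where
  massBounds : MassBounds Q r q a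
  radius_nonneg : 0 ≤ r
  one_le_mul : 1 ≤ n * r
  add_one_le : (n + 1 : ℝ≥0∞) ≤ 2 * n
  one_le : 1 ≤ ENNReal.ofReal (Real.log n)
  degree_le : 2 + n * q ≤ k * ENNReal.ofReal (Real.log n)
  lg_le : lg n + 1 ≤ k * ENNReal.ofReal (Real.log n)
  shell_le : a * ENNReal.ofReal (Real.log n) ≤ k
  grid_le : ENNReal.ofReal (4 ^ d * (1 + (1 / r) ^ d)) ≤ k * n

theorem exists_rates {d : ℕ} {Q : PlanningProblem d} (hQ : Q.FiniteObstacleSurface) (hd : 2 ≤ d)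
    {γ : ℝ} (hγ : 0 < γ) :
    ∃ k : ℝ, 0 ≤ k ∧ ∀ᶠ n : ℕ in atTop, ∃ q a,
      Rates Q n (connectionRadius γ d n) (ENNReal.ofReal k) q a := by
  have hd0 : 0 < d := by omega
  obtain ⟨c, hc, hmass⟩ := exists_massBounds hQ hd0 hγ
  have hγd : 0 < γ ^ d := by positivity
  -- The summands serve different fields: `6 + c` for `degree_le`, `6` for `lg_le`, `c * γ` for
  -- `shell_le`, and the last one for `grid_le`.
  set k := 6 + c + c * γ + 4 ^ d * (1 + 1 / γ ^ d) with hk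
  have hg : 0 ≤ 4 ^ d * (1 + 1 / γ ^ d) := by positivity
  have hcγ : 0 ≤ c * γ := by positivity
  have hk0 : 0 ≤ k := by positivity
  refine ⟨k, hk0, ?_⟩
  filter_upwards [eventually_one_le_mul_connectionRadius hγ hd,
    eventually_connectionRadius_mul_log_le hγ hd0, eventually_one_le_log, eventually_ge_atTop 2]
    with n h1 h2 h3 h4
  have hn : (1 : ℝ) ≤ n := by exact_mod_cast (by omega : 1 ≤ n)
  have hr := connectionRadius_nonneg hγ.le d n
  refine ⟨_, _, hmass n h4, hr, h1, ?_, ?_, ?_, ?_, ?_, ?_⟩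
  · have : n + 1 ≤ 2 * n := by omega
    exact_mod_cast this
  · exact ENNReal.one_le_ofReal.2 h3
  · rw [← ENNReal.ofReal_mul hk0, ← ENNReal.ofReal_natCast, ← ENNReal.ofReal_mul (by positivity),
      ← ENNReal.ofReal_ofNat, ← ENNReal.ofReal_add (by norm_num) (by positivity)]
    refine ENNReal.ofReal_le_ofReal ?_
    have : (n : ℝ) * (c * (Real.log n / n)) = c * Real.log n := by field_simp
    rw [this]
    nlinarith
  · rw [← ENNReal.ofReal_mul hk0, ← ENNReal.ofReal_natCast, ← ENNReal.ofReal_one,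
      ← ENNReal.ofReal_add (by positivity) one_pos.le]
    refine ENNReal.ofReal_le_ofReal ((lg_add_one_le h3).trans ?_)
    exact mul_le_mul_of_nonneg_right (by linarith) (by linarith)
  · rw [← ENNReal.ofReal_mul (by positivity)]
    refine ENNReal.ofReal_le_ofReal ?_
    rw [mul_assoc]
    exact (mul_le_mul_of_nonneg_left h2 hc).trans (by linarith)
  · rw [← ENNReal.ofReal_natCast, ← ENNReal.ofReal_mul hk0]
    refine ENNReal.ofReal_le_ofReal ?_
    have h5 : (1 / connectionRadius γ d n) ^ d ≤ 1 / γ ^ d * n := by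
      rw [one_div_pow, connectionRadius_pow hd0]
      have : 1 / (γ ^ d * (Real.log n / n)) = 1 / γ ^ d * n / Real.log n := by
        field_simp
      rw [this]
      exact div_le_self (by positivity) h3
    calc _ ≤ 4 ^ d * (1 * n + 1 / γ ^ d * n) := by
          refine mul_le_mul_of_nonneg_left (add_le_add ?_ h5) (by positivity)
          linarith
      _ = 4 ^ d * (1 + 1 / γ ^ d) * n := by ring
      _ ≤ k * n := mul_le_mul_of_nonneg_right (by linarith) (by linarith)

namespace Rates

variable {d n : ℕ} {Q : PlanningProblem d} {r : ℝ} {k q a : ℝ≥0∞}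

/-- The logarithm from the expected degree is cancelled by the probability of the shell, through
`shell_le`. -/
theorem expectation_collisionCalls_le (h : Rates Q n r k q a) (hd : 0 < d) :
    expectation (Q.sampleLaw n) (FMT.collisionCalls Q n r) ≤ (1 + k * k) * ENNReal.ofReal n := by
  rw [ENNReal.ofReal_natCast]
  refine (h.massBounds.expectation_collisionCalls_le hd h.radius_nonneg).trans ?_
  calc n * (1 + a * (2 + n * q)) ≤ n * (1 + a * (k * ENNReal.ofReal (Real.log n))) := by
        gcongr
        exact h.degree_le
    _ = n * (1 + k * (a * ENNReal.ofReal (Real.log n))) := by ring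
    _ ≤ n * (1 + k * k) := by
        gcongr
        exact h.shell_le
    _ = _ := mul_comm _ _

theorem expectation_prmStarCalls_le (h : Rates Q n r k q a) (hd : 0 < d) :
    expectation (Q.sampleLaw n) (fun ω => ((prmStarCalls n (Q.node ω) r).length : ℝ≥0∞)) ≤
      2 * k * ENNReal.ofReal (n * Real.log n) := by
  rw [ofReal_mul_log]
  refine (h.massBounds.expectation_prmStarCalls_le hd h.radius_nonneg).trans ?_
  calc (n + 1) * (2 + n * q) ≤ 2 * n * (k * ENNReal.ofReal (Real.log n)) :=
        mul_le_mul' h.add_one_le h.degree_le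
    _ = _ := by ring

theorem expectation_runSpace_le (h : Rates Q n r k q a) (hd : 0 < d) :
    expectation (Q.sampleLaw n) (runSpace fmtProgram Q n r) ≤
      (4 + 2 * d + 3 ^ d + 3 * k) * ENNReal.ofReal (n * Real.log n) := by
  rw [ofReal_mul_log]
  refine (h.massBounds.expectation_runSpace_le hd h.one_le_mul).trans ?_
  set Λ := ENNReal.ofReal (Real.log n)
  have hΛ : (n : ℝ≥0∞) ≤ n * Λ := le_mul_of_one_le_right zero_le h.one_le
  have hn : (1 : ℝ≥0∞) ≤ n := by
    rw [Nat.one_le_cast]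
    by_contra h0
    have := h.one_le_mul
    rw [Nat.lt_one_iff.1 (not_le.1 h0)] at this
    norm_num at this
  calc 2 * n + 2 + (n + 1) * d + 3 ^ d + (n + 1) * (2 + n * q) +
        ENNReal.ofReal (4 ^ d * (1 + (1 / r) ^ d))
      = 2 * (n + 1) + (n + 1) * d + 3 ^ d * 1 + (n + 1) * (2 + n * q) +
        ENNReal.ofReal (4 ^ d * (1 + (1 / r) ^ d)) := by ring
    _ ≤ 2 * (2 * (n * Λ)) + 2 * (n * Λ) * d + 3 ^ d * (n * Λ) + 2 * n * (k * Λ) + k * (n * Λ) := by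
        have h1 : (n + 1 : ℝ≥0∞) ≤ 2 * (n * Λ) := h.add_one_le.trans (by gcongr)
        gcongr
        · exact hn.trans hΛ
        · exact h.add_one_le
        · exact h.degree_le
        · exact h.grid_le.trans (by gcongr)
    _ = _ := by ring

/-- In the second moment `a * (k * Λ) ^ 2` one factor `Λ` is absorbed by `a * Λ ≤ k`, which leaves a
single logarithm. -/
theorem expectation_runTime_le (h : Rates Q n r k q a) (hd : 0 < d) :
    expectation (Q.sampleLaw n) (runTime fmtProgram Q n r) ≤
      (3 ^ d * 1000 * (d + 1)) * (8 * k + 3 * k ^ 3) * ENNReal.ofReal (n * Real.log n) := by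
  rw [ofReal_mul_log]
  refine (h.massBounds.expectation_runTime_le hd h.one_le_mul).trans ?_
  set Λ := ENNReal.ofReal (Real.log n)
  rw [mul_assoc (3 ^ d * 1000 * ((d : ℝ≥0∞) + 1))]
  refine mul_le_mul' le_rfl ?_
  calc 2 * ((n + 1) * (2 + n * q)) + (n + 1) * (lg n + 1) +
        n * ((2 + n * q) + 2 * a * (2 + n * q) ^ 2 + (1 + a * (2 + n * q)) * (lg n + 1))
      ≤ 2 * (2 * n * (k * Λ)) + 2 * n * (k * Λ) +
        n * (k * Λ + 2 * a * (k * Λ) ^ 2 + (1 + a * (k * Λ)) * (k * Λ)) := by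
        have h1 := h.add_one_le
        have h2 := h.degree_le
        have h3 := h.lg_le
        gcongr
    _ = 2 * (2 * n * (k * Λ)) + 2 * n * (k * Λ) +
        n * (k * Λ + 2 * (a * Λ) * k ^ 2 * Λ + (1 + (a * Λ) * k) * (k * Λ)) := by ring
    _ ≤ 2 * (2 * n * (k * Λ)) + 2 * n * (k * Λ) +
        n * (k * Λ + 2 * k * k ^ 2 * Λ + (1 + k * k) * (k * Λ)) := by
        have h1 := h.shell_le
        gcongr
    _ = _ := by ring

end Rates

end RAM

/-! ### Conclusion -/

theorem exists_eventually_le_ofReal {C : ℝ≥0∞} (hC : C ≠ ∞) {f : ℕ → ℝ≥0∞} {g : ℕ → ℝ}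
    (h : ∀ᶠ n in atTop, f n ≤ C * ENNReal.ofReal (g n)) :
    ∃ C : ℝ, ∀ᶠ n in atTop, f n ≤ ENNReal.ofReal (C * g n) := by
  refine ⟨C.toReal, h.mono fun n hn => hn.trans_eq ?_⟩
  rw [ENNReal.ofReal_mul ENNReal.toReal_nonneg, ENNReal.ofReal_toReal hC]

theorem theorem5 :
    ∃ P : RAM.Program,
      ∀ (d : ℕ), 2 ≤ d → ∀ (Q : PlanningProblem d), Q.FiniteObstacleSurface →
      ∀ (γ : ℝ), 0 < γ →
        (∀ (n : ℕ) (ω : Fin n → EuclideanSpace ℝ (Fin d)), (∀ i, ω i ∈ Q.free) →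
          RAM.PerformsFMT P Q n (connectionRadius γ d n) ω) ∧
        (∃ C : ℝ, ∀ᶠ n : ℕ in atTop,
          expectation (Q.sampleLaw n) (RAM.runTime P Q n (connectionRadius γ d n)) ≤
            ENNReal.ofReal (C * (n * Real.log n))) ∧
        (∃ C : ℝ, ∀ᶠ n : ℕ in atTop,
          expectation (Q.sampleLaw n) (RAM.runSpace P Q n (connectionRadius γ d n)) ≤
            ENNReal.ofReal (C * (n * Real.log n))) ∧
        (∃ C : ℝ, ∀ᶠ n : ℕ in atTop,
          expectation (Q.sampleLaw n) (FMT.collisionCalls Q n (connectionRadius γ d n)) ≤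
            ENNReal.ofReal (C * n)) ∧
        (∃ C : ℝ, ∀ᶠ n : ℕ in atTop,
          expectation (Q.sampleLaw n) (fun ω =>
              ((prmStarCalls n (Q.node ω) (connectionRadius γ d n)).length : ℝ≥0∞)) ≤
            ENNReal.ofReal (C * (n * Real.log n))) := by
  refine ⟨RAM.fmtProgram, fun d hd Q hQ γ hγ => ?_⟩
  have hd0 : 0 < d := by omega
  obtain ⟨k, hk, hrates⟩ := RAM.exists_rates hQ hd hγ
  refine ⟨fun n ω hω => RAM.fmtProgram_performs hd0 hω,
    exists_eventually_le_ofReal ?_ (hrates.mono fun n ⟨q, a, h⟩ => h.expectation_runTime_le hd0),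
    exists_eventually_le_ofReal ?_ (hrates.mono fun n ⟨q, a, h⟩ => h.expectation_runSpace_le hd0),
    exists_eventually_le_ofReal ?_
      (hrates.mono fun n ⟨q, a, h⟩ => h.expectation_collisionCalls_le hd0),
    exists_eventually_le_ofReal ?_
      (hrates.mono fun n ⟨q, a, h⟩ => h.expectation_prmStarCalls_le hd0)⟩ <;>
    finiteness
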